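/- Let $\mathbb{R}^2_+=\{X=(x,y)\in\mathbb{R}^2: y\ge 0\}$, let $\Omega\subseteq\mathbb{R}^2_+$ be relatively open (it may contain part of the axis $\{y=0\}$), and write $B_r^+(X_0)=\{X\in\mathbb{R}^2_+:|X-X_0|<r\}$, $\partial B_r^+(X_0)=\{X\in\mathbb{R}^2_+:|X-X_0|=r\}$. Let $L^2_{\mathrm w,\mathrm{loc}}(\Omega)$ be the space of measurable $g$ with $\int_K \frac1y|g|^2\,dX<\infty$ for every compact $K\subseteq\Omega$, and let $W^{1,2}_{\mathrm w,\mathrm{loc}}(\Omega)$ be the space of $g\in L^2_{\mathrm w,\mathrm{loc}}(\Omega)$ whose weak gradient (in the interior $\Omega\cap\{y>0\}$) also lies in $L^2_{\mathrm w,\mathrm{loc}}(\Omega)$. Let $(\psi,I)$ be a variational solution in $\Omega$ with constant $C_V$, that is: $\psi:\Omega\to[0,\infty)$ belongs to $W^{1,2}_{\mathrm w,\mathrm{loc}}(\Omega)\cap C^0(\Omega)\cap C^2(\Omega\cap\{\psi>0\})$, $\psi=0$ on $\Omega\cap\{y=0\}$, and $\frac1y|\nabla\psi|\le C_V$ a.e.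 in $\Omega$; $I:\Omega\to\{0,1\}$ is Borel measurable with $\chi_{\{\psi>0\}}\le I$ a.e. in $\Omega$; and for every vector field $\eta=(\eta_1,\eta_2)\in C^1_c(\Omega,\mathbb{R}^2)$ with $\eta_2=0$ on $\{y=0\}$, $$\int_\Omega\Big(\frac1y|\nabla\psi|^2+yI\Big)\operatorname{div}\eta-\frac2y\nabla\psi\cdot D\eta\,\nabla\psi-\eta_2\Big(\frac1{y^2}|\nabla\psi|^2-I\Big)\,dX=0 .$$ For $X_0=(x_0,y_0)\in\Omega$ put $\mu=\mu(X_0)=2$ if $y_0=0$ and $\mu=1$ if $y_0>0$, let $|A|_{\mathrm w}=\int_A y\,dX$, and for small $r>0$ define $$M_{X_0}(\psi,r)=r^{-\mu-1}\int_{B_r^+(X_0)}\Big(\frac1y|\nabla\psi|^2+yI\Big)dX-\mu\, r^{-\mu-2}\int_{\partial B_r^+(X_0)}\frac1y\psi^2\,d\mathcal H^1 .$$ Let $\omega(X_0)=\frac23$ if $y_0=0$ and $\omega(X_0)=\pi y_0$ if $y_0>0$. Then, for every $X_0\in\Omega$: 1. the limit $M_{X_0}(\psi,0^+)=\lim_{r\to0^+}M_{X_0}(\psi,r)$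 exists in $[-\infty,\infty]$; 2. $M_{X_0}(\psi,0^+)=-\infty$ if and only if $\psi(X_0)>0$; 3. if $\psi(X_0)=0$, then $$M_{X_0}(\psi,0^+)=\lim_{r\to0^+}\frac{\big|\{X\in B_r^+(X_0): I(X)=1\}\big|_{\mathrm w}}{r^{\mu+1}}\in[0,\omega(X_0)];$$ 4. $\omega(X_0)=r^{-\mu-1}\int_{B_r^+(X_0)}y\,dX$ for every $r>0$ if $y_0=0$, and for every $0<r<y_0$ if $y_0>0$. Moreover, the map $X_0\mapsto M_{X_0}(\psi,0^+)\in[-\infty,\infty]$ is upper semicontinuous on $\Omega$. -/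

import Mathlib

open MeasureTheory Filter Topology
open scoped ContDiff

noncomputable section

namespace AxiFlow

/-- The Euclidean plane; for a point `X` the coordinates are `x = X 0` and `y = X 1`. -/
abbrev Plane : Type := EuclideanSpace ℝ (Fin 2)

/-- The closed upper half-plane `{y ≥ 0}`. -/
def upperHalf : Set Plane := {X | 0 ≤ X 1}

/-- Open subsets of the closed upper half-plane (they may contain part of the axis `{y = 0}`). -/
def IsOpenInUpperHalf (Ω : Set Plane) : Prop :=
  ∃ U : Set Plane, IsOpen U ∧ Ω = U ∩ upperHalf

/-- `B_r⁺(X₀)`: the part of the open disc in the upper half-plane. -/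
def halfBall (X₀ : Plane) (r : ℝ) : Set Plane := Metric.ball X₀ r ∩ upperHalf

/-- `∂B_r⁺(X₀)`: the part of the circle in the upper half-plane. -/
def halfCircle (X₀ : Plane) (r : ℝ) : Set Plane := Metric.sphere X₀ r ∩ upperHalf

/-- The `i`-th coordinate vector. -/
def coordVec (i : Fin 2) : Plane := EuclideanSpace.single i 1

/-- `G` is a weak gradient of `f` in the (relatively open) set `Ω`: the test functions are smooth
with compact support in `Ω ∩ {y > 0}`, the interior of `Ω`. -/
structure IsWeakGradient (Ω : Set Plane) (f : Plane → ℝ) (G : Plane → Plane) : Prop where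
  locInt : LocallyIntegrableOn f (interior Ω)
  locInt_grad : LocallyIntegrableOn G (interior Ω)
  integral_eq : ∀ φ : Plane → ℝ, ContDiff ℝ ∞ φ → HasCompactSupport φ →
    tsupport φ ⊆ interior Ω → ∀ i : Fin 2,
      ∫ X in interior Ω, f X * fderiv ℝ φ X (coordVec i) = -∫ X in interior Ω, G X i * φ X

open Classical in
/-- The weak gradient `∇f` of `f` in `Ω` (unique up to a null set; `0` if there is none). -/
def weakGrad (Ω : Set Plane) (f : Plane → ℝ) : Plane → Plane :=
  if h : ∃ G, IsWeakGradient Ω f G then h.choose else 0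

/-- `g ∈ L²_w(K)`, the weight being `1 / y`. -/
def MemL2w {F : Type*} [NormedAddCommGroup F] (K : Set Plane) (g : Plane → F) : Prop :=
  AEStronglyMeasurable g (volume.restrict K) ∧
    IntegrableOn (fun X => (1 / X 1) * ‖g X‖ ^ 2) K

/-- `g ∈ L²_{w,loc}(Ω)`; the compact sets may touch the axis where `Ω` does. -/
def MemL2wLoc {F : Type*} [NormedAddCommGroup F] (Ω : Set Plane) (g : Plane → F) : Prop :=
  ∀ K : Set Plane, IsCompact K → K ⊆ Ω → MemL2w K g

/-- `g ∈ W^{1,2}_{w,loc}(Ω)`. -/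
structure MemW12wLoc (Ω : Set Plane) (g : Plane → ℝ) : Prop where
  memL2wLoc : MemL2wLoc Ω g
  exists_weakGradient : ∃ G, IsWeakGradient Ω g G
  grad_memL2wLoc : MemL2wLoc Ω (weakGrad Ω g)

/-- The divergence of a vector field. -/
def divergence (η : Plane → Plane) (X : Plane) : ℝ :=
  ∑ i : Fin 2, (fderiv ℝ η X (coordVec i)) i

/-- The admissible vector fields `η ∈ C¹_c(Ω, ℝ²)` with `η₂ = 0` on `{y = 0}`. A field of class `C¹`
up to the axis is given through an extension of class `C¹` to the plane; only the part of its
support in the closed upper half-plane has to lie in `Ω`. -/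
structure IsAdmissibleField (Ω : Set Plane) (η : Plane → Plane) : Prop where
  contDiff : ContDiff ℝ 1 η
  hasCompactSupport : HasCompactSupport η
  tsupport_subset : tsupport η ∩ upperHalf ⊆ Ω
  tangential : ∀ X : Plane, X 1 = 0 → η X 1 = 0

/-- The first (inner) variation, in the direction `η`, of
`J(ψ, I) = ∫_Ω (|∇ψ / y|² + I) y dX`. -/
def innerVariation (Ω : Set Plane) (ψ I : Plane → ℝ) (η : Plane → Plane) : ℝ :=
  ∫ X in Ω,
    (((1 / X 1) * ‖weakGrad Ω ψ X‖ ^ 2 + X 1 * I X) * divergence η X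
      - (2 / X 1) * inner ℝ (weakGrad Ω ψ X) (fderiv ℝ η X (weakGrad Ω ψ X))
      - η X 1 * ((1 / X 1 ^ 2) * ‖weakGrad Ω ψ X‖ ^ 2 - I X))

/-- `(ψ, I)` is a variational solution in `Ω` with constant `C`. Only the values of `ψ` and `I`
in `Ω` matter. -/
structure IsVariationalSolution (Ω : Set Plane) (C : ℝ) (ψ I : Plane → ℝ) : Prop where
  isOpen : IsOpenInUpperHalf Ω
  memW12wLoc : MemW12wLoc Ω ψ
  continuousOn : ContinuousOn ψ Ω
  contDiffOn : ContDiffOn ℝ 2 ψ (Ω ∩ {X | 0 < ψ X})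
  nonneg : ∀ X ∈ Ω, 0 ≤ ψ X
  eq_zero_axis : ∀ X ∈ Ω, X 1 = 0 → ψ X = 0
  grad_bound : ∀ᵐ X ∂(volume.restrict Ω), (1 / X 1) * ‖weakGrad Ω ψ X‖ ≤ C
  values : ∀ X ∈ Ω, I X = 0 ∨ I X = 1
  measurable : Measurable (fun X : Ω => I X)
  indicator_le : ∀ᵐ X ∂(volume.restrict Ω), {Z | 0 < ψ Z}.indicator (fun _ => (1 : ℝ)) X ≤ I X
  innerVariation_eq_zero : ∀ η, IsAdmissibleField Ω η → innerVariation Ω ψ I η = 0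

open Classical in
/-- The growth exponent `μ(X₀)`: `2` on the axis, `1` off the axis. -/
def growthExp (X₀ : Plane) : ℕ := if X₀ 1 = 0 then 2 else 1

/-- `D_{X₀}(ψ, r)`. -/
def energyD (Ω : Set Plane) (ψ I : Plane → ℝ) (X₀ : Plane) (r : ℝ) : ℝ :=
  ∫ X in halfBall X₀ r, ((1 / X 1) * ‖weakGrad Ω ψ X‖ ^ 2 + X 1 * I X)

/-- `H_{X₀}(ψ, r)`, with the one-dimensional Hausdorff measure on the circle. -/
def boundaryH (ψ : Plane → ℝ) (X₀ : Plane) (r : ℝ) : ℝ :=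
  ∫ X in halfCircle X₀ r, (1 / X 1) * ψ X ^ 2 ∂(μH[1])

/-- `M_{X₀}(ψ, r) = r^{-μ-1} D_{X₀}(ψ, r) - μ r^{-μ-2} H_{X₀}(ψ, r)`. -/
def monoM (Ω : Set Plane) (ψ I : Plane → ℝ) (X₀ : Plane) (r : ℝ) : ℝ :=
  (r ^ (growthExp X₀ + 1))⁻¹ * energyD Ω ψ I X₀ r
    - (growthExp X₀ : ℝ) * (r ^ (growthExp X₀ + 2))⁻¹ * boundaryH ψ X₀ r

/-- `M_{X₀}(ψ, 0⁺)`, the limit of `M_{X₀}(ψ, r)` as `r ↓ 0`, in `[-∞, ∞]`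
(meaningful where the limit exists). -/
def monoMZero (Ω : Set Plane) (ψ I : Plane → ℝ) (X₀ : Plane) : EReal :=
  limUnder (𝓝[>] (0 : ℝ)) (fun r : ℝ => (monoM Ω ψ I X₀ r : EReal))

/-- The weighted volume `|A|_w = ∫_A y dX`. -/
def wVol (A : Set Plane) : ℝ := ∫ X in A, X 1

open Classical in
/-- The energy upper bound `ω(X₀)`. -/
def omegaBound (X₀ : Plane) : ℝ := if X₀ 1 = 0 then 2 / 3 else X₀ 1 * Real.pi

end AxiFlow

end

open AxiFlow

/-!
Let `X₀` be a zero of `ψ`, and let `g` be the gradient of `ψ` on `{ψ > 0}`, extended by `0`. Then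
`g` represents the weak gradient, and `|g| ≤ |C| y` makes `ψ` of order `y |X - X₀|` near `X₀`. The
inner variation with fields supported in `{ψ > 0}`, where `ψ` is of class `C²`, gives
`∂ₖψ div (∇ψ / y) = 0`, and hence `div (∇ψ / y) = 0` there (`divergence_eq_zero`). Testing this
equation with `ψ φ(|X - X₀|)` and the inner variation with `φ(|X - X₀|) (X - X₀)` yields two
identities between solid and boundary integrals in polar coordinates (`MonotonicityData.flux_eq` and
`MonotonicityData.variation_eq`).

Split `M(r) = F(r) + V(r)`, where `V(r) = r ^ (-μ - 1) ∫ y I` is the density of `{I = 1}` in the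
half-disc and `F(r) = r ^ (-μ - 1) ∫ |g|² / y - μ r ^ (-μ - 2) ∫ ψ² / y` is the homogeneity defect,
its second integral being over the half-circle. The two identities show that, up to a bounded error,
`M'` is `2 r ^ (-μ - 1)` times the integral of `(∂ψ/∂ν - μ ψ / r)² / y` over the half-circle. The
first identity expresses `F` through `∂ψ/∂ν - μ ψ / r` as well, and the Cauchy-Schwarz inequality
turns this into `M' ≥ q F² / r - K` with constants `q > 0` and `K`
(`MonotonicityData.ae_deriv_monoQuantity`). As `M` is bounded below, it has a limit, and `F² / r` is
integrable at `0`; as `F` is Lipschitz in `log r`, this forces `F → 0`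
(`exists_tendsto_of_almost_monotone`). Hence `M(0⁺)` is the limit of `V`, which takes values in
`[0, ω(X₀)]`. No blow-up limits are needed.

Where `ψ > 0` the solid integral is of order `r²` and the boundary integral of order `r`, so that
`M(r) → -∞` (`tendsto_monoM_atBot`).

For upper semicontinuity (`upperSemicontinuousOn_monoMZero`) note that `M(0⁺) ≤ M(r) + K r` with a
constant `K` depending on `C` only, and that `M(r)` for a fixed `r` is upper semicontinuous along
zeros of `ψ` with the same `μ`. This leaves points off the axis that tend to a point `X₀` on the
axis: there `M(0⁺) ≤ π y → 0`, and `0` is a lower bound for the value at `X₀`.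
-/

/-! ### Functions of one real variable -/

/-- Weak form of `b(r) = ∫₀ʳ a`: it suffices to test with functions that are constant near `0` and
vanish near `R`. -/
theorem ae_eq_primitive_of_test {R : ℝ} {a b : ℝ → ℝ} (hR : 0 < R)
    (ha : IntegrableOn a (Set.Ioo 0 R)) (hb : IntegrableOn b (Set.Ioo 0 R))
    (h : ∀ φ : ℝ → ℝ, ContDiff ℝ ∞ φ →
      (∃ s t, 0 < s ∧ t < R ∧ (∀ x ≤ s, φ x = φ s) ∧ ∀ x, t ≤ x → φ x = 0) →
      ∫ x in Set.Ioo 0 R, (φ x * a x + deriv φ x * b x) = 0) :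
    ∀ᵐ r, r ∈ Set.Ioo 0 R → b r = ∫ x in (0 : ℝ)..r, a x := by
  have ha' : IntervalIntegrable a volume 0 R := by
    rwa [intervalIntegrable_iff_integrableOn_Ioo_of_le hR.le]
  have hb' : IntervalIntegrable b volume 0 R := by
    rwa [intervalIntegrable_iff_integrableOn_Ioo_of_le hR.le]
  have hAac := ha'.absolutelyContinuousOnInterval_intervalIntegral (c := 0) (by simp)
  have hAc := hAac.continuousOn
  set A : ℝ → ℝ := fun r => ∫ x in (0 : ℝ)..r, a x with hA
  have hsub : Set.Ioo 0 R ⊆ Set.uIcc 0 R := by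
    rw [Set.uIcc_of_le hR.le]; exact Set.Ioo_subset_Icc_self
  have hloc : LocallyIntegrableOn (fun r => b r - A r) (Set.Ioo 0 R) := by
    refine (hb.sub ?_).locallyIntegrableOn
    exact (hAc.integrableOn_compact isCompact_uIcc).mono_set hsub
  have key := isOpen_Ioo.ae_eq_zero_of_integral_contDiff_smul_eq_zero hloc ?_
  · filter_upwards [key] with r hr hrR
    have := hr hrR
    linarith
  intro g hg hgc hgs
  -- the support of `g` stays away from both endpoints
  obtain ⟨s, t, hs, ht, hst⟩ : ∃ s t, 0 < s ∧ t < R ∧ tsupport g ⊆ Set.Icc s t := by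
    rcases (tsupport g).eq_empty_or_nonempty with he | hne
    · exact ⟨R, 0, hR, hR, by simp [he]⟩
    · obtain ⟨s, hs, hs'⟩ := hgc.exists_isLeast hne
      obtain ⟨t, ht, ht'⟩ := hgc.exists_isGreatest hne
      exact ⟨s, t, (hgs hs).1, (hgs ht).2, fun x hx => ⟨hs' hx, ht' hx⟩⟩
  have hg0 : ∀ x, x ∉ Set.Icc s t → g x = 0 := fun x hx =>
    image_eq_zero_of_notMem_tsupport fun h' => hx (hst h')
  set φ : ℝ → ℝ := fun x => -∫ y in R..x, g y with hφ
  have hφd : ∀ x, HasDerivAt φ (-g x) x := fun x =>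
    (intervalIntegral.integral_hasDerivAt_right (hg.continuous.intervalIntegrable _ _)
      hg.continuous.stronglyMeasurable.stronglyMeasurableAtFilter
      hg.continuous.continuousAt).neg
  have hdφ : deriv φ = fun x => -g x := funext fun x => (hφd x).deriv
  have hφs : ContDiff ℝ ∞ φ := by
    rw [contDiff_infty_iff_deriv]
    exact ⟨fun x => (hφd x).differentiableAt, by rw [hdφ]; exact hg.neg⟩
  have hφt : ∀ x, t ≤ x → φ x = 0 := by
    intro x hx
    have : ∫ y in R..x, g y = ∫ y in R..x, (0 : ℝ) := by
      apply intervalIntegral.integral_congr_ae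
      filter_upwards [Measure.ae_ne volume t] with y hyt hy
      apply hg0
      rintro ⟨-, h2⟩
      rcases Set.mem_uIoc.1 hy with h3 | h3
      · linarith [h3.1]
      · exact hyt (le_antisymm h2 (hx.trans h3.1.le))
    simp [hφ, this]
  have hφs0 : ∀ x ≤ s, φ x = φ s := by
    intro x hx
    have : ∫ y in x..s, g y = ∫ y in x..s, (0 : ℝ) := by
      apply intervalIntegral.integral_congr_ae
      filter_upwards [Measure.ae_ne volume s] with y hyt hy
      apply hg0
      rw [Set.uIoc_of_le hx] at hy
      rintro ⟨h1, -⟩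
      exact hyt (le_antisymm hy.2 h1)
    have h2 := intervalIntegral.integral_add_adjacent_intervals
      (hg.continuous.intervalIntegrable (μ := volume) R x)
      (hg.continuous.intervalIntegrable (μ := volume) x s)
    simp only [hφ]
    rw [← h2, this]; simp
  have h0 := h φ hφs ⟨s, t, hs, ht, hφs0, hφt⟩
  -- integrate `φ * a` by parts
  have hφac : AbsolutelyContinuousOnInterval φ 0 R :=
    (hφs.of_le (by simp)).contDiffOn.absolutelyContinuousOnInterval
  have hibp := hφac.integral_mul_deriv_eq_deriv_mul hAac
  have e1 : ∫ x in (0 : ℝ)..R, φ x * deriv A x = ∫ x in (0 : ℝ)..R, φ x * a x := by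
    apply intervalIntegral.integral_congr_ae
    filter_upwards [ha'.ae_hasDerivAt_integral] with x hx hxm
    rw [(hx (Set.uIoc_subset_uIcc hxm) 0 (by simp)).deriv]
  have hφR : φ R = 0 := hφt R ht.le
  have hA0 : A 0 = 0 := by simp [hA]
  rw [e1, hφR, hA0, hdφ] at hibp
  rw [← integral_Ioc_eq_integral_Ioo, ← intervalIntegral.integral_of_le hR.le] at h0
  have i1 : IntervalIntegrable (fun x => φ x * a x) volume 0 R :=
    ha'.continuousOn_mul hφs.continuous.continuousOn
  have i2 : IntervalIntegrable (fun x => deriv φ x * b x) volume 0 R := by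
    rw [hdφ]; exact hb'.continuousOn_mul hg.continuous.neg.continuousOn
  rw [intervalIntegral.integral_add i1 i2, hibp, hdφ] at h0
  have i3 : IntervalIntegrable (fun x => g x * b x) volume 0 R :=
    hb'.continuousOn_mul hg.continuous.continuousOn
  have i4 : IntervalIntegrable (fun x => g x * A x) volume 0 R :=
    (hAc.intervalIntegrable).continuousOn_mul hg.continuous.continuousOn
  have e2 : ∫ x, g x • (b x - A x) = ∫ x in (0 : ℝ)..R, g x * (b x - A x) := by
    rw [intervalIntegral.integral_of_le hR.le, setIntegral_eq_integral_of_forall_compl_eq_zero]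
    · simp
    · intro x hx
      rw [hg0 x, zero_mul]
      intro hx'
      exact hx ⟨hs.trans_le hx'.1, hx'.2.trans ht.le⟩
  rw [e2]
  simp only [mul_sub]
  rw [intervalIntegral.integral_sub i3 i4]
  simp only [neg_mul, intervalIntegral.integral_neg] at h0
  linarith

/-- A lower bound on the almost everywhere derivative of an absolutely continuous function
integrates. -/
theorem integral_le_sub_of_ae_hasDerivAt {a b : ℝ} (hab : a ≤ b) {M q : ℝ → ℝ}
    (hM : AbsolutelyContinuousOnInterval M a b) (hq : IntervalIntegrable q volume a b)
    (h : ∀ᵐ x, x ∈ Set.Ioo a b → ∃ m, HasDerivAt M m x ∧ q x ≤ m) :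
    ∫ x in a..b, q x ≤ M b - M a := by
  rw [← hM.integral_deriv_eq_sub]
  apply intervalIntegral.integral_mono_ae_restrict hab hq hM.intervalIntegrable_deriv
  rw [EventuallyLE, ← Measure.restrict_congr_set (Ioo_ae_eq_Icc (μ := volume)),
    ae_restrict_iff' measurableSet_Ioo]
  filter_upwards [h] with x hx hxm
  obtain ⟨m, hm, hle⟩ := hx hxm
  rwa [hm.deriv]

/-- An almost monotone function `M` whose increments control `∫ F² / x`, where `F` is Lipschitz in
the logarithmic variable, has a limit at `0`, and `F` tends to `0`. -/
theorem exists_tendsto_of_almost_monotone {M F : ℝ → ℝ} {R c K L B : ℝ} (hR : 0 < R) (hc : 0 < c)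
    (hL : 0 ≤ L) (hK : 0 ≤ K)
    (hFc : ContinuousOn F (Set.Ioo 0 R))
    (hM : ∀ a b, 0 < a → a ≤ b → b < R →
      c * ∫ x in a..b, F x ^ 2 / x ≤ M b - M a + K * (b - a))
    (hF : ∀ a b, 0 < a → a ≤ b → b < R → |F b - F a| ≤ L * (b - a) / a)
    (hB : ∀ r ∈ Set.Ioo 0 R, B ≤ M r) :
    ∃ l, Tendsto M (𝓝[>] 0) (𝓝 l) ∧ Tendsto F (𝓝[>] 0) (𝓝 0) ∧
      ∀ r ∈ Set.Ioo 0 R, l ≤ M r + K * r := by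
  set N : ℝ → ℝ := fun r => M r + K * r with hN
  have hint : ∀ a b, 0 < a → a ≤ b → 0 ≤ ∫ x in a..b, F x ^ 2 / x := by
    intro a b ha hab
    apply intervalIntegral.integral_nonneg hab
    intro x hx
    have := ha.trans_le hx.1
    positivity
  have hmono : ∀ a b, 0 < a → a ≤ b → b < R → N a ≤ N b := by
    intro a b ha hab hb
    have h1 := hM a b ha hab hb
    have h2 := mul_nonneg hc.le (hint a b ha hab)
    simp only [hN]; nlinarith
  -- the limit is the infimum
  set l := sInf (N '' Set.Ioo 0 R) with hl
  have hbdd : BddBelow (N '' Set.Ioo 0 R) := by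
    refine ⟨B, ?_⟩
    rintro _ ⟨r, hr, rfl⟩
    have := hB r hr
    have := mul_nonneg hK hr.1.le
    simp only [hN]; linarith
  have hle : ∀ r ∈ Set.Ioo 0 R, l ≤ N r := fun r hr => csInf_le hbdd ⟨r, hr, rfl⟩
  have hNlim : Tendsto N (𝓝[>] 0) (𝓝 l) := by
    rw [Metric.tendsto_nhds]
    intro ε hε
    obtain ⟨_, ⟨r, hr, rfl⟩, hlt⟩ := exists_lt_of_csInf_lt
      (⟨N (R / 2), R / 2, ⟨by linarith, by linarith⟩, rfl⟩ : (N '' Set.Ioo 0 R).Nonempty)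
      (show sInf (N '' Set.Ioo 0 R) < l + ε by linarith)
    filter_upwards [Ioo_mem_nhdsGT hr.1] with x hx
    have h1 := hle x ⟨hx.1, hx.2.trans hr.2⟩
    have h2 := hmono x r hx.1 hx.2.le hr.2
    rw [Real.dist_eq, abs_lt]
    constructor <;> linarith
  have hKr : Tendsto (fun r : ℝ => K * r) (𝓝[>] 0) (𝓝 0) := by
    have : Tendsto (fun r : ℝ => K * r) (𝓝 0) (𝓝 (K * 0)) :=
      (continuous_const.mul continuous_id).tendsto 0
    rw [mul_zero] at this
    exact this.mono_left nhdsWithin_le_nhds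
  refine ⟨l, ?_, ?_, hle⟩
  · have := hNlim.sub hKr
    simpa [hN] using this
  -- if `|F r| ≥ ε` then `|F| ≥ ε / 2` on `[r, (1 + δ) r]`, which costs a fixed amount of `N`
  rw [Metric.tendsto_nhds]
  intro ε hε
  set δ : ℝ := min 1 (ε / (2 * (L + 1))) with hδ
  have hδ0 : 0 < δ := by positivity
  have hδL : L * δ ≤ ε / 2 := by
    have h1 : δ ≤ ε / (2 * (L + 1)) := min_le_right _ _
    rw [le_div_iff₀ (by positivity)] at h1
    nlinarith
  have hδ1 : δ ≤ 1 := min_le_left _ _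
  set q : ℝ := c * ((ε / 2) ^ 2 / 2 * δ) with hq
  have hq0 : 0 < q := by positivity
  have hscale : Tendsto (fun r : ℝ => (1 + δ) * r) (𝓝[>] 0) (𝓝[>] 0) := by
    apply tendsto_nhdsWithin_of_tendsto_nhds_of_eventually_within
    · have : Tendsto (fun r : ℝ => (1 + δ) * r) (𝓝 0) (𝓝 ((1 + δ) * 0)) :=
        (continuous_const.mul continuous_id).tendsto 0
      rw [mul_zero] at this
      exact this.mono_left nhdsWithin_le_nhds
    · filter_upwards [self_mem_nhdsWithin] with r hr
      exact mul_pos (show (0 : ℝ) < 1 + δ by linarith) hr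
  have hdiff : Tendsto (fun r => N ((1 + δ) * r) - N r) (𝓝[>] 0) (𝓝 0) := by
    simpa using (hNlim.comp hscale).sub hNlim
  filter_upwards [hdiff.eventually (gt_mem_nhds hq0), Ioo_mem_nhdsGT (show 0 < R / 2 by linarith)]
    with r hr hrR
  rw [Real.dist_eq, sub_zero]
  by_contra hcon
  push Not at hcon
  have hr0 := hrR.1
  have hb : (1 + δ) * r < R := by nlinarith [hrR.2]
  have hab : r ≤ (1 + δ) * r := by nlinarith
  have h1 := hM r ((1 + δ) * r) hr0 hab hb
  have hlow : ∀ x ∈ Set.Icc r ((1 + δ) * r), (ε / 2) ^ 2 / (2 * r) ≤ F x ^ 2 / x := by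
    intro x hx
    have hx0 := hr0.trans_le hx.1
    have h2 := hF r x hr0 hx.1 (hx.2.trans_lt hb)
    have h3 : L * (x - r) / r ≤ ε / 2 := by
      rw [div_le_iff₀ hr0]
      have : x - r ≤ δ * r := by linarith [hx.2]
      have := mul_le_mul_of_nonneg_left this hL
      nlinarith
    have h4 : ε / 2 ≤ |F x| := by
      have := abs_sub_abs_le_abs_sub (F r) (F x)
      rw [abs_sub_comm] at this
      linarith
    have h5 : (ε / 2) ^ 2 ≤ F x ^ 2 := by
      rw [← sq_abs (F x)]
      gcongr
    have h6 : x ≤ 2 * r := by nlinarith [hx.2]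
    gcongr
  have hFi : IntervalIntegrable (fun x => F x ^ 2 / x) volume r ((1 + δ) * r) := by
    apply ContinuousOn.intervalIntegrable
    rw [Set.uIcc_of_le hab]
    apply ContinuousOn.div
    · exact (hFc.mono fun x hx => ⟨hr0.trans_le hx.1, hx.2.trans_lt hb⟩).pow 2
    · exact continuousOn_id
    · exact fun x hx => (hr0.trans_le hx.1).ne'
  have h7 := intervalIntegral.integral_mono_on hab (by simp) hFi hlow
  rw [intervalIntegral.integral_const, smul_eq_mul] at h7
  have h8 : ((1 + δ) * r - r) * ((ε / 2) ^ 2 / (2 * r)) = (ε / 2) ^ 2 / 2 * δ := by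
    field_simp
    ring
  rw [h8] at h7
  have h9 := mul_le_mul_of_nonneg_left h7 hc.le
  simp only [hN] at hr
  rw [← hq] at h9
  linarith

/-! ### Polar coordinates and arc length -/

/-- The point with polar coordinates `(r, θ)` around `X₀`. -/
noncomputable def polarPt (X₀ : Plane) (r θ : ℝ) : Plane :=
  X₀ + !₂[r * Real.cos θ, r * Real.sin θ]

open Classical in
/-- The angles, up to null sets, of the points of a half-disc around `X₀` (when it is centred on the
axis) or of a disc around `X₀` (when it stays off the axis). -/
noncomputable def polarAngles (X₀ : Plane) : Set ℝ :=
  if X₀ 1 = 0 then Set.Ioo 0 Real.pi else Set.Ioo (-Real.pi) Real.pi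

@[simp] theorem polarPt_zero (X₀ : Plane) (r θ : ℝ) :
    polarPt X₀ r θ 0 = X₀ 0 + r * Real.cos θ := by simp [polarPt]

@[simp] theorem polarPt_one (X₀ : Plane) (r θ : ℝ) :
    polarPt X₀ r θ 1 = X₀ 1 + r * Real.sin θ := by simp [polarPt]

theorem polarPt_sub (X₀ : Plane) (r θ : ℝ) :
    polarPt X₀ r θ - X₀ = !₂[r * Real.cos θ, r * Real.sin θ] := by simp [polarPt]

theorem continuous_polarPt : Continuous fun p : Plane × ℝ × ℝ => polarPt p.1 p.2.1 p.2.2 := by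
  unfold polarPt
  fun_prop

theorem hasDerivAt_polarPt (X₀ : Plane) (r θ : ℝ) :
    HasDerivAt (fun r => polarPt X₀ r θ) (!₂[Real.cos θ, Real.sin θ] : Plane) r := by
  have e : (fun r => polarPt X₀ r θ) = fun r => X₀ + r • (!₂[Real.cos θ, Real.sin θ] : Plane) := by
    funext r; ext i; fin_cases i <;> simp [polarPt]
  rw [e]
  have := ((hasDerivAt_id r).smul_const (!₂[Real.cos θ, Real.sin θ] : Plane)).const_add X₀
  rwa [one_smul] at this

theorem dist_polarPt_center (X₀ : Plane) {r : ℝ} (hr : 0 ≤ r) (θ : ℝ) :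
    dist (polarPt X₀ r θ) X₀ = r := by
  rw [dist_eq_norm, polarPt_sub, EuclideanSpace.norm_eq, Fin.sum_univ_two]
  simp only [Real.norm_eq_abs, sq_abs]
  have : (!₂[r * Real.cos θ, r * Real.sin θ] : Plane) 0 ^ 2
      + (!₂[r * Real.cos θ, r * Real.sin θ] : Plane) 1 ^ 2 = r ^ 2 := by
    simp
    nlinarith [Real.sin_sq_add_cos_sq θ]
  rw [this, Real.sqrt_sq hr]

theorem dist_polarPt (X₀ : Plane) {r : ℝ} (hr : 0 ≤ r) (s t : ℝ) :
    dist (polarPt X₀ r s) (polarPt X₀ r t) = 2 * r * |Real.sin ((s - t) / 2)| := by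
  rw [EuclideanSpace.dist_eq, Fin.sum_univ_two]
  have : dist (polarPt X₀ r s 0) (polarPt X₀ r t 0) ^ 2
      + dist (polarPt X₀ r s 1) (polarPt X₀ r t 1) ^ 2
      = (2 * r * |Real.sin ((s - t) / 2)|) ^ 2 := by
    simp only [Real.dist_eq, sq_abs, polarPt_zero, polarPt_one, mul_pow]
    have h1 := Real.cos_sq ((s - t) / 2)
    rw [mul_div_cancel₀ _ (two_ne_zero' ℝ)] at h1
    have h2 := Real.sin_sq_add_cos_sq ((s - t) / 2)
    have h3 := Real.cos_sub s t
    have h4 := Real.sin_sq_add_cos_sq s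
    have h5 := Real.sin_sq_add_cos_sq t
    have h6 : Real.sin ((s - t) / 2) ^ 2 = 1 / 2 - (Real.cos s * Real.cos t
      + Real.sin s * Real.sin t) / 2 := by rw [← h3]; linarith
    rw [h6]
    have : (X₀ 0 + r * Real.cos s - (X₀ 0 + r * Real.cos t)) ^ 2
        + (X₀ 1 + r * Real.sin s - (X₀ 1 + r * Real.sin t)) ^ 2
        = r ^ 2 * ((Real.sin s ^ 2 + Real.cos s ^ 2) + (Real.sin t ^ 2 + Real.cos t ^ 2)
          - 2 * (Real.cos s * Real.cos t + Real.sin s * Real.sin t)) := by ring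
    rw [this, h4, h5]; ring
  rw [this, Real.sqrt_sq (by positivity)]

theorem lipschitzWith_polarPt (X₀ : Plane) {r : ℝ} (hr : 0 ≤ r) :
    LipschitzWith r.toNNReal (polarPt X₀ r) := by
  apply LipschitzWith.of_dist_le_mul
  intro s t
  rw [dist_polarPt X₀ hr, Real.coe_toNNReal r hr, Real.dist_eq]
  have : |Real.sin ((s - t) / 2)| ≤ |(s - t) / 2| := Real.abs_sin_le_abs
  rw [abs_div, abs_two] at this
  nlinarith

theorem injOn_polarPt (X₀ : Plane) {r : ℝ} (hr : 0 < r) :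
    Set.InjOn (polarPt X₀ r) (Set.Ioc (-Real.pi) Real.pi) := by
  intro s hs t ht hst
  have h := dist_polarPt X₀ hr.le s t
  rw [hst, dist_self] at h
  have h1 : Real.sin ((s - t) / 2) = 0 := by
    rcases mul_eq_zero.1 h.symm with h2 | h2
    · linarith
    · simpa using h2
  rw [Real.sin_eq_zero_iff_of_lt_of_lt (by linarith [hs.1, ht.2]) (by linarith [hs.2, ht.1])] at h1
  linarith

theorem sphere_subset_image_polarPt (X₀ : Plane) (r : ℝ) :
    Metric.sphere X₀ r ⊆ polarPt X₀ r '' Set.Ioc (-Real.pi) Real.pi := by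
  intro X hX
  set z : ℂ := ⟨X 0 - X₀ 0, X 1 - X₀ 1⟩ with hz
  have hzn : ‖z‖ = r := by
    rw [Metric.mem_sphere, EuclideanSpace.dist_eq, Fin.sum_univ_two] at hX
    rw [← hX, Complex.norm_def, Complex.normSq_apply]
    simp only [Real.dist_eq, sq_abs, hz]
    congr 1; ring
  refine ⟨z.arg, Complex.arg_mem_Ioc z, ?_⟩
  have h1 := Complex.norm_mul_cos_arg z
  have h2 := Complex.norm_mul_sin_arg z
  rw [hzn] at h1 h2
  ext i
  fin_cases i
  · change polarPt X₀ r z.arg 0 = X 0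
    rw [polarPt_zero, h1]; ring
  · change polarPt X₀ r z.arg 1 = X 1
    rw [polarPt_one, h2]; ring

/-- Arc length on a circle is one-dimensional Hausdorff measure: the parametrization by the angle
expands lengths by at most `r`, and on short arcs by almost `r`. -/
theorem hausdorffMeasure_image_polarPt (X₀ : Plane) {r : ℝ} (hr : 0 < r) {A : Set ℝ}
    (hA : MeasurableSet A) (hAs : A ⊆ Set.Ioc (-Real.pi) Real.pi) :
    μH[1] (polarPt X₀ r '' A) = ENNReal.ofReal r * volume A := by
  apply le_antisymm
  · have := (lipschitzWith_polarPt X₀ hr.le).hausdorffMeasure_image_le zero_le_one A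
    simpa [hausdorffMeasure_real, ENNReal.ofReal] using this
  have key : ∀ ε : ℝ, 0 < ε → ε ≤ 1 →
      ENNReal.ofReal r * volume A ≤ ENNReal.ofReal (1 + ε) * μH[1] (polarPt X₀ r '' A) := by
    intro ε hε hε1
    have hsin : ∀ x : ℝ, |x| ≤ ε → |x| ≤ (1 + ε) * (2 * |Real.sin (x / 2)|) := by
      intro x hx
      rcases eq_or_ne x 0 with rfl | hx0
      · simp
      have hp : 0 < |x| / 2 := by positivity
      have h1 := Real.sin_gt_sub_cube hp
      have h2 : |Real.sin (x / 2)| = |Real.sin (|x| / 2)| := by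
        rcases abs_choice x with h | h <;> rw [h]
        rw [neg_div, Real.sin_neg, abs_neg]
      have h3 := le_abs_self (Real.sin (|x| / 2))
      rw [h2]
      set a := |x| with ha
      have ha0 : 0 ≤ a := abs_nonneg x
      have ha2 : a ^ 2 ≤ ε := by nlinarith
      have h4 : a / 2 * (1 - ε / 16) ≤ |Real.sin (a / 2)| := by
        have : (a / 2) ^ 3 / 6 = a / 2 * (a ^ 2 / 24) := by ring
        nlinarith [mul_le_mul_of_nonneg_left ha2 ha0]
      have h5 : 1 ≤ (1 + ε) * (1 - ε / 16) := by nlinarith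
      nlinarith [abs_nonneg x]
    set P : ℤ → Set ℝ := fun k => A ∩ {x | ⌊x / ε⌋ = k} with hP
    have hPm : ∀ k, MeasurableSet (P k) := fun k =>
      hA.inter ((Int.measurable_floor.comp (measurable_id.div_const ε)) (measurableSet_singleton k))
    have hPd : Pairwise (Function.onFun Disjoint P) := by
      intro i j hij
      refine Set.disjoint_left.2 fun x hx hx' => hij ?_
      exact hx.2.symm.trans hx'.2
    have hPU : ⋃ k, P k = A := by
      ext x; simp [hP]
    have hPs : ∀ k, P k ⊆ Set.Ioc (-Real.pi) Real.pi := fun k => Set.inter_subset_left.trans hAs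
    have hclose : ∀ k, ∀ s ∈ P k, ∀ t ∈ P k, |s - t| ≤ ε := by
      intro k s hs t ht
      have h1 : ⌊s / ε⌋ = ⌊t / ε⌋ := hs.2.trans ht.2.symm
      have h2 := Int.abs_sub_lt_one_of_floor_eq_floor h1
      rw [← sub_div, abs_div, abs_of_pos hε, div_lt_one hε] at h2
      exact h2.le
    have hPk : ∀ k, ENNReal.ofReal r * volume (P k)
        ≤ ENNReal.ofReal (1 + ε) * μH[1] (polarPt X₀ r '' P k) := by
      intro k
      have hinj : Set.InjOn (polarPt X₀ r) (P k) := (injOn_polarPt X₀ hr).mono (hPs k)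
      have hlip : LipschitzOnWith ((1 + ε) / r).toNNReal (Function.invFunOn (polarPt X₀ r) (P k))
          (polarPt X₀ r '' P k) := by
        apply LipschitzOnWith.of_dist_le_mul
        rintro _ ⟨s, hs, rfl⟩ _ ⟨t, ht, rfl⟩
        rw [hinj.leftInvOn_invFunOn hs, hinj.leftInvOn_invFunOn ht, dist_polarPt X₀ hr.le,
          Real.coe_toNNReal _ (by positivity), Real.dist_eq]
        have := hsin _ (hclose k s hs t ht)
        calc |s - t| ≤ (1 + ε) * (2 * |Real.sin ((s - t) / 2)|) := this
          _ = _ := by field_simp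
      have h1 := hlip.hausdorffMeasure_image_le zero_le_one
      rw [hinj.leftInvOn_invFunOn.image_image, hausdorffMeasure_real, ENNReal.rpow_one] at h1
      calc ENNReal.ofReal r * volume (P k)
          ≤ ENNReal.ofReal r * (ENNReal.ofReal ((1 + ε) / r) * μH[1] (polarPt X₀ r '' P k)) := by
            gcongr; exact h1
        _ = _ := by
            rw [← mul_assoc, ← ENNReal.ofReal_mul hr.le, mul_div_cancel₀ _ hr.ne']
    have himm : ∀ k, MeasurableSet (polarPt X₀ r '' P k) := fun k =>
      (hPm k).image_of_continuousOn_injOn (lipschitzWith_polarPt X₀ hr.le).continuous.continuousOn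
        ((injOn_polarPt X₀ hr).mono (hPs k))
    have himd : Pairwise (Function.onFun Disjoint fun k => polarPt X₀ r '' P k) := by
      intro i j hij
      exact (hPd hij).image (injOn_polarPt X₀ hr) (hPs i) (hPs j)
    rw [← hPU, Set.image_iUnion, measure_iUnion hPd hPm, measure_iUnion himd himm,
      ← ENNReal.tsum_mul_left, ← ENNReal.tsum_mul_left]
    exact ENNReal.tsum_le_tsum hPk
  have hlim : Tendsto (fun ε : ℝ => ENNReal.ofReal (1 + ε) * μH[1] (polarPt X₀ r '' A)) (𝓝[>] 0)
      (𝓝 (ENNReal.ofReal (1 + 0) * μH[1] (polarPt X₀ r '' A))) := by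
    apply ENNReal.Tendsto.mul_const
    · exact (ENNReal.continuous_ofReal.comp
        (continuous_const.add continuous_id)).continuousAt.tendsto.mono_left nhdsWithin_le_nhds
    · left; simp
  simp only [add_zero, ENNReal.ofReal_one, one_mul] at hlim
  refine ge_of_tendsto hlim ?_
  filter_upwards [Ioc_mem_nhdsGT (show (0 : ℝ) < 1 by norm_num)] with ε hε
  exact key ε hε.1 hε.2

theorem restrict_sphere_hausdorffMeasure (X₀ : Plane) {r : ℝ} (hr : 0 < r) :
    (μH[1] : Measure Plane).restrict (Metric.sphere X₀ r)
      = ENNReal.ofReal r • (volume.restrict (Set.Ioo (-Real.pi) Real.pi)).map (polarPt X₀ r) := by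
  have hm : Measurable (polarPt X₀ r) := (lipschitzWith_polarPt X₀ hr.le).continuous.measurable
  rw [Measure.restrict_congr_set (Ioo_ae_eq_Ioc (μ := volume))]
  ext S hS
  rw [Measure.restrict_apply hS, Measure.smul_apply, Measure.map_apply hm hS,
    Measure.restrict_apply (hm hS), smul_eq_mul,
    ← hausdorffMeasure_image_polarPt X₀ hr ((hm hS).inter measurableSet_Ioc)
      Set.inter_subset_right]
  congr 1
  ext X
  constructor
  · rintro ⟨h1, h2⟩
    obtain ⟨θ, hθ, rfl⟩ := sphere_subset_image_polarPt X₀ r h2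
    exact ⟨θ, ⟨h1, hθ⟩, rfl⟩
  · rintro ⟨θ, ⟨h1, hθ⟩, rfl⟩
    exact ⟨h1, dist_polarPt_center X₀ hr.le θ⟩

theorem measurableSet_polarAngles (X₀ : Plane) : MeasurableSet (polarAngles X₀) := by
  unfold polarAngles; split_ifs <;> exact measurableSet_Ioo

theorem polarAngles_subset (X₀ : Plane) : polarAngles X₀ ⊆ Set.Ioo (-Real.pi) Real.pi := by
  unfold polarAngles
  split_ifs
  · exact Set.Ioo_subset_Ioo_left (by linarith [Real.pi_pos])
  · exact subset_rfl

theorem volume_polarAngles_lt_top (X₀ : Plane) : volume (polarAngles X₀) < ⊤ :=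
  (measure_mono (polarAngles_subset X₀)).trans_lt (by simp)

instance isFiniteMeasure_polarAngles (X₀ : Plane) :
    IsFiniteMeasure (volume.restrict (polarAngles X₀)) :=
  ⟨by simpa using volume_polarAngles_lt_top X₀⟩

theorem volume_real_polarAngles_le (X₀ : Plane) :
    (volume.restrict (polarAngles X₀)).real Set.univ ≤ 2 * Real.pi := by
  rw [Measure.real, Measure.restrict_apply_univ]
  have := measure_mono (μ := volume) (polarAngles_subset X₀)
  rw [Real.volume_Ioo] at this
  calc _ ≤ (ENNReal.ofReal (Real.pi - -Real.pi)).toReal := ENNReal.toReal_mono (by simp) this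
    _ = 2 * Real.pi := by rw [ENNReal.toReal_ofReal (by linarith [Real.pi_pos])]; ring

/-- The points of the half-disc of radius `R` around `X₀` off the axis. -/
def openHalfBall (X₀ : Plane) (R : ℝ) : Set Plane := Metric.ball X₀ R ∩ {X | 0 < X 1}

theorem continuous_coord (i : Fin 2) : Continuous fun X : Plane => X i := by fun_prop

theorem measurable_coord (i : Fin 2) : Measurable fun X : Plane => X i :=
  (continuous_coord i).measurable

theorem abs_coord_sub_le (X Z : Plane) : |X 1 - Z 1| ≤ dist X Z := by
  have := PiLp.norm_apply_le (X - Z) (1 : Fin 2)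
  rwa [← dist_eq_norm] at this

theorem measurableSet_upperHalf : MeasurableSet upperHalf :=
  (isClosed_le continuous_const (continuous_coord 1)).measurableSet

theorem measurableSet_halfBall (X₀ : Plane) (R : ℝ) : MeasurableSet (halfBall X₀ R) :=
  measurableSet_ball.inter measurableSet_upperHalf

theorem polarPt_mem_openHalfBall {X₀ : Plane} {R r θ : ℝ} (hX : X₀ 1 = 0 ∨ R ≤ X₀ 1)
    (hr : r ∈ Set.Ioo 0 R) (hθ : θ ∈ polarAngles X₀) : polarPt X₀ r θ ∈ openHalfBall X₀ R := by
  refine ⟨?_, ?_⟩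
  · rw [Metric.mem_ball, dist_polarPt_center X₀ hr.1.le]; exact hr.2
  · change 0 < polarPt X₀ r θ 1
    rw [polarPt_one]
    rcases hX with h0 | h0
    · rw [polarAngles, if_pos h0] at hθ
      rw [h0, zero_add]
      exact mul_pos hr.1 (Real.sin_pos_of_mem_Ioo hθ)
    · have := Real.neg_one_le_sin θ
      nlinarith [hr.1, hr.2]

/-- The angles of the points of a circle in the closed upper half-plane differ from `polarAngles` at
most in an endpoint. -/
theorem exists_ae_eq_polarAngles {X₀ : Plane} {R : ℝ} (hX : X₀ 1 = 0 ∨ R ≤ X₀ 1) :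
    ∃ B : Set ℝ, MeasurableSet B ∧ B =ᵐ[volume] polarAngles X₀ ∧ ∀ r ∈ Set.Ioo 0 R, ∀ θ,
      (θ ∈ Set.Ioo (-Real.pi) Real.pi ∧ polarPt X₀ r θ ∈ upperHalf ↔ θ ∈ B) := by
  by_cases h0 : X₀ 1 = 0
  · refine ⟨Set.Ico 0 Real.pi, measurableSet_Ico, ?_, ?_⟩
    · rw [polarAngles, if_pos h0]; exact Ioo_ae_eq_Ico.symm
    · intro r hr θ
      have : polarPt X₀ r θ ∈ upperHalf ↔ 0 ≤ Real.sin θ := by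
        change 0 ≤ polarPt X₀ r θ 1 ↔ _
        rw [polarPt_one, h0, zero_add, mul_nonneg_iff_of_pos_left hr.1]
      rw [this]
      constructor
      · rintro ⟨h1, h2⟩
        refine ⟨?_, h1.2⟩
        by_contra hneg
        push Not at hneg
        linarith [Real.sin_neg_of_neg_of_neg_pi_lt hneg h1.1]
      · rintro ⟨h1, h2⟩
        exact ⟨⟨by linarith [Real.pi_pos], h2⟩, Real.sin_nonneg_of_nonneg_of_le_pi h1 h2.le⟩
  · refine ⟨polarAngles X₀, measurableSet_polarAngles X₀, ae_eq_refl _, ?_⟩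
    intro r hr θ
    constructor
    · rintro ⟨h1, -⟩
      rwa [polarAngles, if_neg h0]
    · intro h1
      have h2 : 0 < polarPt X₀ r θ 1 := (polarPt_mem_openHalfBall hX hr h1).2
      exact ⟨polarAngles_subset X₀ h1, h2.le⟩

/-- The integral of `f` over the part of the circle of radius `r` around `X₀` in the upper
half-plane. -/
noncomputable def arcIntegral (f : Plane → ℝ) (X₀ : Plane) (r : ℝ) : ℝ :=
  ∫ θ in polarAngles X₀, r * f (polarPt X₀ r θ)

theorem integral_halfCircle {X₀ : Plane} {R r : ℝ} (hX : X₀ 1 = 0 ∨ R ≤ X₀ 1)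
    (hr : r ∈ Set.Ioo 0 R) {f : Plane → ℝ} (hf : Measurable f) :
    ∫ X in halfCircle X₀ r, f X ∂(μH[1]) = arcIntegral f X₀ r := by
  obtain ⟨B, hBm, hB, hBr⟩ := exists_ae_eq_polarAngles hX
  have hm : Measurable (polarPt X₀ r) := (lipschitzWith_polarPt X₀ hr.1.le).continuous.measurable
  rw [halfCircle, Set.inter_comm, ← Measure.restrict_restrict measurableSet_upperHalf,
    restrict_sphere_hausdorffMeasure X₀ hr.1, Measure.restrict_smul, integral_smul_measure,
    Measure.restrict_map hm measurableSet_upperHalf,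
    integral_map hm.aemeasurable hf.aestronglyMeasurable,
    Measure.restrict_restrict (hm measurableSet_upperHalf), ENNReal.toReal_ofReal hr.1.le]
  have : polarPt X₀ r ⁻¹' upperHalf ∩ Set.Ioo (-Real.pi) Real.pi = B := by
    ext θ
    rw [← hBr r hr θ, and_comm]; rfl
  rw [this, Measure.restrict_congr_set hB, arcIntegral, integral_const_mul, smul_eq_mul]

/-- Integration over the plane in polar coordinates around `X₀`. -/
theorem integral_polarPt (X₀ : Plane) (f : Plane → ℝ) :
    ∫ p in polarCoord.target, p.1 * f (polarPt X₀ p.1 p.2) = ∫ X, f X := by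
  have h1 : MeasurePreserving (fun p : ℝ × ℝ => (!₂[p.1, p.2] : Plane)) := by
    have := ((EuclideanSpace.volume_preserving_symm_measurableEquiv_toLp (Fin 2)).symm).comp
      (volume_preserving_finTwoArrow ℝ).symm
    convert! this using 1
  have h2 : MeasurableEmbedding (fun p : ℝ × ℝ => (!₂[p.1, p.2] : Plane)) := by
    have := (MeasurableEquiv.toLp 2 (Fin 2 → ℝ)).measurableEmbedding.comp
      (MeasurableEquiv.finTwoArrow (α := ℝ)).symm.measurableEmbedding
    convert! this using 1
  rw [← integral_add_left_eq_self f X₀, ← h1.integral_comp h2,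
    ← integral_comp_polarCoord_symm]
  rfl

theorem integrableOn_polarPt {X₀ : Plane} {R b : ℝ} (hX : X₀ 1 = 0 ∨ R ≤ X₀ 1) {f : Plane → ℝ}
    (hf : Measurable f) (hb : ∀ X ∈ openHalfBall X₀ R, |f X| ≤ b) :
    IntegrableOn (fun p : ℝ × ℝ => p.1 * f (polarPt X₀ p.1 p.2))
      (Set.Ioo 0 R ×ˢ polarAngles X₀) := by
  have hm : Measurable fun p : ℝ × ℝ => polarPt X₀ p.1 p.2 :=
    (continuous_polarPt.comp (continuous_const.prodMk continuous_id)).measurable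
  refine Measure.integrableOn_of_bounded (M := R * b) ?_ ?_ ?_
  · rw [Measure.volume_eq_prod, Measure.prod_prod]
    exact (ENNReal.mul_lt_top (by simp) (volume_polarAngles_lt_top X₀)).ne
  · exact (measurable_fst.mul (hf.comp hm)).aestronglyMeasurable
  · rw [ae_restrict_iff' (measurableSet_Ioo.prod (measurableSet_polarAngles X₀))]
    refine ae_of_all _ fun p hp => ?_
    have h1 := hb _ (polarPt_mem_openHalfBall hX hp.1 hp.2)
    rw [norm_mul, Real.norm_eq_abs, Real.norm_eq_abs, abs_of_pos hp.1.1]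
    exact mul_le_mul hp.1.2.le h1 (abs_nonneg _) (hp.1.1.le.trans hp.1.2.le)

theorem integrableOn_arcIntegral {X₀ : Plane} {R b : ℝ} (hX : X₀ 1 = 0 ∨ R ≤ X₀ 1)
    {f : Plane → ℝ} (hf : Measurable f) (hb : ∀ X ∈ openHalfBall X₀ R, |f X| ≤ b) :
    IntegrableOn (arcIntegral f X₀) (Set.Ioo 0 R) := by
  have := integrableOn_polarPt hX hf hb
  rw [IntegrableOn, Measure.volume_eq_prod, ← Measure.prod_restrict] at this
  exact this.integral_prod_left

theorem integral_halfBall {X₀ : Plane} {R b : ℝ} (hX : X₀ 1 = 0 ∨ R ≤ X₀ 1) {f : Plane → ℝ}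
    (hf : Measurable f) (hb : ∀ X ∈ openHalfBall X₀ R, |f X| ≤ b) :
    ∫ X in halfBall X₀ R, f X = ∫ r in Set.Ioo 0 R, arcIntegral f X₀ r := by
  obtain ⟨B, hBm, hB, hBr⟩ := exists_ae_eq_polarAngles hX
  have hm : Measurable fun p : ℝ × ℝ => polarPt X₀ p.1 p.2 :=
    (continuous_polarPt.comp (continuous_const.prodMk continuous_id)).measurable
  have hI := integrableOn_polarPt hX hf hb
  rw [← integral_indicator (measurableSet_halfBall X₀ R), ← integral_polarPt X₀]
  have e1 : ∀ p : ℝ × ℝ, p.1 * (halfBall X₀ R).indicator f (polarPt X₀ p.1 p.2)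
      = ((fun p : ℝ × ℝ => polarPt X₀ p.1 p.2) ⁻¹' halfBall X₀ R).indicator
        (fun p : ℝ × ℝ => p.1 * f (polarPt X₀ p.1 p.2)) p := by
    intro p
    by_cases hp : polarPt X₀ p.1 p.2 ∈ halfBall X₀ R
    · rw [Set.indicator_of_mem hp, Set.indicator_of_mem (by exact hp)]
    · rw [Set.indicator_of_notMem hp, Set.indicator_of_notMem (by exact hp), mul_zero]
  simp_rw [e1]
  rw [setIntegral_indicator (hm (measurableSet_halfBall X₀ R))]
  have e2 : polarCoord.target ∩ (fun p : ℝ × ℝ => polarPt X₀ p.1 p.2) ⁻¹' halfBall X₀ R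
      = Set.Ioo 0 R ×ˢ B := by
    ext p
    constructor
    · rintro ⟨⟨h1, h2⟩, h3, h4⟩
      have hr : p.1 ∈ Set.Ioo 0 R := by
        refine ⟨h1, ?_⟩
        rw [Metric.mem_ball, dist_polarPt_center X₀ (le_of_lt h1)] at h3
        exact h3
      exact ⟨hr, (hBr _ hr _).1 ⟨h2, h4⟩⟩
    · rintro ⟨h1, h2⟩
      have h3 := (hBr _ h1 _).2 h2
      refine ⟨⟨h1.1, h3.1⟩, ?_, h3.2⟩
      rw [Metric.mem_ball, dist_polarPt_center X₀ h1.1.le]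
      exact h1.2
  have e3 : (Set.Ioo 0 R ×ˢ B : Set (ℝ × ℝ)) =ᵐ[volume] (Set.Ioo 0 R ×ˢ polarAngles X₀) := by
    rw [Measure.volume_eq_prod]
    exact Measure.set_prod_ae_eq (ae_eq_refl _) hB
  rw [e2, setIntegral_congr_set e3, Measure.volume_eq_prod, setIntegral_prod]
  · rfl
  · rwa [← Measure.volume_eq_prod]

theorem abs_arcIntegral_le {X₀ : Plane} {r b : ℝ} (hr : 0 ≤ r) {f : Plane → ℝ}
    (hb : ∀ θ ∈ polarAngles X₀, |f (polarPt X₀ r θ)| ≤ b) (hb0 : 0 ≤ b) :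
    |arcIntegral f X₀ r| ≤ 2 * Real.pi * (r * b) := by
  have h : ∀ θ ∈ polarAngles X₀, ‖r * f (polarPt X₀ r θ)‖ ≤ r * b := by
    intro θ hθ
    rw [norm_mul, Real.norm_eq_abs, Real.norm_eq_abs, abs_of_nonneg hr]
    exact mul_le_mul_of_nonneg_left (hb θ hθ) hr
  have h2 := norm_setIntegral_le_of_norm_le_const (volume_polarAngles_lt_top X₀) h
  have h3 := volume_real_polarAngles_le X₀
  rw [Measure.real, Measure.restrict_apply_univ] at h3
  rw [arcIntegral, ← Real.norm_eq_abs]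
  calc _ ≤ r * b * volume.real (polarAngles X₀) := h2
    _ ≤ r * b * (2 * Real.pi) := by
        apply mul_le_mul_of_nonneg_left h3; positivity
    _ = _ := by ring

/-! ### Integration by parts against compactly supported functions -/

theorem integrable_mul_of_tsupport {V : Set Plane} {f k φ : Plane → ℝ} (hf : ContinuousOn f V)
    (hk : Continuous k) (hc : HasCompactSupport φ) (hs : tsupport φ ⊆ V)
    (hkφ : Function.support k ⊆ tsupport φ) : Integrable fun X => f X * k X := by
  have h1 : IntegrableOn (fun X => f X * k X) (tsupport φ) :=
    ((hf.mono hs).mul hk.continuousOn).integrableOn_compact hc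
  rwa [integrableOn_iff_integrable_of_support_subset] at h1
  intro X hX
  exact hkφ (right_ne_zero_of_mul hX)

theorem support_fderiv_apply_subset (φ : Plane → ℝ) (v : Plane) :
    (Function.support fun X => fderiv ℝ φ X v) ⊆ tsupport φ := by
  intro X hX
  apply support_fderiv_subset (𝕜 := ℝ)
  intro h
  apply hX
  simp [h]

theorem continuous_fderiv_apply {φ : Plane → ℝ} (hφ : ContDiff ℝ 1 φ) (v : Plane) :
    Continuous fun X => fderiv ℝ φ X v :=
  (hφ.continuous_fderiv one_ne_zero).clm_apply continuous_const

theorem continuousOn_fderiv_apply {V : Set Plane} (hV : IsOpen V) {f : Plane → ℝ}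
    (hf : ContDiffOn ℝ 1 f V) (v : Plane) : ContinuousOn (fun X => fderiv ℝ f X v) V :=
  (hf.continuousOn_fderiv_of_isOpen hV le_rfl).clm_apply continuousOn_const

theorem integral_mul_fderiv_of_contDiffOn {V : Set Plane} (hV : IsOpen V) {f φ : Plane → ℝ}
    (hf : ContDiffOn ℝ 1 f V) (hφ : ContDiff ℝ 1 φ) (hc : HasCompactSupport φ)
    (hs : tsupport φ ⊆ V) (v : Plane) :
    ∫ X, f X * fderiv ℝ φ X v = -∫ X, fderiv ℝ f X v * φ X := by
  apply integral_mul_fderiv_eq_neg_fderiv_mul_of_integrable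
  · exact integrable_mul_of_tsupport (continuousOn_fderiv_apply hV hf v) hφ.continuous hc hs
      (subset_tsupport φ)
  · exact integrable_mul_of_tsupport hf.continuousOn (continuous_fderiv_apply hφ v) hc hs
      (support_fderiv_apply_subset φ v)
  · exact integrable_mul_of_tsupport hf.continuousOn hφ.continuous hc hs (subset_tsupport φ)
  · exact fun X hX => (hf.differentiableOn one_ne_zero).differentiableAt (hV.mem_nhds (hs hX))
  · exact fun X _ => hφ.differentiable one_ne_zero X

/-- A continuous function that is nonpositive almost everywhere on an open set is nonpositive
there. -/
theorem nonpos_of_ae_of_continuousOn {V : Set Plane} (hV : IsOpen V) {f : Plane → ℝ}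
    (hf : ContinuousOn f V) (h : ∀ᵐ X, X ∈ V → f X ≤ 0) : ∀ X ∈ V, f X ≤ 0 := by
  have ho : IsOpen (V ∩ f ⁻¹' Set.Ioi 0) := hf.isOpen_inter_preimage hV isOpen_Ioi
  have h0 : volume (V ∩ f ⁻¹' Set.Ioi 0) = 0 := by
    apply measure_mono_null _ (ae_iff.1 h)
    rintro X ⟨h1, h2⟩
    simpa using ⟨h1, h2⟩
  have he := ho.eq_empty_of_measure_zero h0
  intro X hX
  by_contra hcon
  push Not at hcon
  have : X ∈ V ∩ f ⁻¹' Set.Ioi 0 := ⟨hX, hcon⟩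
  rw [he] at this
  exact this

/-- The fundamental lemma of the calculus of variations for continuous functions. -/
theorem eq_zero_of_integral_test {V : Set Plane} (hV : IsOpen V) {f : Plane → ℝ}
    (hf : ContinuousOn f V)
    (h : ∀ φ : Plane → ℝ, ContDiff ℝ ∞ φ → HasCompactSupport φ → tsupport φ ⊆ V →
      ∫ X, f X * φ X = 0) : ∀ X ∈ V, f X = 0 := by
  have hae := hV.ae_eq_zero_of_integral_contDiff_smul_eq_zero
    (hf.locallyIntegrableOn hV.measurableSet) (μ := volume) fun φ h1 h2 h3 => by
      have := h φ h1 h2 h3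
      simpa only [smul_eq_mul, mul_comm] using this
  have h1 := nonpos_of_ae_of_continuousOn hV hf (hae.mono fun X h hX => (h hX).le)
  have h2 := nonpos_of_ae_of_continuousOn hV hf.neg (hae.mono fun X h hX => by
    simp [h hX])
  intro X hX
  have h3 := h2 X hX
  exact le_antisymm (h1 X hX) (by simpa using h3)

/-- A smooth truncation of the identity near `0`. -/
theorem exists_truncation : ∃ (β : ℝ → ℝ) (m : ℝ), ContDiff ℝ ∞ β ∧ (∀ t ≤ 1, β t = 0) ∧
    (∀ t, 2 ≤ t → β t = t) ∧ (∀ t, |deriv β t| ≤ m) ∧ ∀ t, 0 ≤ t → |β t| ≤ t := by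
  set β : ℝ → ℝ := fun t => t * Real.smoothTransition (t - 1) with hβ
  have hs : ContDiff ℝ ∞ β :=
    contDiff_id.mul (Real.smoothTransition.contDiff.comp (contDiff_id.sub contDiff_const))
  have h1 : ∀ t ≤ 1, β t = 0 := fun t ht => by
    simp [hβ, Real.smoothTransition.zero_of_nonpos (show t - 1 ≤ 0 by linarith)]
  have h2 : ∀ t, 2 ≤ t → β t = t := fun t ht => by
    simp [hβ, Real.smoothTransition.one_of_one_le (show 1 ≤ t - 1 by linarith)]
  have hdc : Continuous (deriv β) := hs.continuous_deriv (by simp)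
  obtain ⟨m, hm⟩ := (isCompact_Icc (a := (1 : ℝ)) (b := 2)).exists_bound_of_continuousOn
    hdc.continuousOn
  refine ⟨β, max m 1, hs, h1, h2, ?_, ?_⟩
  · intro t
    rcases lt_or_ge t 1 with ht | ht
    · have : β =ᶠ[𝓝 t] fun _ => 0 := by
        filter_upwards [Iio_mem_nhds ht] with s hs using h1 s (le_of_lt hs)
      rw [this.deriv_eq]; simp
    rcases lt_or_ge 2 t with ht' | ht'
    · have : β =ᶠ[𝓝 t] fun s => s := by
        filter_upwards [Ioi_mem_nhds ht'] with s hs using h2 s (le_of_lt hs)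
      rw [this.deriv_eq]; simp
    · exact (hm t ⟨ht, ht'⟩).trans (le_max_left _ _)
  · intro t ht
    rw [hβ, abs_of_nonneg (mul_nonneg ht (Real.smoothTransition.nonneg _))]
    exact mul_le_of_le_one_right ht (Real.smoothTransition.le_one _)

/-- A nonnegative function whose derivative is bounded by `K` where it is positive varies by at most
`K` times the length of the interval. -/
theorem abs_sub_le_of_deriv_bound_of_pos {f f' : ℝ → ℝ} {a b K : ℝ} (hab : a ≤ b)
    (hK : 0 ≤ K)
    (hf : ContinuousOn f (Set.Icc a b)) (h0 : ∀ t ∈ Set.Icc a b, 0 ≤ f t)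
    (hd : ∀ t ∈ Set.Ioo a b, 0 < f t → HasDerivAt f (f' t) t ∧ |f' t| ≤ K) :
    |f b - f a| ≤ K * (b - a) := by
  -- the increase from a smaller value to a larger one happens where `f > 0`
  have key : ∀ (f f' : ℝ → ℝ) (a b : ℝ), a ≤ b → ContinuousOn f (Set.Icc a b) →
      (∀ t ∈ Set.Icc a b, 0 ≤ f t) →
      (∀ t ∈ Set.Ioo a b, 0 < f t → HasDerivAt f (f' t) t ∧ |f' t| ≤ K) →
      f b - f a ≤ K * (b - a) := by
    intro f f' a b hab hf h0 hd
    set Z := Set.Icc a b ∩ f ⁻¹' {0} with hZ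
    have hpos : ∀ c ∈ Set.Icc a b, (∀ t ∈ Set.Ioo c b, 0 < f t) → f b - f c ≤ K * (b - c) := by
      intro c hc hcp
      have hin : ∀ t ∈ interior (Set.Icc c b), HasDerivAt f (f' t) t ∧ |f' t| ≤ K := by
        intro t ht
        rw [interior_Icc] at ht
        exact hd t ⟨hc.1.trans_lt ht.1, ht.2⟩ (hcp t ht)
      exact (convex_Icc c b).image_sub_le_mul_sub_of_deriv_le
        (hf.mono (Set.Icc_subset_Icc_left hc.1))
        (fun t ht => (hin t ht).1.differentiableAt.differentiableWithinAt)
        (fun t ht => by rw [(hin t ht).1.deriv]; exact (le_abs_self _).trans (hin t ht).2)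
        c ⟨le_rfl, hc.2⟩ b ⟨hc.2, le_rfl⟩ hc.2
    rcases Z.eq_empty_or_nonempty with he | hne
    · refine hpos a ⟨le_rfl, hab⟩ fun t ht => ?_
      refine (h0 t ⟨ht.1.le, ht.2.le⟩).lt_of_ne fun h => ?_
      have : t ∈ Z := ⟨⟨ht.1.le, ht.2.le⟩, h.symm⟩
      rw [he] at this; exact this
    · have hZc : IsCompact Z := isCompact_Icc.of_isClosed_subset
        (hf.preimage_isClosed_of_isClosed isClosed_Icc isClosed_singleton) Set.inter_subset_left
      obtain ⟨c, hc, hcmax⟩ := hZc.exists_isGreatest hne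
      have h1 := hpos c hc.1 fun t ht => by
        have ht' : t ∈ Set.Icc a b := ⟨hc.1.1.trans ht.1.le, ht.2.le⟩
        refine (h0 t ht').lt_of_ne fun h => ?_
        exact absurd (hcmax ⟨ht', h.symm⟩) (not_le.2 ht.1)
      have h2 : f c = 0 := hc.2
      have h3 := h0 a ⟨le_rfl, hab⟩
      have h4 := mul_le_mul_of_nonneg_left hc.1.1 hK
      nlinarith
  rw [abs_sub_le_iff]
  refine ⟨key f f' a b hab hf h0 hd, ?_⟩
  have h := key (fun t => f (-t)) (fun t => -f' (-t)) (-b) (-a) (by linarith)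
    (hf.comp continuous_neg.continuousOn fun t ht => ⟨by linarith [ht.2], by linarith [ht.1]⟩)
    (fun t ht => h0 _ ⟨by linarith [ht.2], by linarith [ht.1]⟩)
    (fun t ht hp => by
      obtain ⟨h1, h2⟩ := hd (-t) ⟨by linarith [ht.2], by linarith [ht.1]⟩ hp
      refine ⟨?_, by rwa [abs_neg]⟩
      simpa [Function.comp_def] using h1.comp t (hasDerivAt_neg t))
  simp only [neg_neg] at h
  linarith

/-! ### The stream function in the positivity set -/

/-- The positivity set of `ψ` off the axis. -/
def positivitySet (Ω : Set Plane) (ψ : Plane → ℝ) : Set Plane := interior Ω ∩ {X | 0 < ψ X}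

open Classical in
/-- The classical gradient of `ψ` in the positivity set, extended by `0`; it represents the weak
gradient. -/
noncomputable def streamGrad (Ω : Set Plane) (ψ : Plane → ℝ) (X : Plane) : Plane :=
  if X ∈ positivitySet Ω ψ then gradient ψ X else 0

theorem gradient_apply (ψ : Plane → ℝ) (X : Plane) (i : Fin 2) :
    gradient ψ X i = fderiv ℝ ψ X (coordVec i) := by
  rw [← inner_gradient_left (𝕜 := ℝ), coordVec, EuclideanSpace.inner_single_right]
  simp

theorem norm_sq_eq_coords (v : Plane) : ‖v‖ ^ 2 = v 0 ^ 2 + v 1 ^ 2 := by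
  rw [EuclideanSpace.norm_sq_eq, Fin.sum_univ_two]; simp

theorem inner_eq_coords (v w : Plane) : inner ℝ v w = v 0 * w 0 + v 1 * w 1 := by
  rw [PiLp.inner_apply, Fin.sum_univ_two]; simp [mul_comm]

theorem eq_sum_coordVec (v : Plane) : v = v 0 • coordVec 0 + v 1 • coordVec 1 := by
  ext i; fin_cases i <;> simp [coordVec]

theorem clm_apply_eq_coords {F : Type*} [NormedAddCommGroup F] [NormedSpace ℝ F]
    (T : Plane →L[ℝ] F) (v : Plane) : T v = v 0 • T (coordVec 0) + v 1 • T (coordVec 1) := by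
  conv_lhs => rw [eq_sum_coordVec v]
  simp

theorem norm_coordVec (i : Fin 2) : ‖coordVec i‖ = 1 := by simp [coordVec]

theorem mem_interior_iff {Ω : Set Plane} (h : IsOpenInUpperHalf Ω) {X : Plane} :
    X ∈ interior Ω ↔ X ∈ Ω ∧ 0 < X 1 := by
  obtain ⟨U, hU, rfl⟩ := h
  constructor
  · intro hX
    refine ⟨interior_subset hX, ?_⟩
    obtain ⟨ε, hε, hball⟩ := Metric.isOpen_iff.1 isOpen_interior X hX
    have h1 : X - (ε / 2) • coordVec 1 ∈ Metric.ball X ε := by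
      rw [Metric.mem_ball, dist_eq_norm, sub_sub_cancel_left, norm_neg, norm_smul, norm_coordVec,
        mul_one, Real.norm_eq_abs, abs_of_pos (by linarith)]
      linarith
    have h2 : 0 ≤ (X - (ε / 2) • coordVec 1) 1 := (interior_subset (hball h1)).2
    simp [coordVec] at h2
    linarith
  · rintro ⟨h1, h2⟩
    rw [mem_interior]
    refine ⟨U ∩ {X | 0 < X 1}, fun Z hZ => ⟨hZ.1, ?_⟩,
      hU.inter (isOpen_lt continuous_const (continuous_coord 1)), h1.1, h2⟩
    exact le_of_lt (show 0 < Z 1 from hZ.2)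

theorem measurableSet_of_isOpenInUpperHalf {Ω : Set Plane} (h : IsOpenInUpperHalf Ω) :
    MeasurableSet Ω := by
  obtain ⟨U, hU, rfl⟩ := h
  exact hU.measurableSet.inter measurableSet_upperHalf

theorem volume_axis : volume {X : Plane | X 1 = 0} = 0 := by
  let p : Submodule ℝ Plane :=
    LinearMap.ker (EuclideanSpace.proj (𝕜 := ℝ) (1 : Fin 2) : Plane →L[ℝ] ℝ).toLinearMap
  have hp : ({X : Plane | X 1 = 0} : Set Plane) = p := by
    ext X; simp [p]
  rw [hp]
  apply Measure.addHaar_submodule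
  intro htop
  have : coordVec 1 ∈ p := by rw [htop]; trivial
  simp [p, coordVec] at this

theorem ae_pos_of_mem {Ω : Set Plane} (h : IsOpenInUpperHalf Ω) :
    ∀ᵐ X, X ∈ Ω → X ∈ interior Ω := by
  have h1 : ∀ᵐ X : Plane, X 1 ≠ 0 := by
    rw [ae_iff]; simpa using volume_axis
  filter_upwards [h1] with X hX hXΩ
  rw [mem_interior_iff h]
  refine ⟨hXΩ, ?_⟩
  obtain ⟨U, hU, rfl⟩ := h
  exact lt_of_le_of_ne hXΩ.2 (Ne.symm hX)

theorem weakGrad_spec {Ω : Set Plane} {C : ℝ} {ψ I : Plane → ℝ}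
    (hsol : IsVariationalSolution Ω C ψ I) : IsWeakGradient Ω ψ (weakGrad Ω ψ) := by
  have h := hsol.memW12wLoc.exists_weakGradient
  rw [weakGrad, dif_pos h]
  exact h.choose_spec

section
variable {Ω : Set Plane} {C : ℝ} {ψ I : Plane → ℝ}

theorem isOpen_positivitySet (hsol : IsVariationalSolution Ω C ψ I) :
    IsOpen (positivitySet Ω ψ) :=
  (hsol.continuousOn.mono interior_subset).isOpen_inter_preimage isOpen_interior isOpen_Ioi

theorem positivitySet_pos (hsol : IsVariationalSolution Ω C ψ I) {X : Plane}
    (hX : X ∈ positivitySet Ω ψ) : 0 < X 1 :=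
  ((mem_interior_iff hsol.isOpen).1 hX.1).2

theorem mem_positivitySet_of_pos (hsol : IsVariationalSolution Ω C ψ I) {X : Plane} (hX : X ∈ Ω)
    (h : 0 < ψ X) : X ∈ positivitySet Ω ψ := by
  refine ⟨(mem_interior_iff hsol.isOpen).2 ⟨hX, ?_⟩, h⟩
  obtain ⟨U, hU, hUe⟩ := hsol.isOpen
  have h1 : 0 ≤ X 1 := (hUe ▸ hX : X ∈ U ∩ upperHalf).2
  exact h1.lt_of_ne fun h2 => h.ne' (hsol.eq_zero_axis X hX h2.symm)

theorem contDiffOn_positivitySet (hsol : IsVariationalSolution Ω C ψ I) :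
    ContDiffOn ℝ 2 ψ (positivitySet Ω ψ) :=
  hsol.contDiffOn.mono fun _ hX => ⟨interior_subset hX.1, hX.2⟩

theorem contDiffOn_partial (hsol : IsVariationalSolution Ω C ψ I) (v : Plane) :
    ContDiffOn ℝ 1 (fun X => fderiv ℝ ψ X v) (positivitySet Ω ψ) :=
  ((contDiffOn_positivitySet hsol).fderiv_of_isOpen (isOpen_positivitySet hsol)
    (by norm_num)).clm_apply contDiffOn_const

/-- The weak gradient agrees with the classical one in the positivity set. -/
theorem weakGrad_eq_gradient_ae (hsol : IsVariationalSolution Ω C ψ I) :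
    ∀ᵐ X, X ∈ positivitySet Ω ψ → weakGrad Ω ψ X = gradient ψ X := by
  have hO := isOpen_positivitySet hsol
  have hsub : positivitySet Ω ψ ⊆ interior Ω := Set.inter_subset_left
  have hG := weakGrad_spec hsol
  have key : ∀ i : Fin 2, ∀ᵐ X, X ∈ positivitySet Ω ψ →
      weakGrad Ω ψ X i - fderiv ℝ ψ X (coordVec i) = 0 := by
    intro i
    have hc := (contDiffOn_partial hsol (coordVec i)).continuousOn
    have hGi : LocallyIntegrableOn (fun X => weakGrad Ω ψ X i) (positivitySet Ω ψ) := by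
      intro X hX
      obtain ⟨s, hs, hs'⟩ := hG.locInt_grad.mono_set hsub X hX
      refine ⟨s, hs, ?_⟩
      exact (EuclideanSpace.proj (𝕜 := ℝ) i : Plane →L[ℝ] ℝ).integrable_comp hs'
    apply hO.ae_eq_zero_of_integral_contDiff_smul_eq_zero
      (hGi.sub (hc.locallyIntegrableOn hO.measurableSet))
    intro φ h1 h2 h3
    have h4 := hG.integral_eq φ h1 h2 (h3.trans hsub) i
    have h0 : ∀ X ∉ interior Ω, φ X = 0 := fun X hX =>
      image_eq_zero_of_notMem_tsupport fun h => hX (hsub (h3 h))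
    have h0' : ∀ X ∉ interior Ω, fderiv ℝ φ X (coordVec i) = 0 := fun X hX => by
      by_contra hne
      exact hX (hsub (h3 (support_fderiv_apply_subset φ _ hne)))
    rw [setIntegral_eq_integral_of_forall_compl_eq_zero (fun X hX => by rw [h0' X hX, mul_zero]),
      setIntegral_eq_integral_of_forall_compl_eq_zero (fun X hX => by rw [h0 X hX, mul_zero]),
      integral_mul_fderiv_of_contDiffOn hO ((contDiffOn_positivitySet hsol).of_le (by norm_num))
        (h1.of_le (by simp)) h2 h3] at h4
    have i1 : Integrable fun X => weakGrad Ω ψ X i * φ X := by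
      have hK : IntegrableOn (fun X => weakGrad Ω ψ X i) (tsupport φ) :=
        hGi.integrableOn_compact_subset h3 h2
      have := hK.mul_continuousOn h1.continuous.continuousOn h2
      rwa [integrableOn_iff_integrable_of_support_subset] at this
      exact fun X hX => subset_tsupport _ (right_ne_zero_of_mul hX)
    have i2 : Integrable fun X => fderiv ℝ ψ X (coordVec i) * φ X :=
      integrable_mul_of_tsupport hc h1.continuous h2 h3 (subset_tsupport φ)
    calc ∫ X, φ X • (weakGrad Ω ψ X i - fderiv ℝ ψ X (coordVec i))
        = ∫ X, (weakGrad Ω ψ X i * φ X - fderiv ℝ ψ X (coordVec i) * φ X) := by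
          congr 1; ext X; rw [smul_eq_mul]; ring
      _ = 0 := by rw [integral_sub i1 i2]; linarith
  filter_upwards [key 0, key 1] with X h0 h1 hX
  ext i
  rw [gradient_apply]
  fin_cases i
  · simpa using sub_eq_zero.1 (h0 hX)
  · simpa using sub_eq_zero.1 (h1 hX)

theorem continuousOn_gradient (hsol : IsVariationalSolution Ω C ψ I) :
    ContinuousOn (gradient ψ) (positivitySet Ω ψ) := by
  have h : gradient ψ = fun X => !₂[fderiv ℝ ψ X (coordVec 0), fderiv ℝ ψ X (coordVec 1)] := by
    ext X i; fin_cases i <;> simp [gradient_apply]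
  rw [h]
  have h0 := (contDiffOn_partial hsol (coordVec 0)).continuousOn
  have h1 := (contDiffOn_partial hsol (coordVec 1)).continuousOn
  fun_prop

theorem norm_gradient_le (hsol : IsVariationalSolution Ω C ψ I) {X : Plane}
    (hX : X ∈ positivitySet Ω ψ) : ‖gradient ψ X‖ ≤ |C| * X 1 := by
  have hO := isOpen_positivitySet hsol
  have hc : ContinuousOn (fun X => ‖gradient ψ X‖ - |C| * X 1) (positivitySet Ω ψ) :=
    (continuousOn_gradient hsol).norm.sub
      (continuousOn_const.mul (continuous_coord 1).continuousOn)
  have := nonpos_of_ae_of_continuousOn hO hc ?_ X hX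
  · linarith
  have hb := hsol.grad_bound
  rw [ae_restrict_iff' (measurableSet_of_isOpenInUpperHalf hsol.isOpen)] at hb
  filter_upwards [hb, weakGrad_eq_gradient_ae hsol] with Z h1 h2 hZ
  have h3 := h1 (interior_subset hZ.1)
  rw [h2 hZ] at h3
  have hpos := positivitySet_pos hsol hZ
  rw [one_div, inv_mul_le_iff₀ hpos] at h3
  have := mul_le_mul_of_nonneg_left (le_abs_self C) hpos.le
  linarith

theorem norm_streamGrad_le (hsol : IsVariationalSolution Ω C ψ I) {X : Plane} (hX : 0 ≤ X 1) :
    ‖streamGrad Ω ψ X‖ ≤ |C| * X 1 := by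
  unfold streamGrad
  split_ifs with h
  · exact norm_gradient_le hsol h
  · simp; positivity

theorem measurable_streamGrad (hsol : IsVariationalSolution Ω C ψ I) :
    Measurable (streamGrad Ω ψ) := by
  classical
  have h := (continuousOn_gradient hsol).measurable_piecewise (s := positivitySet Ω ψ)
    (g := fun _ => (0 : Plane)) continuousOn_const (isOpen_positivitySet hsol).measurableSet
  have he : streamGrad Ω ψ = (positivitySet Ω ψ).piecewise (gradient ψ) fun _ => 0 := by
    funext X; simp [streamGrad, Set.piecewise]
  rwa [he]

/-- The variation of `ψ` along a segment inside `Ω`. -/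
theorem abs_sub_le_of_segment (hsol : IsVariationalSolution Ω C ψ I) {X Y : Plane} {m : ℝ}
    (hm : 0 ≤ m)
    (hs : ∀ t ∈ Set.Icc (0 : ℝ) 1, X + t • (Y - X) ∈ Ω ∧ (X + t • (Y - X)) 1 ≤ m) :
    |ψ Y - ψ X| ≤ |C| * m * ‖Y - X‖ := by
  set γ : ℝ → Plane := fun t => X + t • (Y - X) with hγ
  have hγc : Continuous γ := by fun_prop
  have hγd : ∀ t, HasDerivAt γ (Y - X) t := by
    intro t
    have h := ((hasDerivAt_id t).smul_const (Y - X)).const_add X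
    rwa [one_smul] at h
  have h := abs_sub_le_of_deriv_bound_of_pos (f := fun t => ψ (γ t))
    (f' := fun t => fderiv ℝ ψ (γ t) (Y - X)) (a := 0) (b := 1) (K := |C| * m * ‖Y - X‖)
    zero_le_one (by positivity)
    (hsol.continuousOn.comp hγc.continuousOn fun t ht => (hs t ht).1)
    (fun t ht => hsol.nonneg _ (hs t ht).1) (fun t ht hpos => by
      have ht' := Set.Ioo_subset_Icc_self ht
      have hO := mem_positivitySet_of_pos hsol (hs t ht').1 hpos
      have hd : DifferentiableAt ℝ ψ (γ t) :=
        ((contDiffOn_positivitySet hsol).differentiableOn two_ne_zero).differentiableAt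
          ((isOpen_positivitySet hsol).mem_nhds hO)
      refine ⟨hd.hasFDerivAt.comp_hasDerivAt t (hγd t), ?_⟩
      rw [← inner_gradient_left (𝕜 := ℝ)]
      refine (abs_real_inner_le_norm _ _).trans ?_
      apply mul_le_mul_of_nonneg_right _ (norm_nonneg _)
      refine (norm_gradient_le hsol hO).trans ?_
      exact mul_le_mul_of_nonneg_left (hs t ht').2 (abs_nonneg _))
  simpa [hγ] using h

/-- The square of the stream function is continuously differentiable across the free boundary. -/
theorem hasFDerivAt_sq (hsol : IsVariationalSolution Ω C ψ I) {X : Plane} (hX : X ∈ interior Ω) :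
    HasFDerivAt (fun Z => ψ Z ^ 2) ((2 * ψ X) • innerSL ℝ (streamGrad Ω ψ X)) X := by
  by_cases hpos : 0 < ψ X
  · have hO : X ∈ positivitySet Ω ψ := ⟨hX, hpos⟩
    have hd : DifferentiableAt ℝ ψ X :=
      ((contDiffOn_positivitySet hsol).differentiableOn two_ne_zero).differentiableAt
        ((isOpen_positivitySet hsol).mem_nhds hO)
    have h1 : innerSL ℝ (streamGrad Ω ψ X) = fderiv ℝ ψ X := by
      ext v
      rw [streamGrad, if_pos hO, innerSL_apply_apply, inner_gradient_left]
    rw [h1]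
    have := hd.hasFDerivAt.pow 2
    convert! this using 1
    simp
  · have h0 : ψ X = 0 := le_antisymm (not_lt.1 hpos) (hsol.nonneg X (interior_subset hX))
    rw [h0, mul_zero, zero_smul]
    obtain ⟨ε, hε, hball⟩ := Metric.isOpen_iff.1 isOpen_interior X hX
    have hXp := ((mem_interior_iff hsol.isOpen).1 hX).2
    set m := X 1 + ε with hm
    have hle : ∀ Z ∈ Metric.ball X ε, ψ Z ≤ |C| * m * ‖Z - X‖ := by
      intro Z hZ
      have := abs_sub_le_of_segment hsol (X := X) (Y := Z) (m := m) (by positivity) ?_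
      · rw [h0, sub_zero] at this
        exact (le_abs_self _).trans this
      intro t ht
      have h1 : X + t • (Z - X) ∈ Metric.ball X ε := by
        rw [mem_ball_iff_norm] at hZ ⊢
        rw [add_sub_cancel_left, norm_smul, Real.norm_eq_abs, abs_of_nonneg ht.1]
        exact (mul_le_of_le_one_left (norm_nonneg _) ht.2).trans_lt hZ
      refine ⟨interior_subset (hball h1), ?_⟩
      have h2 := PiLp.norm_apply_le (X + t • (Z - X) - X) (1 : Fin 2)
      rw [mem_ball_iff_norm] at h1
      have h3 := (le_abs_self _).trans (h2.trans h1.le)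
      simp only [PiLp.sub_apply] at h3
      linarith
    rw [hasFDerivAt_iff_isLittleO_nhds_zero]
    have hO2 : (fun h : Plane => ψ (X + h) ^ 2) =O[𝓝 0] fun h => ‖h‖ ^ 2 := by
      refine Asymptotics.IsBigO.of_bound ((|C| * m) ^ 2) ?_
      filter_upwards [Metric.ball_mem_nhds (0 : Plane) hε] with h hh
      have hZ : X + h ∈ Metric.ball X ε := by
        rw [mem_ball_iff_norm, add_sub_cancel_left]; simpa using hh
      have h1 := hle _ hZ
      rw [add_sub_cancel_left] at h1
      have h2 := hsol.nonneg _ (interior_subset (hball hZ))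
      rw [Real.norm_of_nonneg (by positivity), Real.norm_of_nonneg (by positivity), ← mul_pow]
      gcongr
    have := hO2.trans_isLittleO (Asymptotics.isLittleO_norm_pow_id one_lt_two)
    simpa [h0] using this
end

/-! ### The equation in the positivity set -/

section
variable {Ω : Set Plane} {C : ℝ} {ψ I : Plane → ℝ}

theorem ae_eq_one_of_mem_positivitySet (hsol : IsVariationalSolution Ω C ψ I) :
    ∀ᵐ X, X ∈ positivitySet Ω ψ → I X = 1 := by
  have h := hsol.indicator_le
  rw [ae_restrict_iff' (measurableSet_of_isOpenInUpperHalf hsol.isOpen)] at h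
  filter_upwards [h] with X h1 hX
  have hXΩ := interior_subset hX.1
  have h2 := h1 hXΩ
  rw [Set.indicator_of_mem (show X ∈ {Z | 0 < ψ Z} from hX.2)] at h2
  rcases hsol.values X hXΩ with h3 | h3
  · rw [h3] at h2; linarith
  · exact h3

theorem coordVec_apply (i j : Fin 2) : coordVec i j = if j = i then 1 else 0 := by
  simp [coordVec]

theorem hasFDerivAt_one_div_coord {X : Plane} (hX : X 1 ≠ 0) :
    HasFDerivAt (fun Z : Plane => 1 / Z 1)
      ((-(X 1 ^ 2)⁻¹) • (EuclideanSpace.proj (𝕜 := ℝ) (1 : Fin 2) : Plane →L[ℝ] ℝ)) X := by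
  have h1 : HasFDerivAt (fun Z : Plane => Z 1)
      (EuclideanSpace.proj (𝕜 := ℝ) (1 : Fin 2) : Plane →L[ℝ] ℝ) X :=
    (EuclideanSpace.proj (𝕜 := ℝ) (1 : Fin 2) : Plane →L[ℝ] ℝ).hasFDerivAt
  have := (hasDerivAt_inv hX).comp_hasFDerivAt X h1
  simpa only [one_div, Function.comp_def] using this

theorem contDiffOn_one_div_coord (hsol : IsVariationalSolution Ω C ψ I) :
    ContDiffOn ℝ 1 (fun Z : Plane => 1 / Z 1) (positivitySet Ω ψ) := by
  apply ContDiffOn.div contDiffOn_const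
  · exact (EuclideanSpace.proj (𝕜 := ℝ) (1 : Fin 2) : Plane →L[ℝ] ℝ).contDiff.contDiffOn
  · exact fun X hX => (positivitySet_pos hsol hX).ne'

/-- The inner variation in the direction `ζ e_k`, with `ζ` supported in the positivity set. -/
theorem innerVariation_smul_coordVec (hsol : IsVariationalSolution Ω C ψ I) (k : Fin 2)
    {ζ : Plane → ℝ} (h1 : ContDiff ℝ ∞ ζ) (h2 : HasCompactSupport ζ)
    (h3 : tsupport ζ ⊆ positivitySet Ω ψ) :
    ∫ X, (((1 / X 1) * (fderiv ℝ ψ X (coordVec 0) ^ 2 + fderiv ℝ ψ X (coordVec 1) ^ 2) + X 1)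
        * fderiv ℝ ζ X (coordVec k)
      - (2 / X 1) * (fderiv ℝ ψ X (coordVec 0) * fderiv ℝ ζ X (coordVec 0)
        + fderiv ℝ ψ X (coordVec 1) * fderiv ℝ ζ X (coordVec 1)) * fderiv ℝ ψ X (coordVec k)
      - ζ X * coordVec k 1 * ((1 / X 1 ^ 2) *
        (fderiv ℝ ψ X (coordVec 0) ^ 2 + fderiv ℝ ψ X (coordVec 1) ^ 2) - 1)) = 0 := by
  set η : Plane → Plane := fun X => ζ X • coordVec k with hη
  have hts : tsupport η ⊆ tsupport ζ := tsupport_smul_subset_left ζ _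
  have hd : ∀ X, HasFDerivAt η ((fderiv ℝ ζ X).smulRight (coordVec k)) X := fun X =>
    (h1.differentiable (by simp) X).hasFDerivAt.smul_const _
  have hadm : IsAdmissibleField Ω η := by
    refine ⟨(h1.of_le (by simp)).smul contDiff_const, h2.smul_right, ?_, ?_⟩
    · exact fun X hX => interior_subset (h3 (hts hX.1)).1
    · intro X hX
      have : ζ X = 0 := image_eq_zero_of_notMem_tsupport fun h =>
        (positivitySet_pos hsol (h3 h)).ne' hX
      simp [hη, this]
  have h0 := hsol.innerVariation_eq_zero η hadm
  rw [innerVariation, setIntegral_eq_integral_of_forall_compl_eq_zero] at h0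
  · rw [← h0]
    apply integral_congr_ae
    filter_upwards [ae_eq_one_of_mem_positivitySet hsol, weakGrad_eq_gradient_ae hsol]
      with X hI hG
    have hdiv : divergence η X = fderiv ℝ ζ X (coordVec k) := by
      rw [divergence, (hd X).fderiv, Fin.sum_univ_two]
      fin_cases k <;> simp [coordVec_apply]
    rw [hdiv, (hd X).fderiv]
    by_cases hX : X ∈ positivitySet Ω ψ
    · rw [hI hX, hG hX, norm_sq_eq_coords]
      simp only [ContinuousLinearMap.smulRight_apply, gradient_apply, inner_smul_right, hη,
        PiLp.smul_apply, smul_eq_mul, mul_one]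
      rw [clm_apply_eq_coords (fderiv ℝ ζ X) (gradient ψ X), inner_eq_coords, gradient_apply,
        gradient_apply, smul_eq_mul, smul_eq_mul]
      fin_cases k <;> simp [coordVec_apply] <;> ring
    · have hz : X ∉ tsupport ζ := fun h => hX (h3 h)
      have hz0 : ζ X = 0 := image_eq_zero_of_notMem_tsupport hz
      have hz1 : fderiv ℝ ζ X = 0 := by
        by_contra hne
        exact hz (support_fderiv_subset (𝕜 := ℝ) hne)
      simp [hz0, hz1, hη]
  · intro X hX
    have hz : X ∉ tsupport ζ := fun h => hX (interior_subset (h3 h).1)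
    have hz0 : ζ X = 0 := image_eq_zero_of_notMem_tsupport hz
    have hz1 : fderiv ℝ ζ X = 0 := by
      by_contra hne
      exact hz (support_fderiv_subset (𝕜 := ℝ) hne)
    rw [divergence, (hd X).fderiv]
    simp [hz0, hz1, hη]

/-- The stationarity equations in the positivity set: the divergence of `∇ψ / y`, multiplied by
either partial derivative of `ψ`, vanishes. -/
theorem partial_mul_divergence_eq_zero (hsol : IsVariationalSolution Ω C ψ I) (k : Fin 2)
    {X : Plane} (hX : X ∈ positivitySet Ω ψ) :
    fderiv ℝ ψ X (coordVec k) *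
      ∑ i, fderiv ℝ (fun Z : Plane => (1 / Z 1) * fderiv ℝ ψ Z (coordVec i)) X (coordVec i)
      = 0 := by
  have hO := isOpen_positivitySet hsol
  set a : Plane → ℝ := fun X => fderiv ℝ ψ X (coordVec 0) with ha
  set b : Plane → ℝ := fun X => fderiv ℝ ψ X (coordVec 1) with hb
  set d : Plane → ℝ := fun X => fderiv ℝ ψ X (coordVec k) with hd
  set q : Plane → ℝ := fun X => 1 / X 1 with hq
  set y : Plane → ℝ := fun X => X 1 with hy
  have hac : ContDiffOn ℝ 1 a (positivitySet Ω ψ) := contDiffOn_partial hsol _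
  have hbc : ContDiffOn ℝ 1 b (positivitySet Ω ψ) := contDiffOn_partial hsol _
  have hdc : ContDiffOn ℝ 1 d (positivitySet Ω ψ) := contDiffOn_partial hsol _
  have hqc : ContDiffOn ℝ 1 q (positivitySet Ω ψ) := contDiffOn_one_div_coord hsol
  have hyc : ContDiffOn ℝ 1 y (positivitySet Ω ψ) :=
    (EuclideanSpace.proj (𝕜 := ℝ) (1 : Fin 2) : Plane →L[ℝ] ℝ).contDiff.contDiffOn
  set κ : Fin 2 → ℝ := fun j => coordVec k j with hκ
  set P0 : Plane → ℝ := fun X => κ 0 * (q X * (a X * a X + b X * b X) + y X)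
    - 2 * (q X * (a X * d X)) with hP0
  set P1 : Plane → ℝ := fun X => κ 1 * (q X * (a X * a X + b X * b X) + y X)
    - 2 * (q X * (b X * d X)) with hP1
  set S : Plane → ℝ := fun X => κ 1 * (1 - q X * q X * (a X * a X + b X * b X)) with hS
  have hP0c : ContDiffOn ℝ 1 P0 (positivitySet Ω ψ) :=
    (contDiffOn_const.mul ((hqc.mul ((hac.mul hac).add (hbc.mul hbc))).add hyc)).sub
      (contDiffOn_const.mul (hqc.mul (hac.mul hdc)))
  have hP1c : ContDiffOn ℝ 1 P1 (positivitySet Ω ψ) :=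
    (contDiffOn_const.mul ((hqc.mul ((hac.mul hac).add (hbc.mul hbc))).add hyc)).sub
      (contDiffOn_const.mul (hqc.mul (hbc.mul hdc)))
  have hSc : ContDiffOn ℝ 1 S (positivitySet Ω ψ) :=
    contDiffOn_const.mul (contDiffOn_const.sub
      ((hqc.mul hqc).mul ((hac.mul hac).add (hbc.mul hbc))))
  have hzero := eq_zero_of_integral_test hO (f := fun X =>
    S X - fderiv ℝ P0 X (coordVec 0) - fderiv ℝ P1 X (coordVec 1))
    ((hSc.continuousOn.sub (continuousOn_fderiv_apply hO hP0c _)).sub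
      (continuousOn_fderiv_apply hO hP1c _)) (fun ζ h1 h2 h3 => by
    have h1' : ContDiff ℝ 1 ζ := h1.of_le (by simp)
    have hv := innerVariation_smul_coordVec hsol k h1 h2 h3
    have e0 := integral_mul_fderiv_of_contDiffOn hO hP0c h1' h2 h3 (coordVec 0)
    have e1 := integral_mul_fderiv_of_contDiffOn hO hP1c h1' h2 h3 (coordVec 1)
    have i0 : Integrable fun X => P0 X * fderiv ℝ ζ X (coordVec 0) :=
      integrable_mul_of_tsupport hP0c.continuousOn (continuous_fderiv_apply h1' _) h2 h3
        (support_fderiv_apply_subset ζ _)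
    have i1 : Integrable fun X => P1 X * fderiv ℝ ζ X (coordVec 1) :=
      integrable_mul_of_tsupport hP1c.continuousOn (continuous_fderiv_apply h1' _) h2 h3
        (support_fderiv_apply_subset ζ _)
    have i2 : Integrable fun X => S X * ζ X :=
      integrable_mul_of_tsupport hSc.continuousOn h1.continuous h2 h3 (subset_tsupport ζ)
    have j0 : Integrable fun X => fderiv ℝ P0 X (coordVec 0) * ζ X :=
      integrable_mul_of_tsupport (continuousOn_fderiv_apply hO hP0c _) h1.continuous h2 h3
        (subset_tsupport ζ)
    have j1 : Integrable fun X => fderiv ℝ P1 X (coordVec 1) * ζ X :=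
      integrable_mul_of_tsupport (continuousOn_fderiv_apply hO hP1c _) h1.continuous h2 h3
        (subset_tsupport ζ)
    have hv2 : ∫ X, (P0 X * fderiv ℝ ζ X (coordVec 0) + P1 X * fderiv ℝ ζ X (coordVec 1)
        + S X * ζ X) = 0 := by
      rw [← hv]
      congr 1
      ext X
      have : fderiv ℝ ζ X (coordVec k)
          = κ 0 * fderiv ℝ ζ X (coordVec 0) + κ 1 * fderiv ℝ ζ X (coordVec 1) := by
        rw [clm_apply_eq_coords (fderiv ℝ ζ X) (coordVec k), smul_eq_mul, smul_eq_mul]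
      rw [this]
      simp only [hP0, hP1, hS, ha, hb, hd, hq, hy, hκ]
      ring
    have i01 : Integrable fun X => P0 X * fderiv ℝ ζ X (coordVec 0)
        + P1 X * fderiv ℝ ζ X (coordVec 1) := i0.add i1
    have i2j : Integrable fun X => S X * ζ X - fderiv ℝ P0 X (coordVec 0) * ζ X := i2.sub j0
    rw [integral_add i01 i2, integral_add i0 i1, e0, e1] at hv2
    simp only [sub_mul]
    rw [integral_sub i2j j1, integral_sub i2 j0]
    linarith)
  -- expand the derivatives at the point
  have hX1 := (positivitySet_pos hsol hX).ne'
  have hnhds := hO.mem_nhds hX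
  have ha' := ((hac.differentiableOn one_ne_zero).differentiableAt hnhds).hasFDerivAt
  have hb' := ((hbc.differentiableOn one_ne_zero).differentiableAt hnhds).hasFDerivAt
  have hd' := ((hdc.differentiableOn one_ne_zero).differentiableAt hnhds).hasFDerivAt
  have hq' : HasFDerivAt q _ X := hasFDerivAt_one_div_coord hX1
  have hy' : HasFDerivAt y (EuclideanSpace.proj (𝕜 := ℝ) (1 : Fin 2) : Plane →L[ℝ] ℝ) X :=
    (EuclideanSpace.proj (𝕜 := ℝ) (1 : Fin 2) : Plane →L[ℝ] ℝ).hasFDerivAt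
  have hE := (hq'.mul ((ha'.mul ha').add (hb'.mul hb'))).add hy'
  have hP0' : HasFDerivAt P0 _ X := (hE.const_mul (κ 0)).sub
    ((hq'.mul (ha'.mul hd')).const_mul 2)
  have hP1' : HasFDerivAt P1 _ X := (hE.const_mul (κ 1)).sub
    ((hq'.mul (hb'.mul hd')).const_mul 2)
  have hqa : HasFDerivAt (fun Z : Plane => (1 / Z 1) * fderiv ℝ ψ Z (coordVec 0)) _ X :=
    hq'.mul ha'
  have hqb : HasFDerivAt (fun Z : Plane => (1 / Z 1) * fderiv ℝ ψ Z (coordVec 1)) _ X :=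
    hq'.mul hb'
  have hsymm : fderiv ℝ a X (coordVec 1) = fderiv ℝ b X (coordVec 0) := by
    have hc : ContDiffAt ℝ 2 ψ X := (contDiffOn_positivitySet hsol).contDiffAt hnhds
    have hs := hc.isSymmSndFDerivAt (by simp)
    have hdd : DifferentiableAt ℝ (fderiv ℝ ψ) X :=
      (hc.fderiv_right (m := 1) (by norm_num)).differentiableAt one_ne_zero
    have e : ∀ v w : Plane, fderiv ℝ (fun Z => fderiv ℝ ψ Z v) X w
        = fderiv ℝ (fderiv ℝ ψ) X w v := by
      intro v w
      rw [fderiv_clm_apply hdd (differentiableAt_const v)]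
      simp
    rw [ha, hb, e, e]
    exact hs _ _
  have hz := hzero X hX
  rw [Fin.sum_univ_two, hqa.fderiv, hqb.fderiv]
  simp only [hP0'.fderiv, hP1'.fderiv] at hz
  have hq2 : q X * q X = (X 1 ^ 2)⁻¹ := by simp only [hq]; field_simp
  have hqX : q X ≠ 0 := by simp only [hq]; positivity
  simp only [hS, hq2] at hz
  fin_cases k
  · have hda : d = a := rfl
    rw [hda] at hz
    simp [hκ, coordVec_apply] at hz ⊢
    rw [← mul_eq_zero]
    linear_combination hz / 2 - q X * b X * hsymm
  · have hdb : d = b := rfl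
    rw [hdb] at hz
    simp [hκ, coordVec_apply] at hz ⊢
    rw [← mul_eq_zero]
    linear_combination hz / 2 + q X * a X * hsymm

/-- In the positivity set `ψ` solves `div (∇ψ / y) = 0`: where the divergence does not vanish, the
stationarity equations force `∇ψ = 0` on an open set, on which the divergence vanishes. -/
theorem divergence_eq_zero (hsol : IsVariationalSolution Ω C ψ I) {X : Plane}
    (hX : X ∈ positivitySet Ω ψ) :
    ∑ i, fderiv ℝ (fun Z : Plane => (1 / Z 1) * fderiv ℝ ψ Z (coordVec i)) X (coordVec i) = 0 := by
  have hO := isOpen_positivitySet hsol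
  have hFc : ∀ i, ContDiffOn ℝ 1 (fun Z : Plane => (1 / Z 1) * fderiv ℝ ψ Z (coordVec i))
      (positivitySet Ω ψ) := fun i =>
    (contDiffOn_one_div_coord hsol).mul (contDiffOn_partial hsol _)
  set D : Plane → ℝ := fun X =>
    ∑ i, fderiv ℝ (fun Z : Plane => (1 / Z 1) * fderiv ℝ ψ Z (coordVec i)) X (coordVec i) with hD
  have hDc : ContinuousOn D (positivitySet Ω ψ) :=
    continuousOn_finsetSum _ fun i _ => continuousOn_fderiv_apply hO (hFc i) _
  by_contra hne
  have hW : positivitySet Ω ψ ∩ D ⁻¹' {0}ᶜ ∈ 𝓝 X :=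
    (hDc.isOpen_inter_preimage hO isOpen_compl_singleton).mem_nhds ⟨hX, hne⟩
  apply hne
  apply Finset.sum_eq_zero
  intro i _
  have : (fun Z : Plane => (1 / Z 1) * fderiv ℝ ψ Z (coordVec i)) =ᶠ[𝓝 X] fun _ => 0 := by
    filter_upwards [hW] with Z hZ
    have := partial_mul_divergence_eq_zero hsol i hZ.1
    rcases mul_eq_zero.1 this with h | h
    · rw [h, mul_zero]
    · exact absurd h hZ.2
  rw [this.fderiv_eq]
  simp
end

/-! ### Testing with the stream function -/

section
variable {Ω : Set Plane} {C : ℝ} {ψ I : Plane → ℝ}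

theorem isCompact_tsupport_inter {Φ : Plane → ℝ}
    (hc : HasCompactSupport Φ) : IsCompact (tsupport Φ ∩ upperHalf) :=
  hc.inter_right (isClosed_le continuous_const (continuous_coord 1))

open Classical in
/-- Truncations of `ψ Φ` that are supported in the positivity set. -/
theorem exists_truncated_product (hsol : IsVariationalSolution Ω C ψ I) {β : ℝ → ℝ}
    (hβ : ContDiff ℝ ∞ β) (hβ0 : ∀ t ≤ 1, β t = 0) {Φ : Plane → ℝ} (hΦ : ContDiff ℝ 1 Φ)
    (hc : HasCompactSupport Φ) (hs : tsupport Φ ∩ upperHalf ⊆ Ω) {N : ℝ} (hN : 0 < N) :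
    ∃ w : Plane → ℝ, ContDiff ℝ 1 w ∧ HasCompactSupport w ∧ tsupport w ⊆ positivitySet Ω ψ ∧
      (∀ X ∉ positivitySet Ω ψ, w X = 0) ∧
      ∀ X ∈ positivitySet Ω ψ, ∀ v, fderiv ℝ w X v
        = deriv β (N * ψ X) * fderiv ℝ ψ X v * Φ X + β (N * ψ X) / N * fderiv ℝ Φ X v := by
  have hO := isOpen_positivitySet hsol
  set w : Plane → ℝ := fun X => if X ∈ positivitySet Ω ψ then β (N * ψ X) / N * Φ X else 0 with hw
  set K : Set Plane := (tsupport Φ ∩ upperHalf) ∩ ψ ⁻¹' Set.Ici (1 / N) with hK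
  have hKc : IsCompact K := by
    have h1 := isCompact_tsupport_inter hc
    exact h1.of_isClosed_subset ((hsol.continuousOn.mono hs).preimage_isClosed_of_isClosed
      h1.isClosed isClosed_Ici) Set.inter_subset_left
  have hKO : K ⊆ positivitySet Ω ψ := fun X hX =>
    mem_positivitySet_of_pos hsol (hs hX.1) ((by positivity : 0 < 1 / N).trans_le hX.2)
  have hsupp : Function.support w ⊆ K := by
    intro X hX
    rw [Function.mem_support] at hX
    simp only [hw] at hX
    split_ifs at hX with hXO
    · refine ⟨⟨subset_tsupport _ (right_ne_zero_of_mul hX),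
        le_of_lt (positivitySet_pos hsol hXO)⟩, ?_⟩
      have h1 : β (N * ψ X) ≠ 0 := fun h => hX (by rw [h]; simp)
      have h2 : 1 < N * ψ X := by
        by_contra hcon
        exact h1 (hβ0 _ (not_lt.1 hcon))
      change 1 / N ≤ ψ X
      rw [div_le_iff₀ hN]
      linarith
    · exact absurd rfl hX
  have htw : tsupport w ⊆ K := closure_minimal hsupp hKc.isClosed
  have heq : ∀ X ∈ positivitySet Ω ψ, w =ᶠ[𝓝 X] fun Z => β (N * ψ Z) / N * Φ Z := by
    intro X hX
    filter_upwards [hO.mem_nhds hX] with Z hZ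
    simp only [hw, if_pos hZ]
  have hψ : ∀ X ∈ positivitySet Ω ψ, ContDiffAt ℝ 1 ψ X := fun X hX =>
    ((contDiffOn_positivitySet hsol).contDiffAt (hO.mem_nhds hX)).of_le (by norm_num)
  refine ⟨w, ?_, HasCompactSupport.intro hKc fun X hX => ?_, htw.trans hKO, ?_, ?_⟩
  · rw [contDiff_iff_contDiffAt]
    intro X
    by_cases hX : X ∈ tsupport w
    swap
    · exact contDiffAt_const.congr_of_eventuallyEq (notMem_tsupport_iff_eventuallyEq.1 hX)
    have hXO := hKO (htw hX)
    refine ContDiffAt.congr_of_eventuallyEq ?_ (heq X hXO)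
    exact (((hβ.of_le (by simp)).contDiffAt.comp X (contDiffAt_const.mul (hψ X hXO))).div_const
      N).mul hΦ.contDiffAt
  · by_contra hne
    exact hX (hsupp hne)
  · intro X hX
    simp only [hw, if_neg hX]
  · intro X hX v
    have h1 := ((hψ X hX).differentiableAt one_ne_zero).hasFDerivAt
    have h2 := (hβ.differentiable (by simp) (N * ψ X)).hasDerivAt
    have h3 := h2.comp_hasFDerivAt X (h1.const_mul N)
    have h4 := (h3.mul_const N⁻¹).mul (hΦ.differentiable one_ne_zero X).hasFDerivAt
    have h5 : HasFDerivAt w _ X := h4.congr_of_eventuallyEq (by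
      filter_upwards [heq X hX] with Z hZ
      rw [hZ, div_eq_mul_inv]; rfl)
    rw [h5.fderiv]
    simp
    field_simp
    ring

/-- A divergence free vector field on the positivity set is orthogonal to `∇(ψ Φ)`: test with
truncations of `ψ Φ`, whose support is a compact part of the positivity set. -/
theorem integral_sum_eq_zero_of_divergence_free (hsol : IsVariationalSolution Ω C ψ I)
    {a : Fin 2 → Plane → ℝ} {A : ℝ} (hA0 : 0 ≤ A)
    (ha : ∀ i, ContDiffOn ℝ 1 (a i) (positivitySet Ω ψ))
    (hdiv : ∀ X ∈ positivitySet Ω ψ, ∑ i, fderiv ℝ (a i) X (coordVec i) = 0)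
    (hA : ∀ X ∈ positivitySet Ω ψ, ∀ i, |a i X| ≤ A) {Φ : Plane → ℝ} (hΦ : ContDiff ℝ 1 Φ)
    (hc : HasCompactSupport Φ) (hs : tsupport Φ ∩ upperHalf ⊆ Ω) :
    ∫ X in positivitySet Ω ψ, ∑ i, a i X * (fderiv ℝ ψ X (coordVec i) * Φ X
      + ψ X * fderiv ℝ Φ X (coordVec i)) = 0 := by
  have hO := isOpen_positivitySet hsol
  obtain ⟨β, m, hβ, hβ0, hβ2, hβm, hβle⟩ := exists_truncation
  have hm : 0 ≤ m := (abs_nonneg _).trans (hβm 0)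
  have hβd : ∀ t, 2 < t → deriv β t = 1 := by
    intro t ht
    have : β =ᶠ[𝓝 t] fun s => s := by
      filter_upwards [Ioi_mem_nhds ht] with s hs using hβ2 s (le_of_lt hs)
    rw [this.deriv_eq]; simp
  have hN : ∀ n : ℕ, (0 : ℝ) < n + 1 := fun n => by positivity
  choose w hw1 hw2 hw3 hw4 hw5 using fun n : ℕ =>
    exists_truncated_product hsol hβ hβ0 hΦ hc hs (hN n)
  have hzero : ∀ n, ∫ X in positivitySet Ω ψ, ∑ i, a i X * fderiv ℝ (w n) X (coordVec i) = 0 := by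
    intro n
    have hi : ∀ i, Integrable fun X => a i X * fderiv ℝ (w n) X (coordVec i) := fun i =>
      integrable_mul_of_tsupport (ha i).continuousOn (continuous_fderiv_apply (hw1 n) _) (hw2 n)
        (hw3 n) (support_fderiv_apply_subset _ _)
    have hj : ∀ i, Integrable fun X => fderiv ℝ (a i) X (coordVec i) * w n X := fun i =>
      integrable_mul_of_tsupport (continuousOn_fderiv_apply hO (ha i) _) (hw1 n).continuous (hw2 n)
        (hw3 n) (subset_tsupport _)
    rw [setIntegral_eq_integral_of_forall_compl_eq_zero, integral_finsetSum _ fun i _ => hi i]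
    · rw [Finset.sum_congr rfl fun i _ =>
        integral_mul_fderiv_of_contDiffOn hO (ha i) (hw1 n) (hw2 n) (hw3 n) (coordVec i)]
      rw [Finset.sum_neg_distrib, ← integral_finsetSum _ fun i _ => hj i, neg_eq_zero]
      apply integral_eq_zero_of_ae
      refine ae_of_all _ fun X => ?_
      simp only [Pi.zero_apply]
      rw [← Finset.sum_mul]
      by_cases hX : X ∈ positivitySet Ω ψ
      · rw [hdiv X hX, zero_mul]
      · rw [hw4 n X hX, mul_zero]
    · intro X hX
      apply Finset.sum_eq_zero
      intro i _
      have : fderiv ℝ (w n) X (coordVec i) = 0 := by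
        by_contra hne
        exact hX (hw3 n (support_fderiv_apply_subset _ _ hne))
      rw [this, mul_zero]
  set Kc := tsupport Φ ∩ upperHalf with hKc
  have hKcc : IsCompact Kc := isCompact_tsupport_inter hc
  set k : Plane → ℝ := fun X => ∑ i : Fin 2, A * (m * (|C| * X 1) * |Φ X|
    + ψ X * |fderiv ℝ Φ X (coordVec i)|) with hk
  have hkc : ContinuousOn k Kc := by
    apply continuousOn_finsetSum
    intro i _
    have h1 := (continuous_fderiv_apply hΦ (coordVec i)).abs.continuousOn (s := Kc)
    have h2 := hΦ.continuous.abs.continuousOn (s := Kc)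
    have h3 := hsol.continuousOn.mono hs
    have h4 := (continuous_coord 1).continuousOn (s := Kc)
    fun_prop
  have hki : Integrable (Kc.indicator k) (volume.restrict (positivitySet Ω ψ)) :=
    ((integrable_indicator_iff hKcc.measurableSet).2 (hkc.integrableOn_compact hKcc)).integrableOn
  have hlim := tendsto_integral_of_dominated_convergence
    (μ := volume.restrict (positivitySet Ω ψ))
    (F := fun n X => ∑ i, a i X * fderiv ℝ (w n) X (coordVec i))
    (f := fun X => ∑ i, a i X * (fderiv ℝ ψ X (coordVec i) * Φ X
      + ψ X * fderiv ℝ Φ X (coordVec i))) (Kc.indicator k) ?_ hki ?_ ?_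
  · simp only [hzero] at hlim
    exact (tendsto_nhds_unique hlim tendsto_const_nhds)
  · intro n
    apply ContinuousOn.aestronglyMeasurable _ hO.measurableSet
    apply continuousOn_finsetSum
    intro i _
    exact (ha i).continuousOn.mul (continuous_fderiv_apply (hw1 n) _).continuousOn
  · intro n
    rw [ae_restrict_iff' hO.measurableSet]
    refine ae_of_all _ fun X hX => ?_
    have hXp := positivitySet_pos hsol hX
    have hψ0 : 0 < ψ X := hX.2
    by_cases hXΦ : X ∈ tsupport Φ
    · rw [Set.indicator_of_mem (show X ∈ Kc from ⟨hXΦ, le_of_lt hXp⟩)]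
      refine (norm_sum_le _ _).trans (Finset.sum_le_sum fun i _ => ?_)
      rw [Real.norm_eq_abs, abs_mul, hw5 n X hX]
      apply mul_le_mul (hA X hX i) _ (abs_nonneg _) hA0
      refine (abs_add_le _ _).trans (add_le_add ?_ ?_)
      · rw [abs_mul, abs_mul]
        apply mul_le_mul_of_nonneg_right _ (abs_nonneg _)
        apply mul_le_mul (hβm _) _ (abs_nonneg _) hm
        rw [← gradient_apply]
        exact (PiLp.norm_apply_le (gradient ψ X) i).trans (norm_gradient_le hsol hX)
      · rw [abs_mul, abs_div, abs_of_pos (hN n)]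
        apply mul_le_mul_of_nonneg_right _ (abs_nonneg _)
        rw [div_le_iff₀ (hN n)]
        have := hβle ((n + 1) * ψ X) (by positivity)
        linarith
    · rw [Set.indicator_of_notMem fun h => hXΦ h.1]
      have h1 : Φ X = 0 := image_eq_zero_of_notMem_tsupport hXΦ
      have h2 : ∀ v, fderiv ℝ Φ X v = 0 := fun v => by
        by_contra hne
        exact hXΦ (support_fderiv_apply_subset _ _ hne)
      simp [hw5 n X hX, h1, h2]
  · rw [ae_restrict_iff' hO.measurableSet]
    refine ae_of_all _ fun X hX => ?_
    have hψ0 : 0 < ψ X := hX.2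
    apply tendsto_nhds_of_eventually_eq
    obtain ⟨n₀, hn₀⟩ := exists_nat_gt (2 / ψ X)
    filter_upwards [eventually_ge_atTop n₀] with n hn
    have h1 : 2 < ((n : ℝ) + 1) * ψ X := by
      rw [← div_lt_iff₀ hψ0]
      have : (n₀ : ℝ) ≤ n := by exact_mod_cast hn
      linarith
    apply Finset.sum_congr rfl
    intro i _
    rw [hw5 n X hX, hβd _ h1, hβ2 _ h1.le, mul_div_cancel_left₀ _ (hN n).ne', one_mul]

theorem streamGrad_apply_of_mem {X : Plane} (hX : X ∈ positivitySet Ω ψ) (i : Fin 2) :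
    streamGrad Ω ψ X i = fderiv ℝ ψ X (coordVec i) := by
  rw [streamGrad, if_pos hX, gradient_apply]

theorem streamGrad_of_notMem {X : Plane} (hX : X ∉ positivitySet Ω ψ) :
    streamGrad Ω ψ X = 0 := by
  rw [streamGrad, if_neg hX]

/-- The gradient of `ψ` on its positivity set, extended by zero, is the weak gradient. -/
theorem weakGrad_eq_streamGrad_ae (hsol : IsVariationalSolution Ω C ψ I) :
    ∀ᵐ X, X ∈ interior Ω → weakGrad Ω ψ X = streamGrad Ω ψ X := by
  have hO := isOpen_positivitySet hsol
  have hG := weakGrad_spec hsol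
  have hbd : ∀ K : Set Plane, IsCompact K → ∃ B, ∀ X ∈ K, X ∈ interior Ω →
      ‖streamGrad Ω ψ X‖ ≤ B := by
    intro K hK
    obtain ⟨B, hB⟩ := hK.exists_bound_of_continuousOn (continuous_coord 1).continuousOn
    refine ⟨|C| * B, fun X hX hXΩ => ?_⟩
    have h0 := ((mem_interior_iff hsol.isOpen).1 hXΩ).2
    refine (norm_streamGrad_le hsol h0.le).trans ?_
    exact mul_le_mul_of_nonneg_left ((le_abs_self _).trans (hB X hX)) (abs_nonneg _)
  have hgloc : ∀ i : Fin 2, LocallyIntegrableOn (fun X => streamGrad Ω ψ X i) (interior Ω) := by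
    intro i
    rw [locallyIntegrableOn_iff isOpen_interior.isLocallyClosed]
    intro K hK hKc
    obtain ⟨B, hB⟩ := hbd K hKc
    refine Measure.integrableOn_of_bounded (M := B) hKc.measure_lt_top.ne ?_ ?_
    · exact ((continuous_coord i).measurable.comp
        (measurable_streamGrad hsol)).aestronglyMeasurable
    · rw [ae_restrict_iff' hKc.measurableSet]
      refine ae_of_all _ fun X hX => ?_
      exact (PiLp.norm_apply_le _ i).trans (hB X hX (hK hX))
  have key : ∀ i : Fin 2, ∀ᵐ X, X ∈ interior Ω →
      weakGrad Ω ψ X i - streamGrad Ω ψ X i = 0 := by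
    intro i
    have hGi : LocallyIntegrableOn (fun X => weakGrad Ω ψ X i) (interior Ω) := by
      intro X hX
      obtain ⟨s, hs, hs'⟩ := hG.locInt_grad X hX
      refine ⟨s, hs, ?_⟩
      exact (EuclideanSpace.proj (𝕜 := ℝ) i : Plane →L[ℝ] ℝ).integrable_comp hs'
    apply isOpen_interior.ae_eq_zero_of_integral_contDiff_smul_eq_zero (hGi.sub (hgloc i))
    intro φ h1 h2 h3
    have h1' : ContDiff ℝ 1 φ := h1.of_le (by simp)
    have h4 := hG.integral_eq φ h1 h2 h3 i
    have h0 : ∀ X ∉ interior Ω, φ X = 0 := fun X hX =>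
      image_eq_zero_of_notMem_tsupport fun h => hX (h3 h)
    -- test with the constant field in the direction of the `i`-th coordinate
    have h5 := integral_sum_eq_zero_of_divergence_free hsol
      (a := fun j _ => if j = i then 1 else 0) (A := 1) zero_le_one
      (fun j => contDiffOn_const) (fun X _ => by simp)
      (fun X _ j => by split_ifs <;> simp) h1' h2
      (Set.inter_subset_left.trans (h3.trans interior_subset))
    simp only [ite_mul, one_mul, zero_mul, Finset.sum_ite_eq', Finset.mem_univ, if_true] at h5
    have intK : ∀ f : Plane → ℝ, LocallyIntegrableOn f (interior Ω) →
        Integrable fun X => f X * φ X := by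
      intro f hf
      have hK : IntegrableOn f (tsupport φ) := hf.integrableOn_compact_subset h3 h2
      have := hK.mul_continuousOn h1.continuous.continuousOn h2
      rwa [integrableOn_iff_integrable_of_support_subset] at this
      exact fun X hX => subset_tsupport _ (right_ne_zero_of_mul hX)
    have i1 := intK _ hGi
    have i2 := intK _ (hgloc i)
    have i3 : Integrable fun X => ψ X * fderiv ℝ φ X (coordVec i) :=
      integrable_mul_of_tsupport (hsol.continuousOn.mono interior_subset)
        (continuous_fderiv_apply h1' _) h2 h3 (support_fderiv_apply_subset φ _)
    have h6 : ∫ X in interior Ω, (streamGrad Ω ψ X i * φ X + ψ X * fderiv ℝ φ X (coordVec i))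
        = 0 := by
      rw [← h5]
      refine (setIntegral_eq_of_subset_of_forall_sdiff_eq_zero isOpen_interior.measurableSet
        (Set.inter_subset_left : positivitySet Ω ψ ⊆ interior Ω) ?_).trans ?_
      · rintro X ⟨hX1, hX2⟩
        have hψ : ψ X = 0 := by
          refine le_antisymm (not_lt.1 fun h => hX2 ⟨hX1, h⟩) (hsol.nonneg X (interior_subset hX1))
        simp [streamGrad_of_notMem hX2, hψ]
      · apply setIntegral_congr_fun hO.measurableSet
        intro X hX
        simp only [streamGrad_apply_of_mem hX]
    rw [integral_add i2.integrableOn i3.integrableOn, h4] at h6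
    rw [setIntegral_eq_integral_of_forall_compl_eq_zero (fun X hX => by rw [h0 X hX, mul_zero]),
      setIntegral_eq_integral_of_forall_compl_eq_zero (fun X hX => by rw [h0 X hX, mul_zero])] at h6
    calc ∫ X, φ X • (weakGrad Ω ψ X i - streamGrad Ω ψ X i)
        = ∫ X, (weakGrad Ω ψ X i * φ X - streamGrad Ω ψ X i * φ X) := by
          congr 1; ext X; rw [smul_eq_mul]; ring
      _ = 0 := by rw [integral_sub i1 i2]; linarith
  filter_upwards [key 0, key 1] with X h0 h1 hX
  ext i
  fin_cases i
  · simpa using sub_eq_zero.1 (h0 hX)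
  · simpa using sub_eq_zero.1 (h1 hX)

/-- The energy identity: test the equation of `ψ` with `ψ Φ`. -/
theorem energy_identity (hsol : IsVariationalSolution Ω C ψ I) {Φ : Plane → ℝ}
    (hΦ : ContDiff ℝ 1 Φ) (hc : HasCompactSupport Φ) (hs : tsupport Φ ∩ upperHalf ⊆ Ω) :
    ∫ X in Ω, (Φ X * ((1 / X 1) * ‖streamGrad Ω ψ X‖ ^ 2)
      + (1 / X 1) * ψ X * fderiv ℝ Φ X (streamGrad Ω ψ X)) = 0 := by
  have hO := isOpen_positivitySet hsol
  have h := integral_sum_eq_zero_of_divergence_free hsol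
    (a := fun i Z => (1 / Z 1) * fderiv ℝ ψ Z (coordVec i)) (A := |C|) (abs_nonneg C)
    (fun i => (contDiffOn_one_div_coord hsol).mul (contDiffOn_partial hsol _))
    (fun X hX => divergence_eq_zero hsol hX) (fun X hX i => by
      have hp := positivitySet_pos hsol hX
      rw [abs_mul, abs_of_pos (by positivity), one_div, inv_mul_le_iff₀ hp, ← gradient_apply,
        mul_comm]
      exact (PiLp.norm_apply_le (gradient ψ X) i).trans (norm_gradient_le hsol hX)) hΦ hc hs
  rw [← h]
  refine (setIntegral_eq_of_subset_of_forall_sdiff_eq_zero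
    (measurableSet_of_isOpenInUpperHalf hsol.isOpen)
    (fun X hX => interior_subset hX.1 : positivitySet Ω ψ ⊆ Ω) ?_).trans ?_
  · rintro X ⟨-, hX2⟩
    simp [streamGrad_of_notMem hX2]
  · apply setIntegral_congr_fun hO.measurableSet
    intro X hX
    simp only
    rw [norm_sq_eq_coords, clm_apply_eq_coords (fderiv ℝ Φ X), Fin.sum_univ_two,
      streamGrad_apply_of_mem hX, streamGrad_apply_of_mem hX]
    simp only [smul_eq_mul]
    ring
end

/-! ### Densities on half-circles -/

/-- Measurable functions that are bounded on the half-disc off the axis. -/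
def IsArcBounded (X₀ : Plane) (R : ℝ) (f : Plane → ℝ) : Prop :=
  Measurable f ∧ ∃ b, ∀ X ∈ openHalfBall X₀ R, |f X| ≤ b

namespace IsArcBounded
variable {X₀ : Plane} {R : ℝ} {f g : Plane → ℝ}

theorem add (hf : IsArcBounded X₀ R f) (hg : IsArcBounded X₀ R g) :
    IsArcBounded X₀ R fun X => f X + g X := by
  obtain ⟨hf, b, hb⟩ := hf
  obtain ⟨hg, b', hb'⟩ := hg
  exact ⟨hf.add hg, b + b', fun X hX => (abs_add_le _ _).trans (add_le_add (hb X hX) (hb' X hX))⟩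

theorem mul (hf : IsArcBounded X₀ R f) (hg : IsArcBounded X₀ R g) :
    IsArcBounded X₀ R fun X => f X * g X := by
  obtain ⟨hf, b, hb⟩ := hf
  obtain ⟨hg, b', hb'⟩ := hg
  refine ⟨hf.mul hg, b * b', fun X hX => ?_⟩
  rw [abs_mul]
  exact mul_le_mul (hb X hX) (hb' X hX) (abs_nonneg _) ((abs_nonneg _).trans (hb X hX))

theorem comp_dist {φ : ℝ → ℝ} (hφ : Continuous φ) :
    IsArcBounded X₀ R fun X => φ (dist X X₀) := by
  obtain ⟨b, hb⟩ := (isCompact_Icc (a := 0) (b := R)).exists_bound_of_continuousOn hφ.continuousOn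
  exact ⟨(hφ.comp (continuous_id.dist continuous_const)).measurable, b, fun X hX =>
    hb _ ⟨dist_nonneg, le_of_lt (Metric.mem_ball.1 hX.1)⟩⟩

theorem const (c : ℝ) : IsArcBounded X₀ R fun _ => c := ⟨measurable_const, |c|, fun _ _ => le_rfl⟩

theorem const_mul (c : ℝ) (hf : IsArcBounded X₀ R f) : IsArcBounded X₀ R fun X => c * f X :=
  (const c).mul hf

theorem sub (hf : IsArcBounded X₀ R f) (hg : IsArcBounded X₀ R g) :
    IsArcBounded X₀ R fun X => f X - g X := by
  simpa [sub_eq_add_neg] using hf.add (hg.const_mul (-1))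

theorem integrableOn_angle (hf : IsArcBounded X₀ R f) (hX : X₀ 1 = 0 ∨ R ≤ X₀ 1) {r : ℝ}
    (hr : r ∈ Set.Ioo 0 R) :
    IntegrableOn (fun θ => r * f (polarPt X₀ r θ)) (polarAngles X₀) := by
  obtain ⟨hf, b, hb⟩ := hf
  refine Measure.integrableOn_of_bounded (M := r * b) (volume_polarAngles_lt_top X₀).ne ?_ ?_
  · exact (measurable_const.mul
      (hf.comp (lipschitzWith_polarPt X₀ hr.1.le).continuous.measurable)).aestronglyMeasurable
  · rw [ae_restrict_iff' (measurableSet_polarAngles X₀)]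
    refine ae_of_all _ fun θ hθ => ?_
    rw [norm_mul, Real.norm_eq_abs, Real.norm_eq_abs, abs_of_pos hr.1]
    exact mul_le_mul_of_nonneg_left (hb _ (polarPt_mem_openHalfBall hX hr hθ)) hr.1.le

theorem integrableOn_arc (hf : IsArcBounded X₀ R f) (hX : X₀ 1 = 0 ∨ R ≤ X₀ 1) :
    IntegrableOn (arcIntegral f X₀) (Set.Ioo 0 R) := by
  obtain ⟨hf, b, hb⟩ := hf
  exact integrableOn_arcIntegral hX hf hb

theorem intervalIntegrable_arc (hf : IsArcBounded X₀ R f) (hX : X₀ 1 = 0 ∨ R ≤ X₀ 1)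
    (hR : 0 < R) : IntervalIntegrable (arcIntegral f X₀) volume 0 R := by
  rw [intervalIntegrable_iff_integrableOn_Ioo_of_le hR.le]
  exact hf.integrableOn_arc hX

theorem mono (hf : IsArcBounded X₀ R f) {r : ℝ} (hr : r ≤ R) : IsArcBounded X₀ r f := by
  obtain ⟨hf, b, hb⟩ := hf
  exact ⟨hf, b, fun X hX => hb X ⟨Metric.ball_subset_ball hr hX.1, hX.2⟩⟩

theorem integral_halfBall_eq (hf : IsArcBounded X₀ R f) (hX : X₀ 1 = 0 ∨ R ≤ X₀ 1) :
    ∫ X in halfBall X₀ R, f X = ∫ r in Set.Ioo 0 R, arcIntegral f X₀ r := by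
  obtain ⟨hf, b, hb⟩ := hf
  exact integral_halfBall hX hf hb

theorem integral_halfBall_eq_interval (hf : IsArcBounded X₀ R f) (hX : X₀ 1 = 0 ∨ R ≤ X₀ 1)
    {r : ℝ} (hr : r ∈ Set.Ioo 0 R) :
    ∫ X in halfBall X₀ r, f X = ∫ s in (0 : ℝ)..r, arcIntegral f X₀ s := by
  rw [(hf.mono hr.2.le).integral_halfBall_eq (hX.imp_right hr.2.le.trans),
    intervalIntegral.integral_of_le hr.1.le, integral_Ioc_eq_integral_Ioo]

theorem arc_add (hf : IsArcBounded X₀ R f) (hg : IsArcBounded X₀ R g)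
    (hX : X₀ 1 = 0 ∨ R ≤ X₀ 1) {r : ℝ} (hr : r ∈ Set.Ioo 0 R) :
    arcIntegral (fun X => f X + g X) X₀ r = arcIntegral f X₀ r + arcIntegral g X₀ r := by
  simp only [arcIntegral, mul_add]
  exact integral_add (hf.integrableOn_angle hX hr) (hg.integrableOn_angle hX hr)

theorem arc_sub (hf : IsArcBounded X₀ R f) (hg : IsArcBounded X₀ R g)
    (hX : X₀ 1 = 0 ∨ R ≤ X₀ 1) {r : ℝ} (hr : r ∈ Set.Ioo 0 R) :
    arcIntegral (fun X => f X - g X) X₀ r = arcIntegral f X₀ r - arcIntegral g X₀ r := by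
  simp only [arcIntegral, mul_sub]
  exact integral_sub (hf.integrableOn_angle hX hr) (hg.integrableOn_angle hX hr)

end IsArcBounded

theorem arc_const_mul (c : ℝ) (f : Plane → ℝ) (X₀ : Plane) (r : ℝ) :
    arcIntegral (fun X => c * f X) X₀ r = c * arcIntegral f X₀ r := by
  simp only [arcIntegral]
  rw [← integral_const_mul]
  congr 1; ext θ; ring

theorem arc_comp_dist_mul (φ : ℝ → ℝ) (f : Plane → ℝ) (X₀ : Plane) {r : ℝ} (hr : 0 ≤ r) :
    arcIntegral (fun X => φ (dist X X₀) * f X) X₀ r = φ r * arcIntegral f X₀ r := by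
  rw [← arc_const_mul]
  simp only [arcIntegral, dist_polarPt_center X₀ hr]

theorem arc_nonneg {X₀ : Plane} {R r : ℝ} (hX : X₀ 1 = 0 ∨ R ≤ X₀ 1) (hr : r ∈ Set.Ioo 0 R)
    {f : Plane → ℝ} (h : ∀ X ∈ openHalfBall X₀ R, 0 ≤ f X) : 0 ≤ arcIntegral f X₀ r := by
  apply setIntegral_nonneg (measurableSet_polarAngles X₀)
  intro θ hθ
  exact mul_nonneg hr.1.le (h _ (polarPt_mem_openHalfBall hX hr hθ))

theorem abs_arc_le {X₀ : Plane} {R r b : ℝ} (hX : X₀ 1 = 0 ∨ R ≤ X₀ 1) (hr : r ∈ Set.Ioo 0 R)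
    {f : Plane → ℝ} (hb0 : 0 ≤ b) (h : ∀ X ∈ openHalfBall X₀ R, dist X X₀ = r → |f X| ≤ b) :
    |arcIntegral f X₀ r| ≤ 2 * Real.pi * (r * b) :=
  abs_arcIntegral_le hr.1.le (fun θ hθ => h _ (polarPt_mem_openHalfBall hX hr hθ)
    (dist_polarPt_center X₀ hr.1.le θ)) hb0

theorem abs_integral_arc_le {X₀ : Plane} {R r b : ℝ} (hX : X₀ 1 = 0 ∨ R ≤ X₀ 1)
    (hr : r ∈ Set.Ioo 0 R) {f : Plane → ℝ} (hb0 : 0 ≤ b)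
    (h : ∀ X ∈ openHalfBall X₀ R, dist X X₀ ≤ r → |f X| ≤ b) :
    |∫ s in (0 : ℝ)..r, arcIntegral f X₀ s| ≤ 2 * Real.pi * (r * b) * r := by
  have := intervalIntegral.norm_integral_le_of_norm_le_const (a := 0) (b := r)
    (f := arcIntegral f X₀) (C := 2 * Real.pi * (r * b)) (fun s hs => by
      rw [Set.uIoc_of_le hr.1.le] at hs
      have hs' : s ∈ Set.Ioo 0 R := ⟨hs.1, hs.2.trans_lt hr.2⟩
      refine (abs_arc_le hX hs' hb0 fun X hX' hd => h X hX' (hd ▸ hs.2)).trans ?_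
      have := hs.2
      have := Real.pi_pos
      gcongr)
  rwa [sub_zero, abs_of_pos hr.1] at this

/-! ### The monotonicity formula -/

/-- The component of `g` in the direction away from `X₀`. -/
noncomputable def radialPart (X₀ : Plane) (g : Plane → Plane) (X : Plane) : ℝ :=
  inner ℝ (g X) (X - X₀) / dist X X₀

/-- The density `|g|² / y`. -/
noncomputable def kineticDensity (g : Plane → Plane) (X : Plane) : ℝ := (1 / X 1) * ‖g X‖ ^ 2

/-- The density `|g|² / y + y I`. -/
noncomputable def energyDensity (g : Plane → Plane) (I : Plane → ℝ) (X : Plane) : ℝ :=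
  (1 / X 1) * ‖g X‖ ^ 2 + X 1 * I X

/-- The zeroth order term of the inner variation in the direction `φ(|X - X₀|) (X - X₀)`. -/
noncomputable def variationDensity (X₀ : Plane) (g : Plane → Plane) (I : Plane → ℝ) (X : Plane) :
    ℝ :=
  2 * energyDensity g I X - 2 * kineticDensity g X
    - (X 1 - X₀ 1) * ((1 / X 1 ^ 2) * ‖g X‖ ^ 2 - I X)

/-- A radial cut-off profile: smooth, constant near `0`, and vanishing near `R`. -/
def IsCutoffProfile (R : ℝ) (φ : ℝ → ℝ) : Prop :=
  ContDiff ℝ ∞ φ ∧ ∃ s t, 0 < s ∧ t < R ∧ (∀ x ≤ s, φ x = φ s) ∧ ∀ x, t ≤ x → φ x = 0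

/-- What the monotonicity formula needs to know about the stream function `u` with gradient `g` and
the phase `I` on the half-disc of radius `R` around a point `X₀` with `u X₀ = 0`: the growth of `u`
and `g`, and the energy identity and the inner variation for radial cut-offs. -/
structure MonotonicityData (X₀ : Plane) (R c : ℝ) (u : Plane → ℝ) (g : Plane → Plane)
    (I : Plane → ℝ) : Prop where
  R_pos : 0 < R
  c_nonneg : 0 ≤ c
  center : X₀ 1 = 0 ∨ 2 * R ≤ X₀ 1
  meas_u : Measurable u
  meas_g : Measurable g
  meas_I : Measurable I
  u_nonneg : ∀ X ∈ openHalfBall X₀ R, 0 ≤ u X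
  g_le : ∀ X ∈ openHalfBall X₀ R, ‖g X‖ ≤ c * X 1
  u_le : ∀ X ∈ openHalfBall X₀ R, u X ≤ 3 * c * X 1 * dist X X₀
  I_mem : ∀ X ∈ openHalfBall X₀ R, I X = 0 ∨ I X = 1
  hasFDerivAt_sq : ∀ X ∈ openHalfBall X₀ R,
    HasFDerivAt (fun Z => u Z ^ 2) ((2 * u X) • innerSL ℝ (g X)) X
  energy : ∀ φ, IsCutoffProfile R φ →
    ∫ X in halfBall X₀ R, (φ (dist X X₀) * kineticDensity g X
      + deriv φ (dist X X₀) * ((1 / X 1) * u X * radialPart X₀ g X)) = 0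
  variation : ∀ φ, IsCutoffProfile R φ →
    ∫ X in halfBall X₀ R, (φ (dist X X₀) * variationDensity X₀ g I X
      + deriv φ (dist X X₀) * (dist X X₀ * (energyDensity g I X
        - 2 * ((1 / X 1) * radialPart X₀ g X ^ 2)))) = 0

/-- The constant in the error term of the monotonicity formula. -/
noncomputable def errorConst (c : ℝ) : ℝ := 2 * Real.pi * (c ^ 2 + 1) + 18 * Real.pi * c ^ 2

theorem errorConst_nonneg (c : ℝ) : 0 ≤ errorConst c := by
  have := Real.pi_pos
  unfold errorConst; positivity

/-- The monotone quantity, written with integrals over half-circles. -/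
noncomputable def monoQuantity (X₀ : Plane) (u : Plane → ℝ) (g : Plane → Plane) (I : Plane → ℝ)
    (r : ℝ) : ℝ :=
  (r ^ (growthExp X₀ + 1))⁻¹ * (∫ s in (0 : ℝ)..r, arcIntegral (energyDensity g I) X₀ s)
    - (growthExp X₀ : ℝ) * (r ^ (growthExp X₀ + 2))⁻¹
      * arcIntegral (fun X => (1 / X 1) * u X ^ 2) X₀ r

/-- The monotone quantity without the phase term. For solutions that are homogeneous of degree `μ`
about `X₀` it vanishes, up to lower order terms off the axis. -/
noncomputable def homogeneityDefect (X₀ : Plane) (u : Plane → ℝ) (g : Plane → Plane) (r : ℝ) : ℝ :=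
  (r ^ (growthExp X₀ + 1))⁻¹ * (∫ s in (0 : ℝ)..r, arcIntegral (kineticDensity g) X₀ s)
    - (growthExp X₀ : ℝ) * (r ^ (growthExp X₀ + 2))⁻¹
      * arcIntegral (fun X => (1 / X 1) * u X ^ 2) X₀ r

theorem growthExp_cases (X₀ : Plane) :
    (X₀ 1 = 0 ∧ growthExp X₀ = 2) ∨ (X₀ 1 ≠ 0 ∧ growthExp X₀ = 1) := by
  by_cases h0 : X₀ 1 = 0
  · exact Or.inl ⟨h0, by simp [growthExp, h0]⟩
  · exact Or.inr ⟨h0, by simp [growthExp, h0]⟩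

theorem pow_growthExp (X₀ : Plane) (r : ℝ) : r * r ^ (growthExp X₀ - 1) = r ^ growthExp X₀ := by
  rcases growthExp_cases X₀ with ⟨-, h⟩ | ⟨-, h⟩ <;> rw [h] <;> ring

namespace MonotonicityData
variable {X₀ : Plane} {R c : ℝ} {u : Plane → ℝ} {g : Plane → Plane} {I : Plane → ℝ}

theorem center' (h : MonotonicityData X₀ R c u g I) : X₀ 1 = 0 ∨ R ≤ X₀ 1 :=
  h.center.imp_right fun h' => by linarith [h.R_pos]

theorem coord_nonneg (h : MonotonicityData X₀ R c u g I) : 0 ≤ X₀ 1 := by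
  rcases h.center with h' | h' <;> linarith [h.R_pos]

/-- On the half-disc the weight `y` is of order `|X - X₀| ^ (μ - 1)`: of order `|X - X₀|` around a
point of the axis, and of order `1` off the axis. -/
theorem coord_le (h : MonotonicityData X₀ R c u g I) {X : Plane} (hX : X ∈ openHalfBall X₀ R) :
    X 1 ≤ (1 + X₀ 1 + R) * dist X X₀ ^ (growthExp X₀ - 1) := by
  have h1 := (le_abs_self _).trans (abs_coord_sub_le X X₀)
  have h2 : dist X X₀ < R := hX.1
  have h3 := h.coord_nonneg
  have h4 := h.R_pos
  have h5 : 0 ≤ dist X X₀ := dist_nonneg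
  by_cases h0 : X₀ 1 = 0
  · have : growthExp X₀ - 1 = 1 := by simp [growthExp, h0]
    rw [this, pow_one, h0]
    rw [h0] at h1
    nlinarith
  · have : growthExp X₀ - 1 = 0 := by simp [growthExp, h0]
    rw [this, pow_zero]
    linarith

theorem coord_le_add {X : Plane} (hX : X ∈ openHalfBall X₀ R) :
    X 1 ≤ X₀ 1 + R := by
  have h1 := (le_abs_self _).trans (abs_coord_sub_le X X₀)
  have h2 : dist X X₀ < R := hX.1
  linarith

theorem abs_radialPart_le (X : Plane) : |radialPart X₀ g X| ≤ ‖g X‖ := by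
  rw [radialPart, abs_div, abs_of_nonneg dist_nonneg]
  apply div_le_of_le_mul₀ dist_nonneg (norm_nonneg _)
  rw [dist_eq_norm]
  exact abs_real_inner_le_norm _ _

theorem kineticDensity_nonneg {X : Plane} (hX : X ∈ openHalfBall X₀ R) :
    0 ≤ kineticDensity g X := by
  have : 0 < X 1 := hX.2
  unfold kineticDensity; positivity

theorem kineticDensity_le (h : MonotonicityData X₀ R c u g I) {X : Plane}
    (hX : X ∈ openHalfBall X₀ R) : kineticDensity g X ≤ c ^ 2 * X 1 := by
  have hy : 0 < X 1 := hX.2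
  have h1 := h.g_le X hX
  rw [kineticDensity, one_div, inv_mul_le_iff₀ hy]
  calc ‖g X‖ ^ 2 ≤ (c * X 1) ^ 2 := by gcongr
    _ = _ := by ring

theorem abs_weightedFlux_le (h : MonotonicityData X₀ R c u g I) {X : Plane}
    (hX : X ∈ openHalfBall X₀ R) :
    |(1 / X 1) * u X * radialPart X₀ g X| ≤ 3 * c ^ 2 * X 1 * dist X X₀ := by
  have hy : 0 < X 1 := hX.2
  rw [abs_mul, abs_mul, abs_of_pos (by positivity : 0 < 1 / X 1), abs_of_nonneg (h.u_nonneg X hX)]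
  have h1 := (abs_radialPart_le (X₀ := X₀) (g := g) X).trans (h.g_le X hX)
  have h2 := h.u_le X hX
  have hc := h.c_nonneg
  calc (1 / X 1) * u X * |radialPart X₀ g X|
      ≤ (1 / X 1) * (3 * c * X 1 * dist X X₀) * (c * X 1) := by gcongr
    _ = _ := by field_simp

theorem weightedSquare_le (h : MonotonicityData X₀ R c u g I) {X : Plane}
    (hX : X ∈ openHalfBall X₀ R) :
    |(1 / X 1) * u X ^ 2| ≤ 9 * c ^ 2 * X 1 * dist X X₀ ^ 2 := by
  have hy : 0 < X 1 := hX.2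
  have h0 := h.u_nonneg X hX
  rw [abs_of_nonneg (by positivity)]
  have h2 := h.u_le X hX
  calc (1 / X 1) * u X ^ 2 ≤ (1 / X 1) * (3 * c * X 1 * dist X X₀) ^ 2 := by gcongr
    _ = _ := by field_simp; ring

theorem measurable_radialPart (h : MonotonicityData X₀ R c u g I) :
    Measurable (radialPart X₀ g) :=
  (h.meas_g.inner (measurable_id.sub_const X₀)).div (measurable_id.dist measurable_const)

theorem isArcBounded_of_le_coord {f : Plane → ℝ}
    (hf : Measurable f) {b : ℝ} (hb : 0 ≤ b)
    (hle : ∀ X ∈ openHalfBall X₀ R, |f X| ≤ b * X 1) : IsArcBounded X₀ R f :=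
  ⟨hf, b * (X₀ 1 + R), fun X hX =>
    (hle X hX).trans (mul_le_mul_of_nonneg_left (coord_le_add hX) hb)⟩

theorem isArcBounded_kinetic (h : MonotonicityData X₀ R c u g I) :
    IsArcBounded X₀ R (kineticDensity g) :=
  isArcBounded_of_le_coord ((measurable_const.div (measurable_coord 1)).mul
    (h.meas_g.norm.pow_const 2)) (sq_nonneg c) fun X hX => by
      rw [abs_of_nonneg (kineticDensity_nonneg hX)]; exact h.kineticDensity_le hX

theorem isArcBounded_phase (h : MonotonicityData X₀ R c u g I) :
    IsArcBounded X₀ R (fun X => X 1 * I X) :=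
  isArcBounded_of_le_coord ((measurable_coord 1).mul h.meas_I) zero_le_one fun X hX => by
    have hy : 0 < X 1 := hX.2
    rcases h.I_mem X hX with h' | h' <;> rw [h'] <;> simp [abs_of_pos hy, hy.le]

theorem isArcBounded_energy (h : MonotonicityData X₀ R c u g I) :
    IsArcBounded X₀ R (energyDensity g I) :=
  h.isArcBounded_kinetic.add h.isArcBounded_phase

theorem isArcBounded_flux (h : MonotonicityData X₀ R c u g I) :
    IsArcBounded X₀ R (fun X => (1 / X 1) * u X * radialPart X₀ g X) := by
  have hc := h.c_nonneg
  have hR := h.R_pos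
  refine isArcBounded_of_le_coord (b := 3 * c ^ 2 * R) (((measurable_const.div
    (measurable_coord 1)).mul h.meas_u).mul h.measurable_radialPart) (by positivity) fun X hX => ?_
  have hy : 0 < X 1 := hX.2
  have hd : dist X X₀ < R := hX.1
  refine (h.abs_weightedFlux_le hX).trans ?_
  calc 3 * c ^ 2 * X 1 * dist X X₀ ≤ 3 * c ^ 2 * X 1 * R := by gcongr
    _ = _ := by ring

theorem isArcBounded_square (h : MonotonicityData X₀ R c u g I) :
    IsArcBounded X₀ R (fun X => (1 / X 1) * u X ^ 2) := by
  have hR := h.R_pos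
  refine isArcBounded_of_le_coord (b := 9 * c ^ 2 * R ^ 2) ((measurable_const.div
    (measurable_coord 1)).mul (h.meas_u.pow_const 2)) (by positivity) fun X hX => ?_
  have hy : 0 < X 1 := hX.2
  have hd : dist X X₀ < R := hX.1
  refine (h.weightedSquare_le hX).trans ?_
  calc 9 * c ^ 2 * X 1 * dist X X₀ ^ 2 ≤ 9 * c ^ 2 * X 1 * R ^ 2 := by gcongr
    _ = _ := by ring

theorem isArcBounded_normal (h : MonotonicityData X₀ R c u g I) :
    IsArcBounded X₀ R (fun X => (1 / X 1) * radialPart X₀ g X ^ 2) := by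
  refine isArcBounded_of_le_coord (b := c ^ 2) ((measurable_const.div
    (measurable_coord 1)).mul (h.measurable_radialPart.pow_const 2)) (by positivity) fun X hX => ?_
  have hy : 0 < X 1 := hX.2
  rw [abs_of_nonneg (by positivity)]
  refine le_trans ?_ (h.kineticDensity_le hX)
  rw [kineticDensity, ← sq_abs (radialPart X₀ g X)]
  have := abs_radialPart_le (X₀ := X₀) (g := g) X
  gcongr

/-- The inner variation has the zeroth order term of a functional that is homogeneous about `X₀`,
exactly on the axis, and up to an error that is linear in the distance off the axis. -/
theorem defect_le (h : MonotonicityData X₀ R c u g I) {X : Plane} (hX : X ∈ openHalfBall X₀ R) :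
    |((growthExp X₀ : ℝ) + 1) * energyDensity g I X - 2 * growthExp X₀ * kineticDensity g X
      - variationDensity X₀ g I X|
      ≤ if X₀ 1 = 0 then 0 else (c ^ 2 + 1) * dist X X₀ := by
  have hy : 0 < X 1 := hX.2
  split_ifs with h0
  · have hk : (growthExp X₀ : ℝ) = 2 := by simp [growthExp, h0]
    rw [hk, variationDensity, energyDensity, kineticDensity, h0]
    apply le_of_eq
    rw [abs_eq_zero]
    field_simp
    ring
  · have hk : (growthExp X₀ : ℝ) = 1 := by simp [growthExp, h0]
    rw [hk, variationDensity, energyDensity, kineticDensity]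
    have e : (1 + 1 : ℝ) * ((1 / X 1) * ‖g X‖ ^ 2 + X 1 * I X) - 2 * 1 * ((1 / X 1) * ‖g X‖ ^ 2)
        - (2 * ((1 / X 1) * ‖g X‖ ^ 2 + X 1 * I X) - 2 * ((1 / X 1) * ‖g X‖ ^ 2)
          - (X 1 - X₀ 1) * ((1 / X 1 ^ 2) * ‖g X‖ ^ 2 - I X))
        = (X 1 - X₀ 1) * ((1 / X 1 ^ 2) * ‖g X‖ ^ 2 - I X) := by ring
    rw [e, abs_mul, mul_comm]
    apply mul_le_mul _ (abs_coord_sub_le X X₀) (abs_nonneg _) (by positivity)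
    refine (abs_sub _ _).trans (add_le_add ?_ ?_)
    · rw [abs_of_nonneg (by positivity), one_div, inv_mul_le_iff₀ (by positivity)]
      calc ‖g X‖ ^ 2 ≤ (c * X 1) ^ 2 := by have := h.g_le X hX; gcongr
        _ = _ := by ring
    · rcases h.I_mem X hX with h' | h' <;> rw [h'] <;> simp

theorem isArcBounded_variation (h : MonotonicityData X₀ R c u g I) :
    IsArcBounded X₀ R (variationDensity X₀ g I) := by
  have hm : Measurable (variationDensity X₀ g I) := by
    have h1 := h.isArcBounded_energy.1
    have h2 := h.isArcBounded_kinetic.1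
    have h3 := measurable_coord 1
    have h4 := h.meas_I
    have h5 := h.meas_g.norm
    unfold variationDensity
    fun_prop
  have hd : IsArcBounded X₀ R fun X => ((growthExp X₀ : ℝ) + 1) * energyDensity g I X
      - 2 * growthExp X₀ * kineticDensity g X - variationDensity X₀ g I X := by
    refine ⟨((h.isArcBounded_energy.const_mul _).sub (h.isArcBounded_kinetic.const_mul _)).1.sub hm,
      (c ^ 2 + 1) * R, fun X hX => (h.defect_le hX).trans ?_⟩
    have hR := h.R_pos
    split_ifs
    · positivity
    · have : dist X X₀ < R := hX.1
      gcongr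
  have := ((h.isArcBounded_energy.const_mul ((growthExp X₀ : ℝ) + 1)).sub
    (h.isArcBounded_kinetic.const_mul (2 * growthExp X₀))).sub hd
  simpa using this

/-! ### Derivatives of solid and boundary integrals -/
/-- The Dirichlet energy in a half-disc is a boundary integral. -/
theorem flux_eq (h : MonotonicityData X₀ R c u g I) :
    ∀ᵐ r, r ∈ Set.Ioo 0 R → arcIntegral (fun X => (1 / X 1) * u X * radialPart X₀ g X) X₀ r
      = ∫ s in (0 : ℝ)..r, arcIntegral (kineticDensity g) X₀ s := by
  have h1 := h.isArcBounded_kinetic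
  have h2 := h.isArcBounded_flux
  refine ae_eq_primitive_of_test h.R_pos (h1.integrableOn_arc h.center')
    (h2.integrableOn_arc h.center') fun φ hφ hφ' => ?_
  have h3 : IsArcBounded X₀ R fun X => φ (dist X X₀) * kineticDensity g X :=
    (IsArcBounded.comp_dist hφ.continuous).mul h1
  have h4 : IsArcBounded X₀ R fun X =>
      deriv φ (dist X X₀) * ((1 / X 1) * u X * radialPart X₀ g X) :=
    (IsArcBounded.comp_dist (hφ.continuous_deriv (by simp))).mul h2
  refine Eq.trans ?_ (h.energy φ ⟨hφ, hφ'⟩)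
  rw [(h3.add h4).integral_halfBall_eq h.center']
  apply setIntegral_congr_fun measurableSet_Ioo
  intro r hr
  simp only
  rw [h3.arc_add h4 h.center' hr, arc_comp_dist_mul φ _ X₀ hr.1.le,
    arc_comp_dist_mul (deriv φ) _ X₀ hr.1.le]

/-- The inner variation in radial directions. -/
theorem variation_eq (h : MonotonicityData X₀ R c u g I) :
    ∀ᵐ r, r ∈ Set.Ioo 0 R → r * (arcIntegral (energyDensity g I) X₀ r
        - 2 * arcIntegral (fun X => (1 / X 1) * radialPart X₀ g X ^ 2) X₀ r)
      = ∫ s in (0 : ℝ)..r, arcIntegral (variationDensity X₀ g I) X₀ s := by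
  have h1 := h.isArcBounded_variation
  have h2 := h.isArcBounded_energy.sub (h.isArcBounded_normal.const_mul 2)
  have h2' : IsArcBounded X₀ R fun X => dist X X₀ * (energyDensity g I X
        - 2 * ((1 / X 1) * radialPart X₀ g X ^ 2)) :=
    (IsArcBounded.comp_dist continuous_id).mul h2
  have key := ae_eq_primitive_of_test h.R_pos (h1.integrableOn_arc h.center')
    (h2'.integrableOn_arc h.center') fun φ hφ hφ' => ?_
  · filter_upwards [key] with r hr hrR
    rw [← hr hrR, arc_comp_dist_mul (fun t => t) _ X₀ hrR.1.le,
      h.isArcBounded_energy.arc_sub (h.isArcBounded_normal.const_mul 2) h.center' hrR,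
      arc_const_mul]
  have h3 : IsArcBounded X₀ R fun X => φ (dist X X₀) * variationDensity X₀ g I X :=
    (IsArcBounded.comp_dist hφ.continuous).mul h1
  have h4 : IsArcBounded X₀ R fun X => deriv φ (dist X X₀) * (dist X X₀ * (energyDensity g I X
        - 2 * ((1 / X 1) * radialPart X₀ g X ^ 2))) :=
    (IsArcBounded.comp_dist (hφ.continuous_deriv (by simp))).mul h2'
  refine Eq.trans ?_ (h.variation φ ⟨hφ, hφ'⟩)
  rw [(h3.add h4).integral_halfBall_eq h.center']
  apply setIntegral_congr_fun measurableSet_Ioo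
  intro r hr
  simp only
  rw [h3.arc_add h4 h.center' hr, arc_comp_dist_mul φ _ X₀ hr.1.le,
    arc_comp_dist_mul (deriv φ) _ X₀ hr.1.le]

/-- The contribution of the weight `1 / y` to the radial derivative of `u² / y`, up to the part that
a homogeneous weight would give. It vanishes when `X₀` lies on the axis, about which `1 / y` is
homogeneous. -/
noncomputable def boundaryDefect (X₀ : Plane) (u : Plane → ℝ) (X : Plane) : ℝ :=
  (2 - growthExp X₀) * ((dist X X₀)⁻¹ * ((1 / X 1) * u X ^ 2))
    - X₀ 1 * ((1 / X 1 ^ 2) * u X ^ 2) * (dist X X₀)⁻¹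

theorem abs_boundaryDefect_le (h : MonotonicityData X₀ R c u g I) {X : Plane}
    (hX : X ∈ openHalfBall X₀ R) :
    |boundaryDefect X₀ u X| ≤ if X₀ 1 = 0 then 0 else 9 * c ^ 2 * dist X X₀ ^ 2 := by
  have hy : 0 < X 1 := hX.2
  split_ifs with h0
  · have hk : (growthExp X₀ : ℝ) = 2 := by simp [growthExp, h0]
    rw [boundaryDefect, hk, h0]; simp
  · have hk : (growthExp X₀ : ℝ) = 1 := by simp [growthExp, h0]
    have e : boundaryDefect X₀ u X = (X 1 - X₀ 1) * ((1 / X 1 ^ 2) * u X ^ 2) * (dist X X₀)⁻¹ := by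
      rw [boundaryDefect, hk]; field_simp; ring
    have h1 : (1 / X 1 ^ 2) * u X ^ 2 ≤ 9 * c ^ 2 * dist X X₀ ^ 2 := by
      rw [one_div, inv_mul_le_iff₀ (by positivity)]
      calc u X ^ 2 ≤ (3 * c * X 1 * dist X X₀) ^ 2 := by
            have := h.u_nonneg X hX
            have := h.u_le X hX
            gcongr
        _ = _ := by ring
    rw [e, abs_mul, abs_mul, abs_of_nonneg (by positivity : 0 ≤ (1 / X 1 ^ 2) * u X ^ 2),
      abs_inv, abs_of_nonneg (dist_nonneg (x := X) (y := X₀))]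
    rcases eq_or_lt_of_le (dist_nonneg (x := X) (y := X₀)) with hd | hd
    · rw [← hd]; simp
    · rw [mul_inv_le_iff₀ hd]
      calc |X 1 - X₀ 1| * ((1 / X 1 ^ 2) * u X ^ 2)
          ≤ dist X X₀ * (9 * c ^ 2 * dist X X₀ ^ 2) := by
            have := abs_coord_sub_le X X₀
            gcongr
        _ = _ := by ring

theorem isArcBounded_boundaryDefect (h : MonotonicityData X₀ R c u g I) :
    IsArcBounded X₀ R (boundaryDefect X₀ u) := by
  refine ⟨?_, 9 * c ^ 2 * R ^ 2, fun X hX => (h.abs_boundaryDefect_le hX).trans ?_⟩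
  · have h1 := h.meas_u
    have h3 := measurable_coord 1
    have h4 : Measurable fun X : Plane => dist X X₀ := measurable_id.dist measurable_const
    unfold boundaryDefect
    fun_prop
  · split_ifs
    · positivity
    · have : dist X X₀ < R := hX.1
      gcongr

theorem inner_direction (X₀ : Plane) {r : ℝ} (hr : 0 < r) (θ : ℝ) :
    inner ℝ (g (polarPt X₀ r θ)) (!₂[Real.cos θ, Real.sin θ] : Plane)
      = radialPart X₀ g (polarPt X₀ r θ) := by
  rw [radialPart, dist_polarPt_center X₀ hr.le, polarPt_sub]
  have : (!₂[r * Real.cos θ, r * Real.sin θ] : Plane) = r • !₂[Real.cos θ, Real.sin θ] := by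
    ext i; fin_cases i <;> simp
  rw [this, inner_smul_right, mul_div_cancel_left₀ _ hr.ne']

theorem hasDerivAt_boundary_integrand (h : MonotonicityData X₀ R c u g I) {r θ : ℝ}
    (hr : r ∈ Set.Ioo 0 R) (hθ : θ ∈ polarAngles X₀) :
    HasDerivAt (fun r => r * ((1 / polarPt X₀ r θ 1) * u (polarPt X₀ r θ) ^ 2))
      (r * (2 * ((1 / polarPt X₀ r θ 1) * u (polarPt X₀ r θ) * radialPart X₀ g (polarPt X₀ r θ))
        + ((2 - growthExp X₀) * ((dist (polarPt X₀ r θ) X₀)⁻¹ *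
          ((1 / polarPt X₀ r θ 1) * u (polarPt X₀ r θ) ^ 2))
            - boundaryDefect X₀ u (polarPt X₀ r θ)))) r := by
  have hX := polarPt_mem_openHalfBall h.center' hr hθ
  have hy : 0 < polarPt X₀ r θ 1 := hX.2
  have h1 := (h.hasFDerivAt_sq _ hX).comp_hasDerivAt r (hasDerivAt_polarPt X₀ r θ)
  have h2 : HasDerivAt (fun r => polarPt X₀ r θ 1) (Real.sin θ) r := by
    simp only [polarPt_one]
    simpa using ((hasDerivAt_id r).mul_const (Real.sin θ)).const_add (X₀ 1)
  have h3 := ((hasDerivAt_id r).mul ((h2.fun_inv hy.ne').mul h1))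
  have hr0 := hr.1
  convert! h3 using 1
  · funext s; simp [one_div]
  · rw [boundaryDefect, dist_polarPt_center X₀ hr0.le]
    simp only [smul_apply, innerSL_apply_apply, inner_direction X₀ hr0,
      smul_eq_mul, id, Function.comp_def, Pi.mul_apply]
    have e := polarPt_one X₀ r θ
    set Y := polarPt X₀ r θ 1
    have e' : X₀ 1 = Y - r * Real.sin θ := by linarith
    rw [e']
    field_simp
    ring

/-- The derivative of the boundary integral. -/
theorem hasDerivAt_boundary (h : MonotonicityData X₀ R c u g I) {r : ℝ} (hr : r ∈ Set.Ioo 0 R) :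
    HasDerivAt (arcIntegral (fun X => (1 / X 1) * u X ^ 2) X₀)
      (2 * arcIntegral (fun X => (1 / X 1) * u X * radialPart X₀ g X) X₀ r
        + (2 - growthExp X₀) * (r⁻¹ * arcIntegral (fun X => (1 / X 1) * u X ^ 2) X₀ r)
        - arcIntegral (boundaryDefect X₀ u) X₀ r) r := by
  have hb1 := h.isArcBounded_flux.const_mul 2
  have hb2 := h.isArcBounded_boundaryDefect
  have hb3 : IsArcBounded X₀ R fun X => (2 - (growthExp X₀ : ℝ)) *
      ((dist X X₀)⁻¹ * ((1 / X 1) * u X ^ 2)) := by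
    refine IsArcBounded.const_mul _ ⟨?_, 9 * c ^ 2 * (X₀ 1 + R) * R, fun X hX => ?_⟩
    · have h4 : Measurable fun X : Plane => dist X X₀ := measurable_id.dist measurable_const
      exact h4.inv.mul h.isArcBounded_square.1
    · have hd : dist X X₀ < R := hX.1
      have hy : 0 < X 1 := hX.2
      have h5 := coord_le_add hX
      rw [abs_mul, abs_inv, abs_of_nonneg (dist_nonneg (x := X) (y := X₀))]
      have h6 := h.weightedSquare_le hX
      rcases eq_or_lt_of_le (dist_nonneg (x := X) (y := X₀)) with hd0 | hd0
      · rw [← hd0] at hd ⊢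
        have : 0 < X₀ 1 + R := hy.trans_le h5
        simp; positivity
      · have h7 : 0 ≤ X₀ 1 + R := hy.le.trans h5
        rw [inv_mul_le_iff₀ hd0]
        calc _ ≤ _ := h6
          _ = dist X X₀ * (9 * c ^ 2 * X 1 * dist X X₀) := by ring
          _ ≤ _ := by gcongr
  set D : Plane → ℝ := fun X => 2 * ((1 / X 1) * u X * radialPart X₀ g X)
    + ((2 - (growthExp X₀ : ℝ)) * ((dist X X₀)⁻¹ * ((1 / X 1) * u X ^ 2))
      - boundaryDefect X₀ u X) with hD
  have hDb : IsArcBounded X₀ R D := hb1.add (hb3.sub hb2)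
  have hval : arcIntegral D X₀ r
      = 2 * arcIntegral (fun X => (1 / X 1) * u X * radialPart X₀ g X) X₀ r
        + (2 - growthExp X₀) * (r⁻¹ * arcIntegral (fun X => (1 / X 1) * u X ^ 2) X₀ r)
        - arcIntegral (boundaryDefect X₀ u) X₀ r := by
    rw [hD, hb1.arc_add (hb3.sub hb2) h.center' hr, hb3.arc_sub hb2 h.center' hr, arc_const_mul,
      arc_const_mul, arc_comp_dist_mul (fun t => t⁻¹) _ X₀ hr.1.le]
    ring
  rw [← hval]
  obtain ⟨b, hb⟩ := hDb.2
  obtain ⟨ε, hε, hball⟩ := Metric.isOpen_iff.1 (isOpen_Ioo (a := 0) (b := R)) r hr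
  have hcont : ∀ s, Measurable (polarPt X₀ s) := fun s =>
    (continuous_polarPt.comp (continuous_const.prodMk
      (continuous_const.prodMk continuous_id))).measurable
  have := hasDerivAt_integral_of_dominated_loc_of_deriv_le
    (μ := volume.restrict (polarAngles X₀)) (s := Set.Ioo 0 R) (x₀ := r)
    (F := fun s θ => s * ((1 / polarPt X₀ s θ 1) * u (polarPt X₀ s θ) ^ 2))
    (F' := fun s θ => s * D (polarPt X₀ s θ)) (bound := fun _ => R * b)
    (isOpen_Ioo.mem_nhds hr) ?_ (h.isArcBounded_square.integrableOn_angle h.center' hr) ?_ ?_ ?_ ?_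
  · exact this.2
  · refine Filter.Eventually.of_forall fun s => ?_
    exact (measurable_const.mul (h.isArcBounded_square.1.comp (hcont s))).aestronglyMeasurable
  · exact (measurable_const.mul (hDb.1.comp (hcont r))).aestronglyMeasurable
  · rw [ae_restrict_iff' (measurableSet_polarAngles X₀)]
    refine ae_of_all _ fun θ hθ s hs => ?_
    have h1 := hb _ (polarPt_mem_openHalfBall h.center' hs hθ)
    rw [norm_mul, Real.norm_eq_abs, Real.norm_eq_abs, abs_of_pos hs.1]
    exact mul_le_mul hs.2.le h1 (abs_nonneg _) h.R_pos.le
  · exact integrable_const _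
  · rw [ae_restrict_iff' (measurableSet_polarAngles X₀)]
    exact ae_of_all _ fun θ hθ s hs => h.hasDerivAt_boundary_integrand hs hθ

/-- The Cauchy-Schwarz inequality on a half-circle. -/
theorem flux_sub_sq_le (h : MonotonicityData X₀ R c u g I) {r k : ℝ} (hr : r ∈ Set.Ioo 0 R) :
    (arcIntegral (fun X => (1 / X 1) * u X * radialPart X₀ g X) X₀ r
        - k * (r⁻¹ * arcIntegral (fun X => (1 / X 1) * u X ^ 2) X₀ r)) ^ 2
      ≤ arcIntegral (fun X => (1 / X 1) * u X ^ 2) X₀ r *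
        (arcIntegral (fun X => (1 / X 1) * radialPart X₀ g X ^ 2) X₀ r
          - 2 * k * (r⁻¹ * arcIntegral (fun X => (1 / X 1) * u X * radialPart X₀ g X) X₀ r)
          + k ^ 2 * (r⁻¹ ^ 2 * arcIntegral (fun X => (1 / X 1) * u X ^ 2) X₀ r)) := by
  have hu := h.isArcBounded_square
  have hp := h.isArcBounded_flux
  have hn := h.isArcBounded_normal
  set H := arcIntegral (fun X => (1 / X 1) * u X ^ 2) X₀ r with hH
  set P := arcIntegral (fun X => (1 / X 1) * u X * radialPart X₀ g X) X₀ r with hP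
  set N := arcIntegral (fun X => (1 / X 1) * radialPart X₀ g X ^ 2) X₀ r with hN
  -- the integral of `(t u - radial part of g)² / y` is a nonnegative quadratic polynomial in `t`
  have hquad : ∀ t : ℝ, 0 ≤ t ^ 2 * H + (-2 * t) * P + N := by
    intro t
    rw [hH, hP, hN, ← arc_const_mul, ← arc_const_mul,
      ← (hu.const_mul _).arc_add (hp.const_mul _) h.center' hr,
      ← ((hu.const_mul _).add (hp.const_mul _)).arc_add hn h.center' hr]
    apply arc_nonneg h.center' hr
    intro X hX
    have hy : 0 < X 1 := hX.2
    have : t ^ 2 * ((1 / X 1) * u X ^ 2) + -2 * t * ((1 / X 1) * u X * radialPart X₀ g X)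
        + (1 / X 1) * radialPart X₀ g X ^ 2 = (1 / X 1) * (t * u X - radialPart X₀ g X) ^ 2 := by
      ring
    rw [this]; positivity
  have hd := discrim_le_zero (a := H) (b := -2 * P) (c := N) fun t => by
    have := hquad t; linarith
  rw [discrim] at hd
  have e : H * (N - 2 * k * (r⁻¹ * P) + k ^ 2 * (r⁻¹ ^ 2 * H)) - (P - k * (r⁻¹ * H)) ^ 2
      = H * N - P ^ 2 := by ring
  linarith

end MonotonicityData

theorem hasDerivAt_inv_pow (m : ℕ) {r : ℝ} (hr : 0 < r) :
    HasDerivAt (fun r : ℝ => (r ^ m)⁻¹) (-m * (r ^ (m + 1))⁻¹) r := by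
  have h := (hasDerivAt_pow m r).fun_inv (by positivity)
  convert! h using 1
  rcases m with _ | m
  · simp
  · simp only [Nat.add_sub_cancel]
    field_simp
    ring

/-- The derivative of a combination of a solid and a boundary integral with the scaling of the
monotonicity formula. -/
theorem hasDerivAt_normalized (k : ℕ) {A H : ℝ → ℝ} {A' H' r : ℝ} (hr : 0 < r)
    (hA : HasDerivAt A A' r) (hH : HasDerivAt H H' r) :
    HasDerivAt (fun r => (r ^ (k + 1))⁻¹ * A r - (k : ℝ) * (r ^ (k + 2))⁻¹ * H r)
      ((r ^ (k + 2))⁻¹ * (r * A' - (k + 1) * A r - k * H' + k * (k + 2) * (r⁻¹ * H r))) r := by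
  have h := ((hasDerivAt_inv_pow (k + 1) hr).mul hA).sub
    (((hasDerivAt_inv_pow (k + 2) hr).const_mul (k : ℝ)).mul hH)
  convert! h using 1
  push_cast
  field_simp
  ring

theorem absolutelyContinuousOnInterval_inv_pow (m : ℕ) {a b : ℝ} (ha : 0 < a) (hab : a ≤ b) :
    AbsolutelyContinuousOnInterval (fun r : ℝ => (r ^ m)⁻¹) a b := by
  apply ContDiffOn.absolutelyContinuousOnInterval
  rw [Set.uIcc_of_le hab]
  refine ContDiffOn.inv (contDiff_id.pow m).contDiffOn fun x hx => ?_
  have : 0 < x := ha.trans_le hx.1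
  exact pow_ne_zero m this.ne'

theorem absolutelyContinuousOnInterval_normalized (k : ℕ) {A H : ℝ → ℝ} {a b : ℝ} (ha : 0 < a)
    (hab : a ≤ b) (hA : AbsolutelyContinuousOnInterval A a b)
    (hH : AbsolutelyContinuousOnInterval H a b) :
    AbsolutelyContinuousOnInterval
      (fun r => (r ^ (k + 1))⁻¹ * A r - (k : ℝ) * (r ^ (k + 2))⁻¹ * H r) a b :=
  ((absolutelyContinuousOnInterval_inv_pow (k + 1) ha hab).fun_mul hA).fun_sub
    (((absolutelyContinuousOnInterval_inv_pow (k + 2) ha hab).const_mul (k : ℝ)).fun_mul hH)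

namespace MonotonicityData
variable {X₀ : Plane} {R c : ℝ} {u : Plane → ℝ} {g : Plane → Plane} {I : Plane → ℝ}

theorem one_le_scale (h : MonotonicityData X₀ R c u g I) : 1 ≤ 1 + X₀ 1 + R := by
  linarith [h.coord_nonneg, h.R_pos]

theorem abs_arc_kinetic_le (h : MonotonicityData X₀ R c u g I) {r : ℝ} (hr : r ∈ Set.Ioo 0 R) :
    |arcIntegral (kineticDensity g) X₀ r|
      ≤ 2 * Real.pi * c ^ 2 * (1 + X₀ 1 + R) * r ^ growthExp X₀ := by
  have hY := h.one_le_scale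
  have hr0 := hr.1
  refine (abs_arc_le h.center' hr (b := c ^ 2 * ((1 + X₀ 1 + R) * r ^ (growthExp X₀ - 1)))
    (by positivity) fun X hX hd => ?_).trans (le_of_eq ?_)
  · rw [abs_of_nonneg (kineticDensity_nonneg hX)]
    refine (h.kineticDensity_le hX).trans ?_
    have := h.coord_le hX
    rw [hd] at this
    gcongr
  · rw [← pow_growthExp]; ring

theorem abs_integral_kinetic_le (h : MonotonicityData X₀ R c u g I) {r : ℝ}
    (hr : r ∈ Set.Ioo 0 R) :
    |∫ s in (0 : ℝ)..r, arcIntegral (kineticDensity g) X₀ s|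
      ≤ 2 * Real.pi * c ^ 2 * (1 + X₀ 1 + R) * r ^ (growthExp X₀ + 1) := by
  have hY := h.one_le_scale
  have hr0 := hr.1
  refine (abs_integral_arc_le h.center' hr
    (b := c ^ 2 * ((1 + X₀ 1 + R) * r ^ (growthExp X₀ - 1)))
    (by positivity) fun X hX hd => ?_).trans (le_of_eq ?_)
  · rw [abs_of_nonneg (kineticDensity_nonneg hX)]
    refine (h.kineticDensity_le hX).trans ?_
    have := (h.coord_le hX).trans (mul_le_mul_of_nonneg_left
      (pow_le_pow_left₀ dist_nonneg hd _) (by linarith))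
    gcongr
  · rw [pow_succ r, ← pow_growthExp]; ring

theorem abs_boundary_le (h : MonotonicityData X₀ R c u g I) {r : ℝ} (hr : r ∈ Set.Ioo 0 R) :
    |arcIntegral (fun X => (1 / X 1) * u X ^ 2) X₀ r|
      ≤ 18 * Real.pi * c ^ 2 * (1 + X₀ 1 + R) * r ^ (growthExp X₀ + 2) := by
  have hY := h.one_le_scale
  have hr0 := hr.1
  refine (abs_arc_le h.center' hr
    (b := 9 * c ^ 2 * ((1 + X₀ 1 + R) * r ^ (growthExp X₀ - 1)) * r ^ 2)
    (by positivity) fun X hX hd => ?_).trans (le_of_eq ?_)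
  · refine (h.weightedSquare_le hX).trans ?_
    have := h.coord_le hX
    rw [hd] at this ⊢
    gcongr
  · rw [pow_add, ← pow_growthExp]; ring

theorem abs_flux_le (h : MonotonicityData X₀ R c u g I) {r : ℝ} (hr : r ∈ Set.Ioo 0 R) :
    |arcIntegral (fun X => (1 / X 1) * u X * radialPart X₀ g X) X₀ r|
      ≤ 6 * Real.pi * c ^ 2 * (1 + X₀ 1 + R) * r ^ (growthExp X₀ + 1) := by
  have hY := h.one_le_scale
  have hr0 := hr.1
  refine (abs_arc_le h.center' hr
    (b := 3 * c ^ 2 * ((1 + X₀ 1 + R) * r ^ (growthExp X₀ - 1)) * r)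
    (by positivity) fun X hX hd => ?_).trans (le_of_eq ?_)
  · refine (h.abs_weightedFlux_le hX).trans ?_
    have := h.coord_le hX
    rw [hd] at this ⊢
    gcongr
  · rw [pow_add, ← pow_growthExp]; ring

/-- The boundary defect gains a factor `r` over its natural scaling `r ^ (μ + 1)`. -/
theorem abs_arc_boundaryDefect_le (h : MonotonicityData X₀ R c u g I) {r : ℝ}
    (hr : r ∈ Set.Ioo 0 R) :
    growthExp X₀ * |arcIntegral (boundaryDefect X₀ u) X₀ r|
      ≤ 18 * Real.pi * c ^ 2 * r ^ (growthExp X₀ + 2) := by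
  have hr0 := hr.1
  rcases growthExp_cases X₀ with ⟨h0, hk⟩ | ⟨h0, hk⟩
  · have := abs_arc_le h.center' hr le_rfl fun X hX _ => by
      have := h.abs_boundaryDefect_le hX
      rwa [if_pos h0] at this
    have h1 : |arcIntegral (boundaryDefect X₀ u) X₀ r| = 0 :=
      le_antisymm (by simpa using this) (abs_nonneg _)
    rw [h1, mul_zero]
    have := Real.pi_pos
    positivity
  · have := abs_arc_le h.center' hr (b := 9 * c ^ 2 * r ^ 2) (by positivity) fun X hX hd => by
      have := h.abs_boundaryDefect_le hX
      rwa [if_neg h0, hd] at this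
    rw [hk, Nat.cast_one, one_mul]
    refine this.trans (le_of_eq ?_)
    ring

/-- The integrated zeroth order defect gains a factor `r` over its natural scaling `r ^ (μ + 1)`. -/
theorem abs_integral_defect_le (h : MonotonicityData X₀ R c u g I) {r : ℝ}
    (hr : r ∈ Set.Ioo 0 R) :
    |((growthExp X₀ : ℝ) + 1) * (∫ s in (0 : ℝ)..r, arcIntegral (energyDensity g I) X₀ s)
      - 2 * growthExp X₀ * (∫ s in (0 : ℝ)..r, arcIntegral (kineticDensity g) X₀ s)
      - ∫ s in (0 : ℝ)..r, arcIntegral (variationDensity X₀ g I) X₀ s|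
      ≤ 2 * Real.pi * (c ^ 2 + 1) * r ^ (growthExp X₀ + 2) := by
  have hr0 := hr.1
  have hc := h.center'
  set f : Plane → ℝ := fun X => ((growthExp X₀ : ℝ) + 1) * energyDensity g I X
      - 2 * growthExp X₀ * kineticDensity g X - variationDensity X₀ g I X with hf
  have hb1 := h.isArcBounded_energy.const_mul ((growthExp X₀ : ℝ) + 1)
  have hb2 := h.isArcBounded_kinetic.const_mul (2 * growthExp X₀ : ℝ)
  have hb3 := h.isArcBounded_variation
  have hint : ∀ {f : Plane → ℝ}, IsArcBounded X₀ R f →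
      IntervalIntegrable (arcIntegral f X₀) volume 0 r := fun hf =>
    (hf.intervalIntegrable_arc hc h.R_pos).mono_set (by
      rw [Set.uIcc_of_le hr0.le, Set.uIcc_of_le h.R_pos.le]
      exact Set.Icc_subset_Icc_right hr.2.le)
  have e : ((growthExp X₀ : ℝ) + 1) * (∫ s in (0 : ℝ)..r, arcIntegral (energyDensity g I) X₀ s)
      - 2 * growthExp X₀ * (∫ s in (0 : ℝ)..r, arcIntegral (kineticDensity g) X₀ s)
      - ∫ s in (0 : ℝ)..r, arcIntegral (variationDensity X₀ g I) X₀ s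
      = ∫ s in (0 : ℝ)..r, arcIntegral f X₀ s := by
    rw [← intervalIntegral.integral_const_mul, ← intervalIntegral.integral_const_mul,
      ← intervalIntegral.integral_sub, ← intervalIntegral.integral_sub]
    · rw [intervalIntegral.integral_of_le hr0.le, intervalIntegral.integral_of_le hr0.le]
      apply setIntegral_congr_fun measurableSet_Ioc
      intro s hs
      have hs' : s ∈ Set.Ioo 0 R := ⟨hs.1, hs.2.trans_lt hr.2⟩
      simp only
      rw [hf, (hb1.sub hb2).arc_sub hb3 hc hs', hb1.arc_sub hb2 hc hs', arc_const_mul,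
        arc_const_mul]
    · exact ((hint h.isArcBounded_energy).const_mul _).sub
        ((hint h.isArcBounded_kinetic).const_mul _)
    · exact hint hb3
    · exact (hint h.isArcBounded_energy).const_mul _
    · exact (hint h.isArcBounded_kinetic).const_mul _
  rw [e]
  rcases growthExp_cases X₀ with ⟨h0, hk⟩ | ⟨h0, hk⟩
  · have := abs_integral_arc_le (f := f) h.center' hr le_rfl fun X hX _ => by
      have := h.defect_le hX
      rwa [if_pos h0] at this
    refine this.trans ?_
    have := Real.pi_pos
    simp only [mul_zero, zero_mul]
    positivity
  · have := abs_integral_arc_le (f := f) h.center' hr (b := (c ^ 2 + 1) * r) (by positivity)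
      fun X hX hd => by
        have := h.defect_le hX
        rw [if_neg h0] at this
        exact this.trans (by gcongr)
    rw [hk]
    refine this.trans (le_of_eq ?_)
    ring
/-! ### Convergence of the monotone quantity -/
theorem abs_deriv_boundary_le (h : MonotonicityData X₀ R c u g I) {r : ℝ} (hr : r ∈ Set.Ioo 0 R) :
    |2 * arcIntegral (fun X => (1 / X 1) * u X * radialPart X₀ g X) X₀ r
        + (2 - growthExp X₀) * (r⁻¹ * arcIntegral (fun X => (1 / X 1) * u X ^ 2) X₀ r)
        - arcIntegral (boundaryDefect X₀ u) X₀ r|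
      ≤ 48 * Real.pi * c ^ 2 * (1 + X₀ 1 + R) * r ^ (growthExp X₀ + 1) := by
  have hr0 := hr.1
  have hY := h.one_le_scale
  have h0 := h.coord_nonneg
  have hR := h.R_pos
  have hπ := Real.pi_pos
  have h1 := h.abs_flux_le hr
  have h2 := h.abs_boundary_le hr
  have h3 := h.abs_arc_boundaryDefect_le hr
  set P := arcIntegral (fun X => (1 / X 1) * u X * radialPart X₀ g X) X₀ r
  set H := arcIntegral (fun X => (1 / X 1) * u X ^ 2) X₀ r
  set B := arcIntegral (boundaryDefect X₀ u) X₀ r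
  set Y := 1 + X₀ 1 + R with hYdef
  have hk1 : (1 : ℝ) ≤ growthExp X₀ ∧ (growthExp X₀ : ℝ) ≤ 2 := by
    rcases growthExp_cases X₀ with ⟨-, hk⟩ | ⟨-, hk⟩ <;> rw [hk] <;> norm_num
  have h2' : |(2 - growthExp X₀) * (r⁻¹ * H)|
      ≤ 18 * Real.pi * c ^ 2 * Y * r ^ (growthExp X₀ + 1) := by
    rw [abs_mul, abs_mul, abs_of_pos (inv_pos.2 hr0), abs_of_nonneg (by linarith [hk1.2])]
    calc (2 - (growthExp X₀ : ℝ)) * (r⁻¹ * |H|)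
        ≤ 1 * (r⁻¹ * (18 * Real.pi * c ^ 2 * Y * r ^ (growthExp X₀ + 2))) := by
          apply mul_le_mul (by linarith [hk1.1]) _ (by positivity) zero_le_one
          gcongr
      _ = _ := by field_simp; ring
  have h3' : |B| ≤ 18 * Real.pi * c ^ 2 * Y * r ^ (growthExp X₀ + 1) := by
    calc |B| ≤ growthExp X₀ * |B| := le_mul_of_one_le_left (abs_nonneg _) hk1.1
      _ ≤ 18 * Real.pi * c ^ 2 * r ^ (growthExp X₀ + 2) := h3
      _ = 18 * Real.pi * c ^ 2 * r * r ^ (growthExp X₀ + 1) := by ring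
      _ ≤ _ := by
        have : r ≤ Y := by linarith [hr.2]
        gcongr
  have h4 : |2 * P + (2 - growthExp X₀) * (r⁻¹ * H) - B|
      ≤ 2 * |P| + |(2 - growthExp X₀) * (r⁻¹ * H)| + |B| := by
    refine (abs_sub _ _).trans (add_le_add ((abs_add_le _ _).trans ?_) le_rfl)
    rw [abs_mul, abs_two]
  linarith

theorem absolutelyContinuousOnInterval_boundary (h : MonotonicityData X₀ R c u g I) {a b : ℝ}
    (ha : 0 < a) (hab : a ≤ b) (hb : b < R) :
    AbsolutelyContinuousOnInterval (arcIntegral (fun X => (1 / X 1) * u X ^ 2) X₀) a b := by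
  have hY := h.one_le_scale
  have hπ := Real.pi_pos
  have := Convex.lipschitzOnWith_of_nnnorm_hasDerivWithin_le (convex_Icc a b)
    (C := (48 * Real.pi * c ^ 2 * (1 + X₀ 1 + R) * b ^ (growthExp X₀ + 1)).toNNReal)
    (fun x hx => (h.hasDerivAt_boundary ⟨ha.trans_le hx.1, hx.2.trans_lt hb⟩).hasDerivWithinAt)
    (fun x hx => by
      rw [← NNReal.coe_le_coe, coe_nnnorm, Real.norm_eq_abs, Real.coe_toNNReal']
      refine le_max_of_le_left
        ((h.abs_deriv_boundary_le ⟨ha.trans_le hx.1, hx.2.trans_lt hb⟩).trans ?_)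
      have h1 := hx.2
      have h2 := ha.trans_le hx.1
      gcongr)
  apply LipschitzOnWith.absolutelyContinuousOnInterval
  rw [Set.uIcc_of_le hab]
  exact this

theorem absolutelyContinuousOnInterval_solid (h : MonotonicityData X₀ R c u g I)
    {f : Plane → ℝ} (hf : IsArcBounded X₀ R f) {a b : ℝ} (ha : 0 < a) (hab : a ≤ b) (hb : b < R) :
    AbsolutelyContinuousOnInterval (fun r => ∫ s in (0 : ℝ)..r, arcIntegral f X₀ s) a b := by
  refine ((hf.intervalIntegrable_arc h.center'
      h.R_pos).absolutelyContinuousOnInterval_intervalIntegral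
    (c := 0) (by simp)).mono ?_
  rw [Set.uIcc_of_le hab, Set.uIcc_of_le h.R_pos.le]
  exact Set.Icc_subset_Icc ha.le hb.le

theorem ae_hasDerivAt_solid (h : MonotonicityData X₀ R c u g I) {f : Plane → ℝ}
    (hf : IsArcBounded X₀ R f) : ∀ᵐ r, r ∈ Set.Ioo 0 R →
      HasDerivAt (fun r => ∫ s in (0 : ℝ)..r, arcIntegral f X₀ s) (arcIntegral f X₀ r) r := by
  filter_upwards [(hf.intervalIntegrable_arc h.center' h.R_pos).ae_hasDerivAt_integral]
    with r hr hrR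
  refine hr ?_ 0 (by simp)
  rw [Set.uIcc_of_le h.R_pos.le]
  exact Set.Ioo_subset_Icc_self hrR

/-- The almost everywhere derivative of the monotone quantity bounds the square of the homogeneity
defect: up to the error term it is a perfect square, and the homogeneity defect is the integral of
its root against `u`. -/
theorem ae_deriv_monoQuantity (h : MonotonicityData X₀ R c u g I) :
    ∃ q : ℝ, 0 < q ∧ ∀ᵐ r, r ∈ Set.Ioo 0 R → ∃ m, HasDerivAt (monoQuantity X₀ u g I) m r ∧
      q * (homogeneityDefect X₀ u g r ^ 2 / r) - errorConst c ≤ m := by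
  have hY := h.one_le_scale
  have hπ := Real.pi_pos
  set C₂ := 18 * Real.pi * c ^ 2 * (1 + X₀ 1 + R) + 1 with hC₂
  have hC₂0 : 0 < C₂ := by positivity
  refine ⟨2 / C₂, by positivity, ?_⟩
  filter_upwards [h.flux_eq, h.variation_eq, h.ae_hasDerivAt_solid h.isArcBounded_energy]
    with r h1 h2 h3 hr
  have hr0 := hr.1
  have hnorm := hasDerivAt_normalized (growthExp X₀) hr0 (h3 hr) (h.hasDerivAt_boundary hr)
  refine ⟨_, hnorm, ?_⟩
  have e1 := h1 hr
  have e2 := h2 hr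
  have b1 := h.abs_boundary_le hr
  have b2 := h.abs_arc_boundaryDefect_le hr
  have b3 := h.abs_integral_defect_le hr
  have cs := h.flux_sub_sq_le (k := growthExp X₀) hr
  rw [homogeneityDefect, ← e1]
  rw [← e1] at b3
  set k := growthExp X₀
  set P := arcIntegral (fun X => (1 / X 1) * u X * radialPart X₀ g X) X₀ r
  set H := arcIntegral (fun X => (1 / X 1) * u X ^ 2) X₀ r
  set N := arcIntegral (fun X => (1 / X 1) * radialPart X₀ g X ^ 2) X₀ r
  set B := arcIntegral (boundaryDefect X₀ u) X₀ r
  set D := ∫ s in (0 : ℝ)..r, arcIntegral (energyDensity g I) X₀ s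
  set d := arcIntegral (energyDensity g I) X₀ r
  set V := ∫ s in (0 : ℝ)..r, arcIntegral (variationDensity X₀ g I) X₀ s
  set S := N - 2 * k * (r⁻¹ * P) + k ^ 2 * (r⁻¹ ^ 2 * H) with hS
  have hrk : 0 < r ^ k := by positivity
  -- the derivative is a perfect square up to the error terms
  have hm : (r ^ (k + 2))⁻¹ * (r * d - (k + 1) * D
      - k * (2 * P + (2 - k) * (r⁻¹ * H) - B) + k * (k + 2) * (r⁻¹ * H))
      = (r ^ (k + 2))⁻¹ * (2 * r * S + (k * B - ((k + 1) * D - 2 * k * P - V))) := by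
    congr 1
    have : r * d = V + 2 * r * N := by linarith
    rw [this, hS]
    field_simp
    ring
  rw [hm]
  have herr : -errorConst c ≤ (r ^ (k + 2))⁻¹ * (k * B - ((k + 1) * D - 2 * k * P - V)) := by
    have h5 : -(errorConst c * r ^ (k + 2)) ≤ k * B - ((k + 1) * D - 2 * k * P - V) := by
      have h6 := (abs_le.1 b3).2
      have h7 := neg_abs_le B
      have hk0 : (0 : ℝ) ≤ k := Nat.cast_nonneg k
      have h8 : -(k * |B|) ≤ k * B := by nlinarith
      rw [errorConst]
      linarith
    have := mul_le_mul_of_nonneg_left h5 (by positivity : 0 ≤ (r ^ (k + 2))⁻¹)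
    refine le_trans (le_of_eq ?_) this
    field_simp
  have hF : (r ^ (k + 1))⁻¹ * P - (k : ℝ) * (r ^ (k + 2))⁻¹ * H
      = (r ^ (k + 1))⁻¹ * (P - k * (r⁻¹ * H)) := by
    field_simp; ring
  rw [hF, mul_add]
  have hsq : 2 / C₂ * (((r ^ (k + 1))⁻¹ * (P - k * (r⁻¹ * H))) ^ 2 / r)
      ≤ (r ^ (k + 2))⁻¹ * (2 * r * S) := by
    have hH0 : 0 ≤ H := arc_nonneg h.center' hr fun X hX => by
      have hy : 0 < X 1 := hX.2
      positivity
    have hS0 : 0 ≤ S := by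
      by_contra hneg
      push Not at hneg
      -- `S` is itself the integral of a square
      have hp := h.isArcBounded_flux
      have hu := h.isArcBounded_square
      have hn := h.isArcBounded_normal
      have : S
          = arcIntegral (fun X => (1 / X 1) * (radialPart X₀ g X - k * r⁻¹ * u X) ^ 2) X₀ r := by
        have e : (fun X : Plane => (1 / X 1) * (radialPart X₀ g X - k * r⁻¹ * u X) ^ 2)
            = fun X => (1 / X 1) * radialPart X₀ g X ^ 2
              - 2 * k * r⁻¹ * ((1 / X 1) * u X * radialPart X₀ g X)
              + k ^ 2 * r⁻¹ ^ 2 * ((1 / X 1) * u X ^ 2) := by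
          funext X; ring
        rw [e, (hn.sub (hp.const_mul _)).arc_add (hu.const_mul _) h.center' hr,
          hn.arc_sub (hp.const_mul _) h.center' hr, arc_const_mul, arc_const_mul, hS]
        ring
      rw [this] at hneg
      exact absurd hneg (not_lt.2 (arc_nonneg h.center' hr fun X hX => by
        have hy : 0 < X 1 := hX.2
        positivity))
    have hHle : H ≤ C₂ * r ^ (k + 2) := by
      have := (le_abs_self H).trans b1
      rw [hC₂]
      nlinarith [pow_pos hr0 (k + 2)]
    have h9 : (P - k * (r⁻¹ * H)) ^ 2 ≤ C₂ * r ^ (k + 2) * S :=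
      cs.trans (mul_le_mul_of_nonneg_right hHle hS0)
    calc 2 / C₂ * (((r ^ (k + 1))⁻¹ * (P - k * (r⁻¹ * H))) ^ 2 / r)
        = 2 / C₂ * ((r ^ (k + 1))⁻¹ ^ 2 * (P - k * (r⁻¹ * H)) ^ 2 / r) := by rw [mul_pow]
      _ ≤ 2 / C₂ * ((r ^ (k + 1))⁻¹ ^ 2 * (C₂ * r ^ (k + 2) * S) / r) := by gcongr
      _ = _ := by
        field_simp; ring
  linarith

/-- The homogeneity defect is Lipschitz in `log r`: both of its terms are scale invariant up to
bounded factors. -/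
theorem abs_homogeneityDefect_sub_le (h : MonotonicityData X₀ R c u g I) :
    ∃ L : ℝ, 0 ≤ L ∧ ∀ a b, 0 < a → a ≤ b → b < R →
      |homogeneityDefect X₀ u g b - homogeneityDefect X₀ u g a| ≤ L * (b - a) / a := by
  have hY := h.one_le_scale
  have hπ := Real.pi_pos
  set A := Real.pi * c ^ 2 * (1 + X₀ 1 + R) with hA
  have hA0 : 0 ≤ A := by positivity
  have hk1 : (1 : ℝ) ≤ growthExp X₀ ∧ (growthExp X₀ : ℝ) ≤ 2 := by
    rcases growthExp_cases X₀ with ⟨-, hk⟩ | ⟨-, hk⟩ <;> rw [hk] <;> norm_num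
  refine ⟨300 * A, by positivity, fun a b ha hab hb => ?_⟩
  have hae : ∀ᵐ r, r ∈ Set.Ioo a b → ∃ m, HasDerivAt (homogeneityDefect X₀ u g) m r ∧
      |m| ≤ 300 * A / a := by
    filter_upwards [h.ae_hasDerivAt_solid h.isArcBounded_kinetic] with r h3 hrab
    have hr : r ∈ Set.Ioo 0 R := ⟨ha.trans hrab.1, hrab.2.trans hb⟩
    have hr0 := hr.1
    refine ⟨_, hasDerivAt_normalized (growthExp X₀) hr0 (h3 hr) (h.hasDerivAt_boundary hr), ?_⟩
    have b1 := h.abs_boundary_le hr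
    have b2 := h.abs_deriv_boundary_le hr
    have b3 := h.abs_arc_kinetic_le hr
    have b4 := h.abs_integral_kinetic_le hr
    set k := growthExp X₀
    set H := arcIntegral (fun X => (1 / X 1) * u X ^ 2) X₀ r
    set H' := 2 * arcIntegral (fun X => (1 / X 1) * u X * radialPart X₀ g X) X₀ r
        + (2 - (k : ℝ)) * (r⁻¹ * H) - arcIntegral (boundaryDefect X₀ u) X₀ r
    set E := ∫ s in (0 : ℝ)..r, arcIntegral (kineticDensity g) X₀ s
    set e := arcIntegral (kineticDensity g) X₀ r
    have hp : 0 < r ^ (k + 1) := by positivity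
    have c1 : |r * e| ≤ 2 * A * r ^ (k + 1) := by
      rw [abs_mul, abs_of_pos hr0]
      calc r * |e| ≤ r * (2 * Real.pi * c ^ 2 * (1 + X₀ 1 + R) * r ^ k) := by gcongr
        _ = _ := by rw [hA]; ring
    have c2 : |((k : ℝ) + 1) * E| ≤ 6 * A * r ^ (k + 1) := by
      rw [abs_mul, abs_of_pos (by linarith [hk1.1] : (0 : ℝ) < k + 1)]
      calc ((k : ℝ) + 1) * |E| ≤ 3 * (2 * Real.pi * c ^ 2 * (1 + X₀ 1 + R) * r ^ (k + 1)) := by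
            apply mul_le_mul (by linarith [hk1.2]) b4 (abs_nonneg _) (by norm_num)
        _ = _ := by rw [hA]; ring
    have c3 : |(k : ℝ) * H'| ≤ 96 * A * r ^ (k + 1) := by
      rw [abs_mul, abs_of_pos (by linarith [hk1.1] : (0 : ℝ) < k)]
      calc (k : ℝ) * |H'| ≤ 2 * (48 * Real.pi * c ^ 2 * (1 + X₀ 1 + R) * r ^ (k + 1)) := by
            apply mul_le_mul (by linarith [hk1.2]) b2 (abs_nonneg _) (by norm_num)
        _ = _ := by rw [hA]; ring
    have c4 : |(k : ℝ) * (k + 2) * (r⁻¹ * H)| ≤ 144 * A * r ^ (k + 1) := by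
      rw [abs_mul ((k : ℝ) * (k + 2)), abs_of_nonneg (by nlinarith [hk1.1] : (0 : ℝ) ≤ k * (k + 2)),
        abs_mul, abs_of_pos (inv_pos.2 hr0)]
      calc (k : ℝ) * (k + 2) * (r⁻¹ * |H|)
          ≤ 8 * (r⁻¹ * (18 * Real.pi * c ^ 2 * (1 + X₀ 1 + R) * r ^ (k + 2))) := by
            apply mul_le_mul (by nlinarith [hk1.1, hk1.2]) _ (by positivity) (by norm_num)
            gcongr
        _ = _ := by rw [hA]; field_simp; ring
    have c5 : |r * e - ((k : ℝ) + 1) * E - k * H' + k * (k + 2) * (r⁻¹ * H)|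
        ≤ 300 * A * r ^ (k + 1) := by
      have t1 := abs_add_le (r * e - ((k : ℝ) + 1) * E - k * H') (k * (k + 2) * (r⁻¹ * H))
      have t2 := abs_sub (r * e - ((k : ℝ) + 1) * E) (k * H')
      have t3 := abs_sub (r * e) (((k : ℝ) + 1) * E)
      have : 0 ≤ A * r ^ (k + 1) := by positivity
      linarith
    rw [abs_mul, abs_of_pos (by positivity : 0 < (r ^ (k + 2))⁻¹)]
    calc (r ^ (k + 2))⁻¹ * _ ≤ (r ^ (k + 2))⁻¹ * (300 * A * r ^ (k + 1)) := by gcongr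
      _ = 300 * A / r := by field_simp; ring
      _ ≤ 300 * A / a := by
        have := hrab.1
        gcongr
  have hac : AbsolutelyContinuousOnInterval (homogeneityDefect X₀ u g) a b :=
    absolutelyContinuousOnInterval_normalized _ ha hab
      (h.absolutelyContinuousOnInterval_solid h.isArcBounded_kinetic ha hab hb)
      (h.absolutelyContinuousOnInterval_boundary ha hab hb)
  have u1 := integral_le_sub_of_ae_hasDerivAt hab hac (q := fun _ => -(300 * A / a)) (by simp)
    (by
      filter_upwards [hae] with x hx hxm
      obtain ⟨m, hm, hle⟩ := hx hxm
      exact ⟨m, hm, (abs_le.1 hle).1⟩)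
  have u2 := integral_le_sub_of_ae_hasDerivAt hab hac.fun_neg (q := fun _ => -(300 * A / a))
    (by simp) (by
      filter_upwards [hae] with x hx hxm
      obtain ⟨m, hm, hle⟩ := hx hxm
      exact ⟨-m, hm.neg, by linarith [(abs_le.1 hle).2]⟩)
  rw [intervalIntegral.integral_const, smul_eq_mul] at u1 u2
  have e : 300 * A * (b - a) / a = (b - a) * (300 * A / a) := by ring
  rw [abs_le, e]
  constructor <;> linarith

/-- The monotonicity formula: the monotone quantity has a limit at `0`, which it almost bounds from
above, and the homogeneity defect tends to `0`. -/
theorem exists_tendsto (h : MonotonicityData X₀ R c u g I) :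
    ∃ l : ℝ, Tendsto (monoQuantity X₀ u g I) (𝓝[>] 0) (𝓝 l) ∧
      Tendsto (homogeneityDefect X₀ u g) (𝓝[>] 0) (𝓝 0) ∧
      ∀ r ∈ Set.Ioo 0 R, l ≤ monoQuantity X₀ u g I r + errorConst c * r := by
  obtain ⟨q, hq, hder⟩ := h.ae_deriv_monoQuantity
  obtain ⟨L, hL, hLip⟩ := h.abs_homogeneityDefect_sub_le
  have hY := h.one_le_scale
  have hπ := Real.pi_pos
  have hac : ∀ {a b : ℝ}, 0 < a → a ≤ b → b < R →
      AbsolutelyContinuousOnInterval (homogeneityDefect X₀ u g) a b := fun ha hab hb =>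
    absolutelyContinuousOnInterval_normalized _ ha hab
      (h.absolutelyContinuousOnInterval_solid h.isArcBounded_kinetic ha hab hb)
      (h.absolutelyContinuousOnInterval_boundary ha hab hb)
  have hFc : ContinuousOn (homogeneityDefect X₀ u g) (Set.Ioo 0 R) := by
    intro r hr
    have h1 : r / 2 < r := by linarith [hr.1]
    have h2 : r < (r + R) / 2 := by linarith [hr.2]
    have := (hac (show 0 < r / 2 by linarith [hr.1]) (h1.trans h2).le
      (show (r + R) / 2 < R by linarith [hr.2])).continuousOn
    rw [Set.uIcc_of_le (h1.trans h2).le] at this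
    exact (this.continuousAt (Icc_mem_nhds h1 h2)).continuousWithinAt
  refine exists_tendsto_of_almost_monotone (c := q) (L := L)
    (B := -(2 * (18 * Real.pi * c ^ 2 * (1 + X₀ 1 + R)))) h.R_pos hq hL (errorConst_nonneg c) hFc
    (fun a b ha hab hb => ?_) hLip fun r hr => ?_
  · have hM : AbsolutelyContinuousOnInterval (monoQuantity X₀ u g I) a b :=
      absolutelyContinuousOnInterval_normalized _ ha hab
        (h.absolutelyContinuousOnInterval_solid h.isArcBounded_energy ha hab hb)
        (h.absolutelyContinuousOnInterval_boundary ha hab hb)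
    have hi : IntervalIntegrable (fun x => homogeneityDefect X₀ u g x ^ 2 / x) volume a b := by
      apply ContinuousOn.intervalIntegrable
      rw [Set.uIcc_of_le hab]
      exact ((hFc.mono fun x hx => ⟨ha.trans_le hx.1, hx.2.trans_lt hb⟩).pow 2).div continuousOn_id
        fun x hx => (ha.trans_le hx.1).ne'
    have := integral_le_sub_of_ae_hasDerivAt hab hM
      (q := fun x => q * (homogeneityDefect X₀ u g x ^ 2 / x) - errorConst c)
      ((hi.const_mul q).sub (by simp))
      (by
        filter_upwards [hder] with x hx hxm
        exact hx ⟨ha.trans hxm.1, hxm.2.trans hb⟩)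
    rw [intervalIntegral.integral_sub (hi.const_mul q) (by simp),
      intervalIntegral.integral_const_mul, intervalIntegral.integral_const, smul_eq_mul] at this
    linarith
  · have hr0 := hr.1
    have b1 := (le_abs_self _).trans (h.abs_boundary_le hr)
    have hk : (growthExp X₀ : ℝ) ≤ 2 := by
      rcases growthExp_cases X₀ with ⟨-, hk⟩ | ⟨-, hk⟩ <;> rw [hk] <;> norm_num
    have hD : 0 ≤ ∫ s in (0 : ℝ)..r, arcIntegral (energyDensity g I) X₀ s := by
      rw [intervalIntegral.integral_of_le hr0.le]
      apply setIntegral_nonneg measurableSet_Ioc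
      intro s hs
      apply arc_nonneg h.center' ⟨hs.1, hs.2.trans_lt hr.2⟩
      intro X hX
      have hy : 0 < X 1 := hX.2
      rw [energyDensity]
      rcases h.I_mem X hX with h' | h' <;> rw [h'] <;> positivity
    have hH0 : 0 ≤ arcIntegral (fun X => (1 / X 1) * u X ^ 2) X₀ r :=
      arc_nonneg h.center' hr fun X hX => by
        have hy : 0 < X 1 := hX.2
        positivity
    rw [monoQuantity]
    have h1 : 0 ≤ (r ^ (growthExp X₀ + 1))⁻¹
        * (∫ s in (0 : ℝ)..r, arcIntegral (energyDensity g I) X₀ s) := by positivity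
    have h2 : (growthExp X₀ : ℝ) * (r ^ (growthExp X₀ + 2))⁻¹
      * arcIntegral (fun X => (1 / X 1) * u X ^ 2) X₀ r
        ≤ 2 * (18 * Real.pi * c ^ 2 * (1 + X₀ 1 + R)) := by
      calc _ ≤ 2 * (r ^ (growthExp X₀ + 2))⁻¹
            * (18 * Real.pi * c ^ 2 * (1 + X₀ 1 + R) * r ^ (growthExp X₀ + 2)) := by gcongr
        _ = _ := by field_simp
    linarith

end MonotonicityData

/-! ### Radial test functions and the data of a variational solution -/

namespace IsCutoffProfile
variable {R : ℝ} {φ : ℝ → ℝ} (X₀ : Plane)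

theorem eventuallyEq_const (h : IsCutoffProfile R φ) :
    (fun X => φ (dist X X₀)) =ᶠ[𝓝 X₀] fun _ => φ (dist X₀ X₀) := by
  obtain ⟨-, s, t, hs, -, hc, -⟩ := h
  filter_upwards [Metric.ball_mem_nhds X₀ hs] with X hX
  rw [dist_self, hc _ (le_of_lt hX), hc 0 hs.le]

theorem contDiff_comp_dist (h : IsCutoffProfile R φ) :
    ContDiff ℝ 1 fun X => φ (dist X X₀) := by
  rw [contDiff_iff_contDiffAt]
  intro X
  by_cases hX : X = X₀
  · subst hX
    exact contDiffAt_const.congr_of_eventuallyEq (h.eventuallyEq_const X)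
  · have h1 : ContDiffAt ℝ 1 (fun Z : Plane => dist Z X₀) X := by
      simp only [dist_eq_norm]
      exact (contDiffAt_id.sub contDiffAt_const).norm ℝ (sub_ne_zero.2 hX)
    exact ((h.1.of_le (by simp)).contDiffAt).comp X h1

theorem fderiv_comp_dist (h : IsCutoffProfile R φ) (X v : Plane) :
    fderiv ℝ (fun Z => φ (dist Z X₀)) X v
      = deriv φ (dist X X₀) * (inner ℝ v (X - X₀) / dist X X₀) := by
  by_cases hX : X = X₀
  · subst hX
    rw [(h.eventuallyEq_const X).fderiv_eq]
    simp
  · have hd : HasFDerivAt (fun Z : Plane => dist Z X₀)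
        ((dist X X₀)⁻¹ • innerSL ℝ (X - X₀)) X := by
      have h1 : HasFDerivAt (fun Z : Plane => ‖Z - X₀‖ ^ 2) (2 • innerSL ℝ (X - X₀)) X :=
        (hasStrictFDerivAt_norm_sq (X - X₀)).hasFDerivAt.comp (f := fun Z : Plane => Z - X₀) X
          ((hasFDerivAt_id X).sub_const X₀)
      have h2 := h1.sqrt (pow_ne_zero 2 (norm_ne_zero_iff.2 (sub_ne_zero.2 hX)))
      have h3 : (fun Z : Plane => dist Z X₀) = fun Z => √(‖Z - X₀‖ ^ 2) := by
        funext Z; rw [Real.sqrt_sq (norm_nonneg _), dist_eq_norm]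
      rw [h3]
      convert! h2 using 1
      rw [Real.sqrt_sq (norm_nonneg _), dist_eq_norm]
      ext v
      simp
      ring
    have h1 : HasDerivAt φ (deriv φ (dist X X₀)) (dist X X₀) :=
      ((h.1.differentiable (by simp)) _).hasDerivAt
    have h2 := (h1.comp_hasFDerivAt X hd).fderiv
    simp only [Function.comp_def] at h2
    rw [h2]
    simp only [smul_apply, innerSL_apply_apply, smul_eq_mul]
    rw [real_inner_comm]
    ring

theorem tsupport_comp_dist_subset (h : IsCutoffProfile R φ) :
    ∃ t < R, tsupport (fun X => φ (dist X X₀)) ⊆ Metric.closedBall X₀ t := by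
  obtain ⟨-, s, t, -, ht, -, h0⟩ := h
  refine ⟨t, ht, closure_minimal (fun X hX => ?_) Metric.isClosed_closedBall⟩
  rw [Metric.mem_closedBall]
  by_contra hlt
  exact hX (h0 _ (not_le.1 hlt).le)

theorem hasCompactSupport_comp_dist (h : IsCutoffProfile R φ) :
    HasCompactSupport fun X => φ (dist X X₀) := by
  obtain ⟨t, -, ht⟩ := h.tsupport_comp_dist_subset X₀
  exact (isCompact_closedBall X₀ t).of_isClosed_subset (isClosed_tsupport _) ht

theorem tsupport_comp_dist_inter_subset (h : IsCutoffProfile R φ) :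
    tsupport (fun X => φ (dist X X₀)) ∩ upperHalf ⊆ halfBall X₀ R := by
  obtain ⟨t, h1, ht⟩ := h.tsupport_comp_dist_subset X₀
  exact Set.inter_subset_inter_left _ (ht.trans (Metric.closedBall_subset_ball h1))

theorem eq_zero_of_le (h : IsCutoffProfile R φ) {r : ℝ} (hr : R ≤ r) : φ r = 0 := by
  obtain ⟨-, s, t, -, ht, -, h0⟩ := h
  exact h0 r (ht.le.trans hr)

theorem deriv_eq_zero_of_le (h : IsCutoffProfile R φ) {r : ℝ} (hr : R ≤ r) : deriv φ r = 0 := by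
  obtain ⟨-, s, t, -, ht, -, h0⟩ := h
  have : φ =ᶠ[𝓝 r] fun _ => 0 := by
    filter_upwards [lt_mem_nhds (ht.trans_le hr)] with x hx using h0 x hx.le
  rw [this.deriv_eq, deriv_const]

/-- Radial dilations, cut off near `X₀`, as admissible vector fields. -/
theorem isAdmissibleField (h : IsCutoffProfile R φ) {Ω : Set Plane} (hΩ : halfBall X₀ R ⊆ Ω)
    (hX : X₀ 1 = 0 ∨ R ≤ X₀ 1) :
    IsAdmissibleField Ω fun X => φ (dist X X₀) • (X - X₀) where
  contDiff := (h.contDiff_comp_dist X₀).smul (contDiff_id.sub contDiff_const)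
  hasCompactSupport := (h.hasCompactSupport_comp_dist X₀).smul_right
  tsupport_subset := fun _ hZ => hΩ (h.tsupport_comp_dist_inter_subset X₀
    ⟨closure_mono (Function.support_smul_subset_left _ _) hZ.1, hZ.2⟩)
  tangential := by
    intro X hX1
    rcases hX with h0 | h0
    · simp [hX1, h0]
    · have : R ≤ dist X X₀ := by
        have := abs_coord_sub_le X X₀
        rw [hX1, zero_sub, abs_neg] at this
        exact (h0.trans (le_abs_self _)).trans this
      simp [h.eq_zero_of_le this]

theorem fderiv_smul_sub (h : IsCutoffProfile R φ) (X v : Plane) :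
    fderiv ℝ (fun Z => φ (dist Z X₀) • (Z - X₀)) X v
      = φ (dist X X₀) • v
        + (deriv φ (dist X X₀) * (inner ℝ v (X - X₀) / dist X X₀)) • (X - X₀) := by
  have h1 := ((h.contDiff_comp_dist X₀).differentiable (by simp) X).hasFDerivAt.smul
    ((hasFDerivAt_id X).sub_const X₀)
  have h2 : fderiv ℝ (fun Z => φ (dist Z X₀) • (Z - X₀)) X = _ := h1.fderiv
  rw [h2, ← h.fderiv_comp_dist X₀ X v]
  simp

theorem divergence_smul_sub (h : IsCutoffProfile R φ) (X : Plane) :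
    divergence (fun Z => φ (dist Z X₀) • (Z - X₀)) X
      = 2 * φ (dist X X₀) + deriv φ (dist X X₀) * dist X X₀ := by
  have h1 : dist X X₀ ^ 2 = (X 0 - X₀ 0) ^ 2 + (X 1 - X₀ 1) ^ 2 := by
    rw [dist_eq_norm, norm_sq_eq_coords]; simp
  rw [divergence, Fin.sum_univ_two, h.fderiv_smul_sub, h.fderiv_smul_sub, inner_eq_coords,
    inner_eq_coords]
  simp [coordVec]
  by_cases h0 : dist X X₀ = 0
  · rw [h0]; simp; ring
  · field_simp
    linear_combination (-(deriv φ (dist X X₀))) * h1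

end IsCutoffProfile

section
variable {Ω : Set Plane} {C : ℝ} {ψ I : Plane → ℝ} {X₀ : Plane} {R : ℝ}

theorem setIntegral_halfBall_eq (hsol : IsVariationalSolution Ω C ψ I)
    (hΩ : halfBall X₀ R ⊆ Ω) {f : Plane → ℝ} (hf : ∀ X, R ≤ dist X X₀ → f X = 0) :
    ∫ X in halfBall X₀ R, f X = ∫ X in Ω, f X := by
  symm
  apply setIntegral_eq_of_subset_of_forall_sdiff_eq_zero
    (measurableSet_of_isOpenInUpperHalf hsol.isOpen) hΩ
  rintro X ⟨hX1, hX2⟩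
  apply hf
  by_contra hlt
  obtain ⟨U, hU, rfl⟩ := hsol.isOpen
  exact hX2 ⟨not_le.1 hlt, hX1.2⟩

theorem measurable_indicator_stream (hsol : IsVariationalSolution Ω C ψ I) :
    Measurable (Ω.indicator ψ) := by
  classical
  have h := hsol.continuousOn.measurable_piecewise (g := fun _ => (0 : ℝ)) continuousOn_const
    (measurableSet_of_isOpenInUpperHalf hsol.isOpen)
  rwa [← Set.piecewise_eq_indicator]

theorem measurable_indicator_phase (hsol : IsVariationalSolution Ω C ψ I) :
    Measurable (Ω.indicator I) := by
  apply measurable_of_restrict_of_restrict_compl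
    (measurableSet_of_isOpenInUpperHalf hsol.isOpen)
  · convert hsol.measurable using 1
    funext X
    simp
  · convert measurable_const (a := (0 : ℝ)) using 1
    funext X
    simpa using fun h => absurd h X.2

theorem openHalfBall_subset_interior (hsol : IsVariationalSolution Ω C ψ I)
    (hΩ : halfBall X₀ R ⊆ Ω) : openHalfBall X₀ R ⊆ interior Ω := fun X hX =>
  (mem_interior_iff hsol.isOpen).2 ⟨hΩ ⟨hX.1, le_of_lt (show 0 < X 1 from hX.2)⟩, hX.2⟩

/-- Growth away from a zero of `ψ`, from the bound `|∇ψ| ≤ |C| y` along a segment: from the foot of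
the perpendicular when `X₀` lies on the axis, and from `X₀` otherwise. -/
theorem stream_le (hsol : IsVariationalSolution Ω C ψ I) (hΩ : halfBall X₀ R ⊆ Ω)
    (hX : X₀ 1 = 0 ∨ 2 * R ≤ X₀ 1) (h0 : ψ X₀ = 0) {X : Plane} (hXR : X ∈ openHalfBall X₀ R) :
    ψ X ≤ 3 * |C| * X 1 * dist X X₀ := by
  have hy : 0 < X 1 := hXR.2
  have hd : dist X X₀ < R := hXR.1
  have hcd := abs_coord_sub_le X X₀
  have hC := abs_nonneg C
  rcases hX with hX | hX
  · -- compare with the foot of the perpendicular on the axis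
    rw [hX, sub_zero, abs_of_pos hy] at hcd
    set F : Plane := X - X 1 • coordVec 1 with hF
    have hseg : ∀ t ∈ Set.Icc (0 : ℝ) 1, F + t • (X - F) ∈ Ω ∧ (F + t • (X - F)) 1 ≤ X 1 := by
      intro t ht
      have e0 : (F + t • (X - F)) 0 = X 0 := by simp [hF, coordVec]
      have e1 : (F + t • (X - F)) 1 = t * X 1 := by simp [hF, coordVec]
      refine ⟨hΩ ⟨?_, ?_⟩, ?_⟩
      · rw [Metric.mem_ball]
        refine lt_of_le_of_lt ?_ hd
        rw [dist_eq_norm, dist_eq_norm]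
        refine (sq_le_sq₀ (norm_nonneg _) (norm_nonneg _)).1 ?_
        rw [norm_sq_eq_coords, norm_sq_eq_coords]
        simp only [PiLp.sub_apply, e0, e1, hX, sub_zero]
        have : (t * X 1) ^ 2 ≤ X 1 ^ 2 := by
          have := mul_nonneg ht.1 hy.le
          have := mul_le_of_le_one_left hy.le ht.2
          gcongr
        linarith
      · change 0 ≤ (F + t • (X - F)) 1
        rw [e1]
        exact mul_nonneg ht.1 hy.le
      · rw [e1]
        exact mul_le_of_le_one_left hy.le ht.2
    have hFΩ : F ∈ Ω := by simpa using (hseg 0 (by simp)).1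
    have hψF : ψ F = 0 := hsol.eq_zero_axis F hFΩ (by simp [hF, coordVec])
    have h1 := (le_abs_self _).trans (abs_sub_le_of_segment hsol hy.le hseg)
    have e2 : ‖X - F‖ = X 1 := by
      rw [hF, sub_sub_cancel, norm_smul, norm_coordVec, mul_one, Real.norm_of_nonneg hy.le]
    rw [hψF, e2, sub_zero] at h1
    calc ψ X ≤ |C| * X 1 * X 1 := h1
      _ ≤ |C| * X 1 * dist X X₀ := by gcongr
      _ ≤ 3 * |C| * X 1 * dist X X₀ := by
        have : 0 ≤ |C| * X 1 * dist X X₀ := by positivity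
        linarith
  · have hd0 : 0 ≤ dist X X₀ := dist_nonneg
    have h1 := (le_abs_self _).trans (abs_sub_le_of_segment hsol (X := X₀) (Y := X)
      (m := X₀ 1 + dist X X₀) (by linarith) fun t ht => by
        have e1 : dist (X₀ + t • (X - X₀)) X₀ ≤ dist X X₀ := by
          rw [dist_eq_norm, dist_eq_norm, add_sub_cancel_left, norm_smul, Real.norm_eq_abs,
            abs_of_nonneg ht.1]
          exact mul_le_of_le_one_left (norm_nonneg _) ht.2
        have e2 := abs_le.1 (abs_coord_sub_le (X₀ + t • (X - X₀)) X₀)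
        refine ⟨hΩ ⟨e1.trans_lt hd, ?_⟩, by linarith⟩
        change 0 ≤ (X₀ + t • (X - X₀)) 1
        linarith)
    rw [h0, sub_zero, ← dist_eq_norm] at h1
    refine h1.trans ?_
    have h2 := abs_le.1 hcd
    -- `|X - X₀| ≤ y₀ / 2` gives `y₀ / 2 ≤ y`
    have h3 : X₀ 1 + dist X X₀ ≤ 3 * X 1 := by linarith
    calc |C| * (X₀ 1 + dist X X₀) * dist X X₀ ≤ |C| * (3 * X 1) * dist X X₀ := by gcongr
      _ = _ := by ring

/-- At a point where `ψ` vanishes, a variational solution satisfies the hypotheses of the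
monotonicity formula on every sufficiently small half-disc. -/
theorem monotonicityData (hsol : IsVariationalSolution Ω C ψ I) (hR : 0 < R)
    (hΩ : halfBall X₀ R ⊆ Ω) (hX : X₀ 1 = 0 ∨ 2 * R ≤ X₀ 1) (h0 : ψ X₀ = 0) :
    MonotonicityData X₀ R |C| (Ω.indicator ψ) (streamGrad Ω ψ) (Ω.indicator I) where
  R_pos := hR
  c_nonneg := abs_nonneg C
  center := hX
  meas_u := measurable_indicator_stream hsol
  meas_g := measurable_streamGrad hsol
  meas_I := measurable_indicator_phase hsol
  u_nonneg := fun X _ => Set.indicator_nonneg (fun Z hZ => hsol.nonneg Z hZ) X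
  g_le := fun X hXR => norm_streamGrad_le hsol (le_of_lt hXR.2)
  u_le := fun X hXR => by
    rw [Set.indicator_of_mem (interior_subset (openHalfBall_subset_interior hsol hΩ hXR))]
    exact stream_le hsol hΩ hX h0 hXR
  I_mem := fun X hXR => by
    have := interior_subset (openHalfBall_subset_interior hsol hΩ hXR)
    rw [Set.indicator_of_mem this]
    exact hsol.values X this
  hasFDerivAt_sq := fun X hXR => by
    have hXi := openHalfBall_subset_interior hsol hΩ hXR
    rw [Set.indicator_of_mem (interior_subset hXi)]
    apply (hasFDerivAt_sq hsol hXi).congr_of_eventuallyEq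
    filter_upwards [isOpen_interior.mem_nhds hXi] with Z hZ
    rw [Set.indicator_of_mem (interior_subset hZ)]
  energy := fun φ hφ => by
    have h := energy_identity hsol (hφ.contDiff_comp_dist X₀) (hφ.hasCompactSupport_comp_dist X₀)
      ((hφ.tsupport_comp_dist_inter_subset X₀).trans hΩ)
    rw [← h]
    rw [← setIntegral_halfBall_eq hsol hΩ (X₀ := X₀) (R := R)]
    · apply setIntegral_congr_fun (measurableSet_halfBall X₀ R)
      intro X hXR
      simp only
      rw [hφ.fderiv_comp_dist, Set.indicator_of_mem (hΩ hXR), kineticDensity, radialPart]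
      ring
    · intro X hXR
      simp only
      rw [hφ.fderiv_comp_dist, hφ.eq_zero_of_le hXR, hφ.deriv_eq_zero_of_le hXR]
      ring
  variation := fun φ hφ => by
    have hX' : X₀ 1 = 0 ∨ R ≤ X₀ 1 := hX.imp_right fun h => by linarith
    have h := hsol.innerVariation_eq_zero _ (hφ.isAdmissibleField X₀ hΩ hX')
    rw [innerVariation] at h
    rw [← h, ← setIntegral_halfBall_eq hsol hΩ (X₀ := X₀) (R := R)]
    · apply setIntegral_congr_ae (measurableSet_halfBall X₀ R)
      filter_upwards [weakGrad_eq_streamGrad_ae hsol, ae_pos_of_mem hsol.isOpen] with X h1 h2 hXR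
      rw [h1 (h2 (hΩ hXR)), hφ.divergence_smul_sub, hφ.fderiv_smul_sub, inner_add_right,
        real_inner_smul_right, real_inner_smul_right, real_inner_self_eq_norm_sq,
        variationDensity, energyDensity, kineticDensity, Set.indicator_of_mem (hΩ hXR)]
      have e : inner ℝ (streamGrad Ω ψ X) (X - X₀)
          = dist X X₀ * radialPart X₀ (streamGrad Ω ψ) X := by
        rw [radialPart]
        by_cases hd : dist X X₀ = 0
        · rw [dist_eq_zero] at hd
          simp [hd]
        · field_simp
      have e' : inner ℝ (streamGrad Ω ψ X) (X - X₀) / dist X X₀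
          = radialPart X₀ (streamGrad Ω ψ) X := rfl
      rw [e', e]
      simp only [PiLp.smul_apply, PiLp.sub_apply, smul_eq_mul]
      ring
    · intro X hXR
      simp only
      rw [hφ.divergence_smul_sub, hφ.fderiv_smul_sub, hφ.eq_zero_of_le hXR,
        hφ.deriv_eq_zero_of_le hXR]
      simp
end

/-! ### The density of a variational solution at a point -/

/-- The weighted volume of a half-disc around a point of the axis, and of a disc off the axis. -/
theorem setIntegral_halfBall_coord {X₀ : Plane} {r : ℝ} (hr : 0 < r) (hX : X₀ 1 = 0 ∨ r ≤ X₀ 1) :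
    ∫ X in halfBall X₀ r, X 1 = omegaBound X₀ * r ^ (growthExp X₀ + 1) := by
  rw [integral_halfBall hX (continuous_coord 1).measurable (b := |X₀ 1| + r) fun X hXr => by
      have h1 := abs_coord_sub_le X X₀
      have h2 : dist X X₀ < r := hXr.1
      have h3 := abs_add_le (X 1 - X₀ 1) (X₀ 1)
      rw [sub_add_cancel] at h3
      linarith, ← integral_Ioc_eq_integral_Ioo, ← intervalIntegral.integral_of_le hr.le]
  have hπ := Real.pi_pos
  by_cases h0 : X₀ 1 = 0
  · have e : arcIntegral (fun X => X 1) X₀ = fun s => 2 * s ^ 2 := by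
      funext s
      rw [arcIntegral, polarAngles, if_pos h0, ← integral_Ioc_eq_integral_Ioo,
        ← intervalIntegral.integral_of_le hπ.le]
      simp [h0]
      ring
    rw [e, omegaBound, if_pos h0, growthExp, if_pos h0]
    simp
    ring
  · have e : arcIntegral (fun X => X 1) X₀ = fun s => 2 * Real.pi * X₀ 1 * s := by
      funext s
      rw [arcIntegral, polarAngles, if_neg h0, ← integral_Ioc_eq_integral_Ioo,
        ← intervalIntegral.integral_of_le (by linarith)]
      simp
      ring
    rw [e, omegaBound, if_neg h0, growthExp, if_neg h0, intervalIntegral.integral_const_mul,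
      integral_id]
    ring

section
variable {Ω : Set Plane} {C : ℝ} {ψ I : Plane → ℝ} {X₀ : Plane} {R : ℝ}

theorem exists_halfBall_subset (hsol : IsVariationalSolution Ω C ψ I) (hX : X₀ ∈ Ω) :
    ∃ R > 0, halfBall X₀ R ⊆ Ω ∧ (X₀ 1 = 0 ∨ 2 * R ≤ X₀ 1) := by
  obtain ⟨U, hU, rfl⟩ := hsol.isOpen
  obtain ⟨ε, hε, hball⟩ := Metric.isOpen_iff.1 hU X₀ hX.1
  by_cases h0 : X₀ 1 = 0
  · exact ⟨ε, hε, Set.inter_subset_inter_left _ hball, Or.inl h0⟩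
  · have hp : 0 < X₀ 1 := lt_of_le_of_ne hX.2 (Ne.symm h0)
    refine ⟨min ε (X₀ 1 / 2), lt_min hε (by linarith), Set.inter_subset_inter_left _
      ((Metric.ball_subset_ball (min_le_left _ _)).trans hball), Or.inr ?_⟩
    have := min_le_right ε (X₀ 1 / 2)
    linarith

theorem indicator_phase_mem (hsol : IsVariationalSolution Ω C ψ I) (X : Plane) :
    Ω.indicator I X = 0 ∨ Ω.indicator I X = 1 := by
  by_cases hX : X ∈ Ω
  · rw [Set.indicator_of_mem hX]; exact hsol.values X hX
  · exact Or.inl (Set.indicator_of_notMem hX I)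

theorem energyDensity_nonneg (hsol : IsVariationalSolution Ω C ψ I) {X : Plane} (hX : 0 ≤ X 1) :
    0 ≤ energyDensity (streamGrad Ω ψ) (Ω.indicator I) X := by
  rw [energyDensity]
  rcases indicator_phase_mem hsol X with h | h <;> rw [h] <;> positivity

theorem energyDensity_le (hsol : IsVariationalSolution Ω C ψ I) {X : Plane} (hX : 0 ≤ X 1) :
    energyDensity (streamGrad Ω ψ) (Ω.indicator I) X ≤ (C ^ 2 + 1) * X 1 := by
  have h1 : (1 / X 1) * ‖streamGrad Ω ψ X‖ ^ 2 ≤ C ^ 2 * X 1 := by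
    rcases hX.eq_or_lt with h0 | h0
    · simp [← h0]
    · have := pow_le_pow_left₀ (norm_nonneg _) (norm_streamGrad_le hsol hX) 2
      rw [mul_pow, sq_abs] at this
      rw [one_div, inv_mul_le_iff₀ h0]
      linarith
  have h2 : X 1 * Ω.indicator I X ≤ X 1 := by
    rcases indicator_phase_mem hsol X with h | h <;> rw [h] <;> simp [hX]
  rw [energyDensity]
  linarith

theorem isArcBounded_energyDensity (hsol : IsVariationalSolution Ω C ψ I) (X₀ : Plane) (R : ℝ) :
    IsArcBounded X₀ R (energyDensity (streamGrad Ω ψ) (Ω.indicator I)) := by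
  refine ⟨?_, (C ^ 2 + 1) * (|X₀ 1| + R), fun X hX => ?_⟩
  · exact ((measurable_const.div (measurable_coord 1)).mul
      ((measurable_streamGrad hsol).norm.pow_const 2)).add
      ((measurable_coord 1).mul (measurable_indicator_phase hsol))
  · have hy : 0 < X 1 := hX.2
    have hd : dist X X₀ < R := hX.1
    have h1 := le_abs_self (X₀ 1)
    have h2 := (le_abs_self _).trans (abs_coord_sub_le X X₀)
    rw [abs_of_nonneg (energyDensity_nonneg hsol hy.le)]
    refine (energyDensity_le hsol hy.le).trans ?_
    gcongr
    linarith

theorem energyD_eq (hsol : IsVariationalSolution Ω C ψ I) {r : ℝ} (hΩ : halfBall X₀ r ⊆ Ω) :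
    energyD Ω ψ I X₀ r
      = ∫ X in halfBall X₀ r, energyDensity (streamGrad Ω ψ) (Ω.indicator I) X := by
  apply setIntegral_congr_ae (measurableSet_halfBall X₀ r)
  filter_upwards [weakGrad_eq_streamGrad_ae hsol, ae_pos_of_mem hsol.isOpen] with X h1 h2 hX
  rw [h1 (h2 (hΩ hX)), energyDensity, Set.indicator_of_mem (hΩ hX)]

theorem energyD_eq_interval (hsol : IsVariationalSolution Ω C ψ I) (hΩ : halfBall X₀ R ⊆ Ω)
    (hX : X₀ 1 = 0 ∨ R ≤ X₀ 1) {r : ℝ} (hr : r ∈ Set.Ioo 0 R) :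
    energyD Ω ψ I X₀ r
      = ∫ s in (0 : ℝ)..r, arcIntegral (energyDensity (streamGrad Ω ψ) (Ω.indicator I)) X₀ s := by
  rw [energyD_eq hsol ((Set.inter_subset_inter_left _ (Metric.ball_subset_ball hr.2.le)).trans hΩ),
    (isArcBounded_energyDensity hsol X₀ R).integral_halfBall_eq_interval hX hr]

theorem boundaryH_eq (hsol : IsVariationalSolution Ω C ψ I) (hΩ : halfBall X₀ R ⊆ Ω)
    (hX : X₀ 1 = 0 ∨ R ≤ X₀ 1) {r : ℝ} (hr : r ∈ Set.Ioo 0 R) :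
    boundaryH ψ X₀ r = arcIntegral (fun X => (1 / X 1) * Ω.indicator ψ X ^ 2) X₀ r := by
  have hm : Measurable fun X : Plane => (1 / X 1) * Ω.indicator ψ X ^ 2 :=
    (measurable_const.div (measurable_coord 1)).mul
      ((measurable_indicator_stream hsol).pow_const 2)
  rw [← integral_halfCircle hX hr hm]
  apply setIntegral_congr_fun (Metric.isClosed_sphere.measurableSet.inter measurableSet_upperHalf)
  intro X hXr
  have : X ∈ Ω := hΩ ⟨Metric.sphere_subset_ball hr.2 hXr.1, hXr.2⟩
  simp only
  rw [Set.indicator_of_mem this]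

theorem monoM_eq_monoQuantity (hsol : IsVariationalSolution Ω C ψ I) (hΩ : halfBall X₀ R ⊆ Ω)
    (hX : X₀ 1 = 0 ∨ R ≤ X₀ 1) {r : ℝ} (hr : r ∈ Set.Ioo 0 R) :
    monoM Ω ψ I X₀ r
      = monoQuantity X₀ (Ω.indicator ψ) (streamGrad Ω ψ) (Ω.indicator I) r := by
  rw [monoM, monoQuantity, energyD_eq_interval hsol hΩ hX hr, boundaryH_eq hsol hΩ hX hr]

theorem wVol_phase_eq (hsol : IsVariationalSolution Ω C ψ I) {r : ℝ} (hΩ : halfBall X₀ r ⊆ Ω) :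
    wVol {X | X ∈ halfBall X₀ r ∧ I X = 1}
      = ∫ X in halfBall X₀ r, X 1 * Ω.indicator I X := by
  have e : {X | X ∈ halfBall X₀ r ∧ I X = 1} = halfBall X₀ r ∩ Ω.indicator I ⁻¹' {1} := by
    ext X
    constructor
    · rintro ⟨h1, h2⟩
      refine ⟨h1, ?_⟩
      rw [Set.mem_preimage, Set.indicator_of_mem (hΩ h1), h2]; rfl
    · rintro ⟨h1, h2⟩
      refine ⟨h1, ?_⟩
      rw [Set.mem_preimage, Set.indicator_of_mem (hΩ h1)] at h2
      exact h2
  rw [wVol, e, ← setIntegral_indicator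
    (measurable_indicator_phase hsol (measurableSet_singleton 1))]
  congr 1
  funext X
  rcases indicator_phase_mem hsol X with h | h
  · rw [h, Set.indicator_of_notMem (by simp [h]), mul_zero]
  · rw [h, Set.indicator_of_mem (by simp [h]), mul_one]

theorem wVol_phase_mem (hsol : IsVariationalSolution Ω C ψ I) {r : ℝ} (hr : 0 < r)
    (hΩ : halfBall X₀ r ⊆ Ω) (hX : X₀ 1 = 0 ∨ r ≤ X₀ 1) :
    wVol {X | X ∈ halfBall X₀ r ∧ I X = 1} / r ^ (growthExp X₀ + 1)
      ∈ Set.Icc 0 (omegaBound X₀) := by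
  have hp : 0 < r ^ (growthExp X₀ + 1) := by positivity
  rw [wVol_phase_eq hsol hΩ]
  have hnn : ∀ X ∈ halfBall X₀ r, 0 ≤ X 1 * Ω.indicator I X := fun X hXr => by
    have h0 : 0 ≤ X 1 := hXr.2
    rcases indicator_phase_mem hsol X with h | h <;> rw [h] <;> simp [h0]
  constructor
  · apply div_nonneg _ hp.le
    exact setIntegral_nonneg (measurableSet_halfBall X₀ r) hnn
  · rw [div_le_iff₀ hp, ← setIntegral_halfBall_coord hr hX]
    apply integral_mono_of_nonneg
    · exact (ae_restrict_iff' (measurableSet_halfBall X₀ r)).2 (ae_of_all _ hnn)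
    · exact ((continuous_coord 1).continuousOn.integrableOn_compact
        (isCompact_closedBall X₀ r)).mono_set
          (Set.inter_subset_left.trans Metric.ball_subset_closedBall)
    · refine (ae_restrict_iff' (measurableSet_halfBall X₀ r)).2 (ae_of_all _ fun X hXr => ?_)
      have h0 : 0 ≤ X 1 := hXr.2
      rcases indicator_phase_mem hsol X with h | h <;> simp [h, h0]

theorem halfBall_mono {r : ℝ} (h : r ≤ R) : halfBall X₀ r ⊆ halfBall X₀ R :=
  Set.inter_subset_inter_left _ (Metric.ball_subset_ball h)

/-- At a point where `ψ` vanishes, the monotone quantity and the density of `{I = 1}` have a common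
limit, which is controlled by the monotone quantity at a fixed scale. -/
theorem exists_tendsto_monoM (hsol : IsVariationalSolution Ω C ψ I) (hR : 0 < R)
    (hΩ : halfBall X₀ R ⊆ Ω) (hX : X₀ 1 = 0 ∨ 2 * R ≤ X₀ 1) (h0 : ψ X₀ = 0) :
    ∃ l ∈ Set.Icc 0 (omegaBound X₀), Tendsto (monoM Ω ψ I X₀) (𝓝[>] 0) (𝓝 l) ∧
      Tendsto (fun r => wVol {X | X ∈ halfBall X₀ r ∧ I X = 1} / r ^ (growthExp X₀ + 1))
        (𝓝[>] 0) (𝓝 l) ∧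
      ∀ r ∈ Set.Ioo 0 R, l ≤ monoM Ω ψ I X₀ r + errorConst |C| * r := by
  have h := monotonicityData hsol hR hΩ hX h0
  obtain ⟨l, hl1, hl2, hl3⟩ := h.exists_tendsto
  have hev : ∀ᶠ r in 𝓝[>] (0 : ℝ), r ∈ Set.Ioo 0 R := Ioo_mem_nhdsGT hR
  have hM : ∀ r ∈ Set.Ioo 0 R, monoM Ω ψ I X₀ r
      = monoQuantity X₀ (Ω.indicator ψ) (streamGrad Ω ψ) (Ω.indicator I) r := fun r hr =>
    monoM_eq_monoQuantity hsol hΩ h.center' hr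
  have hV : Tendsto (fun r => wVol {X | X ∈ halfBall X₀ r ∧ I X = 1} / r ^ (growthExp X₀ + 1))
      (𝓝[>] 0) (𝓝 l) := by
    have := hl1.sub hl2
    rw [sub_zero] at this
    refine this.congr' ?_
    filter_upwards [hev] with r hr
    rw [wVol_phase_eq hsol ((halfBall_mono hr.2.le).trans hΩ),
      h.isArcBounded_phase.integral_halfBall_eq_interval h.center' hr, monoQuantity,
      homogeneityDefect, sub_sub_sub_cancel_right, ← mul_sub, div_eq_inv_mul]
    congr 1
    rw [← intervalIntegral.integral_sub]
    · apply intervalIntegral.integral_congr_ae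
      refine ae_of_all _ fun s hs => ?_
      rw [Set.uIoc_of_le hr.1.le] at hs
      have hs' : s ∈ Set.Ioo 0 R := ⟨hs.1, hs.2.trans_lt hr.2⟩
      rw [sub_eq_iff_eq_add', ← h.isArcBounded_kinetic.arc_add h.isArcBounded_phase h.center' hs']
      rfl
    · exact (h.isArcBounded_energy.mono hr.2.le).intervalIntegrable_arc
        (h.center'.imp_right hr.2.le.trans) hr.1
    · exact (h.isArcBounded_kinetic.mono hr.2.le).intervalIntegrable_arc
        (h.center'.imp_right hr.2.le.trans) hr.1
  refine ⟨l, ?_, hl1.congr' ?_, hV, fun r hr => (hM r hr).symm ▸ hl3 r hr⟩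
  · apply isClosed_Icc.mem_of_tendsto hV
    filter_upwards [hev] with r hr
    exact wVol_phase_mem hsol hr.1 ((halfBall_mono hr.2.le).trans hΩ)
      (h.center'.imp_right hr.2.le.trans)
  · filter_upwards [hev] with r hr
    exact (hM r hr).symm

/-- Where `ψ` is positive the boundary term dominates. -/
theorem tendsto_monoM_atBot (hsol : IsVariationalSolution Ω C ψ I) (hX₀ : X₀ ∈ Ω)
    (hpos : 0 < ψ X₀) : Tendsto (monoM Ω ψ I X₀) (𝓝[>] 0) atBot := by
  have hO := mem_positivitySet_of_pos hsol hX₀ hpos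
  have hy := positivitySet_pos hsol hO
  have hk : growthExp X₀ = 1 := by simp [growthExp, hy.ne']
  obtain ⟨R₁, hR₁, hΩ₁, hX₁⟩ := exists_halfBall_subset hsol hX₀
  have hX₁ := hX₁.resolve_left hy.ne'
  -- bounds for `ψ` near `X₀`
  have hcont : ContinuousAt ψ X₀ := (hsol.continuousOn.mono interior_subset).continuousAt
    (isOpen_interior.mem_nhds hO.1)
  obtain ⟨R₂, hR₂, hlow⟩ := Metric.eventually_nhds_iff.1
    (hcont.eventually (Ioo_mem_nhds (half_lt_self hpos) (lt_two_mul_self hpos)))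
  set R := min R₁ R₂ with hRdef
  have hR : 0 < R := lt_min hR₁ hR₂
  have hΩ : halfBall X₀ R ⊆ Ω := (halfBall_mono (min_le_left _ _)).trans hΩ₁
  have hRX : 2 * R ≤ X₀ 1 := by
    have := min_le_left R₁ R₂
    linarith
  have hX : X₀ 1 = 0 ∨ R ≤ X₀ 1 := Or.inr (by linarith)
  have hcoord : ∀ X ∈ openHalfBall X₀ R, X 1 ≤ 2 * X₀ 1 := fun X hXR => by
    have h1 := (le_abs_self _).trans (abs_coord_sub_le X X₀)
    have h2 : dist X X₀ < R := hXR.1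
    linarith
  set m := ψ X₀ / 2 with hm
  have hm0 : 0 < m := by positivity
  set A := 2 * Real.pi * ((C ^ 2 + 1) * (2 * X₀ 1)) with hA
  set b := (1 / (2 * X₀ 1)) * m ^ 2 with hb
  have hb0 : 0 < b := by positivity
  have hπ := Real.pi_pos
  have hbound : ∀ r ∈ Set.Ioo 0 R, monoM Ω ψ I X₀ r ≤ A - 2 * Real.pi * b * (r⁻¹) ^ 2 := by
    intro r hr
    have hr0 := hr.1
    have hD : energyD Ω ψ I X₀ r ≤ A * r ^ 2 := by
      rw [energyD_eq_interval hsol hΩ hX hr]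
      refine (le_abs_self _).trans ((abs_integral_arc_le hX hr
        (b := (C ^ 2 + 1) * (2 * X₀ 1)) (by positivity) fun X hXR _ => ?_).trans
          (le_of_eq (by rw [hA]; ring)))
      have hXy : 0 < X 1 := hXR.2
      rw [abs_of_nonneg (energyDensity_nonneg hsol hXy.le)]
      refine (energyDensity_le hsol hXy.le).trans ?_
      have := hcoord X hXR
      gcongr
    have hlb : ∀ θ ∈ polarAngles X₀, r * b
        ≤ r * ((1 / polarPt X₀ r θ 1) * Ω.indicator ψ (polarPt X₀ r θ) ^ 2) := by
      intro θ hθ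
      have hp := polarPt_mem_openHalfBall hX hr hθ
      have h1 := hcoord _ hp
      have h2 : 0 < polarPt X₀ r θ 1 := hp.2
      have h3 : m < ψ (polarPt X₀ r θ) :=
        (hlow ((show dist (polarPt X₀ r θ) X₀ < R from hp.1).trans_le (min_le_right _ _))).1
      rw [Set.indicator_of_mem (hΩ ⟨hp.1, h2.le⟩), hb]
      gcongr
    have hH : 2 * Real.pi * (r * b) ≤ boundaryH ψ X₀ r := by
      rw [boundaryH_eq hsol hΩ hX hr]
      have hbd : IsArcBounded X₀ R fun X => (1 / X 1) * Ω.indicator ψ X ^ 2 := by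
        refine ⟨(measurable_const.div (measurable_coord 1)).mul
          ((measurable_indicator_stream hsol).pow_const 2),
          (1 / (X₀ 1 / 2)) * (2 * ψ X₀) ^ 2, fun X hXR => ?_⟩
        have hXy : 0 < X 1 := hXR.2
        have hXd : dist X X₀ < R := hXR.1
        have h1 := abs_le.1 (abs_coord_sub_le X X₀)
        have h2 := hlow (hXd.trans_le (min_le_right _ _))
        simp only
        rw [Set.indicator_of_mem (hΩ ⟨hXR.1, hXy.le⟩), abs_of_nonneg (by positivity)]
        have h3 := h2.2.le
        have h4 : 0 ≤ ψ X := hm0.le.trans h2.1.le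
        have h5 : X₀ 1 / 2 ≤ X 1 := by linarith
        gcongr
      have := setIntegral_mono_on (integrableOn_const (volume_polarAngles_lt_top X₀).ne)
        (hbd.integrableOn_angle hX hr) (measurableSet_polarAngles X₀) hlb
      refine le_trans (le_of_eq ?_) this
      rw [setIntegral_const, polarAngles, if_neg hy.ne', Real.volume_real_Ioo_of_le (by linarith),
        smul_eq_mul]
      ring
    rw [monoM, hk]
    have h1 : ((r : ℝ) ^ (1 + 1))⁻¹ * energyD Ω ψ I X₀ r ≤ A := by
      rw [inv_mul_le_iff₀ (by positivity), mul_comm]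
      exact hD
    have h2 : 2 * Real.pi * b * (r⁻¹) ^ 2
        ≤ ((1 : ℕ) : ℝ) * ((r : ℝ) ^ (1 + 2))⁻¹ * boundaryH ψ X₀ r := by
      rw [Nat.cast_one, one_mul]
      calc 2 * Real.pi * b * (r⁻¹) ^ 2 = ((r : ℝ) ^ (1 + 2))⁻¹ * (2 * Real.pi * (r * b)) := by
            field_simp
        _ ≤ _ := by gcongr
    linarith
  have hlim : Tendsto (fun r : ℝ => A - 2 * Real.pi * b * (r⁻¹) ^ 2) (𝓝[>] 0) atBot := by
    apply tendsto_atBot_add_const_left _ A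
    rw [tendsto_neg_atBot_iff]
    exact (((tendsto_pow_atTop two_ne_zero).comp tendsto_inv_nhdsGT_zero).const_mul_atTop
      (by positivity))
  refine tendsto_atBot_mono' _ ?_ hlim
  filter_upwards [Ioo_mem_nhdsGT hR] with r hr using hbound r hr
end

/-! ### Upper semicontinuity -/

section
variable {Ω : Set Plane} {C : ℝ} {ψ I : Plane → ℝ} {X₀ : Plane} {R : ℝ}

theorem monoMZero_eq {l : EReal}
    (h : Tendsto (fun r : ℝ => (monoM Ω ψ I X₀ r : EReal)) (𝓝[>] 0) (𝓝 l)) :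
    monoMZero Ω ψ I X₀ = l := h.limUnder_eq

theorem monoMZero_eq_bot (hsol : IsVariationalSolution Ω C ψ I) (hX₀ : X₀ ∈ Ω)
    (hpos : 0 < ψ X₀) : monoMZero Ω ψ I X₀ = ⊥ :=
  monoMZero_eq (EReal.tendsto_coe_nhds_bot_iff.2 (tendsto_monoM_atBot hsol hX₀ hpos))

theorem monoMZero_mem_Icc (hsol : IsVariationalSolution Ω C ψ I) (hX₀ : X₀ ∈ Ω)
    (h0 : ψ X₀ = 0) : ∃ l ∈ Set.Icc 0 (omegaBound X₀), monoMZero Ω ψ I X₀ = (l : ℝ) := by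
  obtain ⟨R, hR, hΩ, hX⟩ := exists_halfBall_subset hsol hX₀
  obtain ⟨l, hl, h1, -, -⟩ := exists_tendsto_monoM hsol hR hΩ hX h0
  exact ⟨l, hl, monoMZero_eq (EReal.tendsto_coe.2 h1)⟩

theorem energyD_le_of_halfBall_subset (hsol : IsVariationalSolution Ω C ψ I) {X : Plane} {r s : ℝ}
    (hs : halfBall X₀ s ⊆ Ω) (hrs : halfBall X r ⊆ halfBall X₀ s) :
    energyD Ω ψ I X r ≤ energyD Ω ψ I X₀ s := by
  rw [energyD_eq hsol (hrs.trans hs), energyD_eq hsol hs]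
  have hnn : ∀ Z ∈ halfBall X₀ s, 0 ≤ energyDensity (streamGrad Ω ψ) (Ω.indicator I) Z :=
    fun Z hZ => energyDensity_nonneg hsol hZ.2
  apply setIntegral_mono_set _ _ (ae_of_all _ hrs)
  · refine Integrable.mono' (g := fun Z => (C ^ 2 + 1) * Z 1) ?_
      (isArcBounded_energyDensity hsol X₀ s).1.aestronglyMeasurable ?_
    · exact ((continuous_const.mul (continuous_coord 1)).continuousOn.integrableOn_compact
        (isCompact_closedBall X₀ s)).mono_set
          (Set.inter_subset_left.trans Metric.ball_subset_closedBall)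
    · refine (ae_restrict_iff' (measurableSet_halfBall X₀ s)).2 (ae_of_all _ fun Z hZ => ?_)
      rw [Real.norm_of_nonneg (hnn Z hZ)]
      exact energyDensity_le hsol hZ.2
  · exact (ae_restrict_iff' (measurableSet_halfBall X₀ s)).2 (ae_of_all _ hnn)

theorem halfBall_subset_add_dist (X X₀ : Plane) (r : ℝ) :
    halfBall X r ⊆ halfBall X₀ (r + dist X X₀) := by
  apply Set.inter_subset_inter_left
  apply Metric.ball_subset_ball'
  linarith

/-- The boundary integral is continuous in the centre of the half-circle, as long as the centre
stays a zero of `ψ` and does not move between the axis and its complement. -/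
theorem tendsto_arcIntegral_square (hsol : IsVariationalSolution Ω C ψ I)
    (hΩ : halfBall X₀ (2 * R) ⊆ Ω) (hX₀ : X₀ 1 = 0 ∨ 4 * R ≤ X₀ 1) {r : ℝ} (hr : r ∈ Set.Ioo 0 R)
    {T : Set Plane} (hT : ∀ X ∈ T, ψ X = 0 ∧ (X 1 = 0 ↔ X₀ 1 = 0)) :
    Tendsto (fun X => arcIntegral (fun Z => (1 / Z 1) * Ω.indicator ψ Z ^ 2) X r) (𝓝[T] X₀)
      (𝓝 (arcIntegral (fun Z => (1 / Z 1) * Ω.indicator ψ Z ^ 2) X₀ r)) := by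
  have hR := hr.1.trans hr.2
  set f : Plane → ℝ := fun Z => (1 / Z 1) * Ω.indicator ψ Z ^ 2 with hf
  have hfm : Measurable f := (measurable_const.div (measurable_coord 1)).mul
    ((measurable_indicator_stream hsol).pow_const 2)
  have hT' : ∀ X ∈ T, arcIntegral f X r = ∫ θ in polarAngles X₀, r * f (polarPt X r θ) := by
    intro X hX
    have : polarAngles X = polarAngles X₀ := by simp only [polarAngles, (hT X hX).2]
    rw [arcIntegral, this]
  refine Tendsto.congr' (f₁ := fun X => ∫ θ in polarAngles X₀, r * f (polarPt X r θ)) ?_ ?_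
  · filter_upwards [self_mem_nhdsWithin] with X hX using (hT' X hX).symm
  have hnear : ∀ᶠ X in 𝓝[T] X₀, X ∈ T ∧ dist X X₀ < R := by
    filter_upwards [self_mem_nhdsWithin, mem_nhdsWithin_of_mem_nhds (Metric.ball_mem_nhds X₀ hR)]
      with X h1 h2 using ⟨h1, h2⟩
  refine tendsto_integral_filter_of_dominated_convergence
    (fun _ => r * (9 * C ^ 2 * (|X₀ 1| + 2 * R) * R ^ 2)) ?_ ?_ (integrable_const _) ?_
  · refine Eventually.of_forall fun X => ?_
    have : Measurable fun θ => polarPt X r θ :=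
      (continuous_polarPt.comp (continuous_const.prodMk (continuous_const.prodMk
        continuous_id))).measurable
    exact ((hfm.comp this).const_mul r).aestronglyMeasurable
  · filter_upwards [hnear] with X ⟨hXT, hXd⟩
    refine (ae_restrict_iff' (measurableSet_polarAngles X₀)).2 (ae_of_all _ fun θ hθ => ?_)
    have hXc := hT X hXT
    have hcd := abs_le.1 (abs_coord_sub_le X X₀)
    have hX1 : X 1 = 0 ∨ 2 * R ≤ X 1 := by
      rcases hX₀ with h | h
      · exact Or.inl (hXc.2.2 h)
      · exact Or.inr (by linarith)
    have hsub : halfBall X R ⊆ Ω := (halfBall_subset_add_dist X X₀ R).trans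
      ((halfBall_mono (by linarith)).trans hΩ)
    have hd := monotonicityData hsol hR hsub hX1 hXc.1
    have hθ' : θ ∈ polarAngles X := by
      rwa [show polarAngles X = polarAngles X₀ by simp only [polarAngles, hXc.2]]
    have hp := polarPt_mem_openHalfBall hd.center' hr hθ'
    have hy : 0 < polarPt X r θ 1 := hp.2
    have hpd := dist_polarPt_center X hr.1.le θ
    have h1 := hd.weightedSquare_le hp
    have h2 := abs_le.1 (abs_coord_sub_le (polarPt X r θ) X)
    have h3 := le_abs_self (X₀ 1)
    rw [hpd, sq_abs] at h1
    rw [norm_mul, Real.norm_of_nonneg hr.1.le, Real.norm_of_nonneg (by positivity)]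
    apply mul_le_mul_of_nonneg_left _ hr.1.le
    refine ((le_abs_self _).trans h1).trans ?_
    have h4 : polarPt X r θ 1 ≤ |X₀ 1| + 2 * R := by linarith [hr.2]
    have := hr.1.le
    have := hr.2.le
    gcongr
  · refine (ae_restrict_iff' (measurableSet_polarAngles X₀)).2 (ae_of_all _ fun θ hθ => ?_)
    have hp := polarPt_mem_openHalfBall (hX₀.imp_right fun h => by linarith : X₀ 1 = 0 ∨ R ≤ X₀ 1)
      hr hθ
    have hy : 0 < polarPt X₀ r θ 1 := hp.2
    have hpi : polarPt X₀ r θ ∈ interior Ω := openHalfBall_subset_interior hsol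
      ((halfBall_mono (by linarith)).trans hΩ) hp
    have hψ : ContinuousAt (Ω.indicator ψ) (polarPt X₀ r θ) := by
      apply ((hsol.continuousOn.mono interior_subset).continuousAt
        (isOpen_interior.mem_nhds hpi)).congr
      filter_upwards [isOpen_interior.mem_nhds hpi] with Z hZ
      rw [Set.indicator_of_mem (interior_subset hZ)]
    have hfc : ContinuousAt f (polarPt X₀ r θ) :=
      (continuousAt_const.div (continuous_coord 1).continuousAt hy.ne').mul (hψ.pow 2)
    have hpc : ContinuousAt (fun X => polarPt X r θ) X₀ :=
      (continuous_polarPt.comp (continuous_id.prodMk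
        (continuous_const (y := (r, θ))))).continuousAt
    exact ((ContinuousAt.comp (f := fun X => polarPt X r θ) hfc hpc).tendsto.const_mul r).mono_left
      nhdsWithin_le_nhds

/-- Upper semicontinuity along zeros of `ψ` with the same growth exponent: up to a small error
`M_X(ψ, 0⁺)` is bounded by `M_X(ψ, r)` for a fixed small `r`, whose limit as the centre tends to
`X₀` is at most `M_{X₀}(ψ, r)`. -/
theorem eventually_monoMZero_lt (hsol : IsVariationalSolution Ω C ψ I) (hX₀ : X₀ ∈ Ω)
    (h0 : ψ X₀ = 0) {a : EReal} (ha : monoMZero Ω ψ I X₀ < a) {T : Set Plane}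
    (hT : ∀ X ∈ T, ψ X = 0 ∧ (X 1 = 0 ↔ X₀ 1 = 0)) :
    ∀ᶠ X in 𝓝[T] X₀, monoMZero Ω ψ I X < a := by
  obtain ⟨R', hR', hΩ', hX'⟩ := exists_halfBall_subset hsol hX₀
  set R := R' / 2 with hRdef
  have hR : 0 < R := by positivity
  have hΩ : halfBall X₀ (2 * R) ⊆ Ω := by rwa [hRdef, mul_div_cancel₀ _ two_ne_zero]
  have hX : X₀ 1 = 0 ∨ 4 * R ≤ X₀ 1 := hX'.imp_right fun h => by linarith
  obtain ⟨l, -, hl, -, -⟩ := exists_tendsto_monoM hsol hR ((halfBall_mono (by linarith)).trans hΩ)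
    (hX.imp_right fun h => by linarith) h0
  rw [monoMZero_eq (EReal.tendsto_coe.2 hl)] at ha
  obtain ⟨z, hlz, hza⟩ := EReal.lt_iff_exists_real_btwn.1 ha
  rw [EReal.coe_lt_coe_iff] at hlz
  -- a scale at which the monotone quantity at `X₀` is already below `z`
  set K := errorConst |C|
  have hlim : Tendsto (fun r => monoM Ω ψ I X₀ r + K * r) (𝓝[>] 0) (𝓝 l) := by
    have h1 : Tendsto (fun r : ℝ => K * r) (𝓝[>] 0) (𝓝 0) := by
      have : Tendsto (fun r : ℝ => K * r) (𝓝 0) (𝓝 (K * 0)) := tendsto_id.const_mul K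
      rw [mul_zero] at this
      exact this.mono_left nhdsWithin_le_nhds
    simpa using hl.add h1
  obtain ⟨r, hrz, hr⟩ := ((hlim.eventually (gt_mem_nhds hlz)).and (Ioo_mem_nhdsGT hR)).exists
  have hr2 : r ∈ Set.Ioo 0 (2 * R) := ⟨hr.1, by linarith [hr.1, hr.2]⟩
  have hX2 : X₀ 1 = 0 ∨ 2 * R ≤ X₀ 1 := hX.imp_right fun h => by linarith
  set k := growthExp X₀ with hk
  set G : ℝ → ℝ := fun s => ∫ t in (0 : ℝ)..s,
    arcIntegral (energyDensity (streamGrad Ω ψ) (Ω.indicator I)) X₀ t with hG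
  set H : Plane → ℝ := fun X => arcIntegral (fun Z => (1 / Z 1) * Ω.indicator ψ Z ^ 2) X r with hH
  have hGc : ContinuousAt G r := by
    have h1 := ((isArcBounded_energyDensity hsol X₀ (2 * R)).intervalIntegrable_arc hX2
      (by positivity))
    have h2 := intervalIntegral.continuousOn_primitive_interval'
      (a := 0) h1 (Set.left_mem_uIcc)
    rw [Set.uIcc_of_le (by positivity)] at h2
    exact h2.continuousAt (Icc_mem_nhds hr2.1 hr2.2)
  have hGX : Tendsto (fun X => G (r + dist X X₀)) (𝓝[T] X₀) (𝓝 (G r)) := by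
    have h1 : Tendsto (fun X : Plane => r + dist X X₀) (𝓝 X₀) (𝓝 (r + dist X₀ X₀)) :=
      (continuous_const.add (continuous_id.dist continuous_const)).tendsto X₀
    rw [dist_self, add_zero] at h1
    exact (hGc.tendsto.comp h1).mono_left nhdsWithin_le_nhds
  have hHX : Tendsto H (𝓝[T] X₀) (𝓝 (H X₀)) := tendsto_arcIntegral_square hsol hΩ hX hr hT
  have hlim2 : Tendsto (fun X => (r ^ (k + 1))⁻¹ * G (r + dist X X₀)
      - (k : ℝ) * (r ^ (k + 2))⁻¹ * H X + K * r) (𝓝[T] X₀)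
      (𝓝 ((r ^ (k + 1))⁻¹ * G r - (k : ℝ) * (r ^ (k + 2))⁻¹ * H X₀ + K * r)) :=
    ((hGX.const_mul _).sub (hHX.const_mul _)).add_const _
  have hval : (r ^ (k + 1))⁻¹ * G r - (k : ℝ) * (r ^ (k + 2))⁻¹ * H X₀ + K * r < z := by
    rw [monoM, energyD_eq_interval hsol hΩ hX2 hr2, boundaryH_eq hsol hΩ hX2 hr2] at hrz
    exact hrz
  filter_upwards [hlim2.eventually (gt_mem_nhds hval), self_mem_nhdsWithin,
    mem_nhdsWithin_of_mem_nhds (Metric.ball_mem_nhds X₀ (sub_pos.2 hr.2)),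
    mem_nhdsWithin_of_mem_nhds (Metric.ball_mem_nhds X₀ hR)] with X hXz hXT hXr hXR
  rw [Metric.mem_ball] at hXr hXR
  have hXc := hT X hXT
  have hcd := abs_le.1 (abs_coord_sub_le X X₀)
  have hX1 : X 1 = 0 ∨ 2 * R ≤ X 1 := by
    rcases hX with h | h
    · exact Or.inl (hXc.2.2 h)
    · exact Or.inr (by linarith)
  have hsub : halfBall X R ⊆ Ω := (halfBall_subset_add_dist X X₀ R).trans
    ((halfBall_mono (by linarith)).trans hΩ)
  obtain ⟨l', -, hl', -, hle⟩ := exists_tendsto_monoM hsol hR hsub hX1 hXc.1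
  rw [monoMZero_eq (EReal.tendsto_coe.2 hl')]
  refine lt_trans (EReal.coe_lt_coe_iff.2 (lt_of_le_of_lt ?_ hXz)) hza
  refine (hle r hr).trans ?_
  have hkX : growthExp X = k := by simp only [hk, growthExp, hXc.2]
  have hs : r + dist X X₀ ∈ Set.Ioo 0 (2 * R) :=
    ⟨by linarith [hr.1, dist_nonneg (x := X) (y := X₀)], by linarith⟩
  have hD : energyD Ω ψ I X r ≤ G (r + dist X X₀) := by
    simp only [hG]
    rw [← energyD_eq_interval hsol hΩ hX2 hs]
    exact energyD_le_of_halfBall_subset hsol ((halfBall_mono hs.2.le).trans hΩ)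
      (halfBall_subset_add_dist X X₀ r)
  rw [monoM, hkX, boundaryH_eq hsol hsub (hX1.imp_right fun h => by linarith) hr]
  have hrp := hr.1
  have := mul_le_mul_of_nonneg_left hD (by positivity : 0 ≤ (r ^ (k + 1))⁻¹)
  linarith

theorem upperSemicontinuousOn_monoMZero (hsol : IsVariationalSolution Ω C ψ I) :
    UpperSemicontinuousOn (fun X => monoMZero Ω ψ I X) Ω := by
  intro X₀ hX₀ a ha
  simp only at ha ⊢
  have hbot : ∀ X ∈ Ω, 0 < ψ X → monoMZero Ω ψ I X < a := fun X hX hpos => by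
    rw [monoMZero_eq_bot hsol hX hpos]
    exact (bot_le).trans_lt ha
  rcases (hsol.nonneg X₀ hX₀).eq_or_lt with h0 | hpos
  · set T : Set Plane := {X | X ∈ Ω ∧ ψ X = 0 ∧ (X 1 = 0 ↔ X₀ 1 = 0)} with hT
    have h1 : ∀ᶠ X in 𝓝[Ω] X₀, X ∈ T → monoMZero Ω ψ I X < a := by
      have := eventually_monoMZero_lt hsol hX₀ h0.symm ha (T := T) fun X hX => hX.2
      rw [eventually_nhdsWithin_iff] at this
      exact mem_nhdsWithin_of_mem_nhds this
    have h2 : ∀ᶠ X in 𝓝[Ω] X₀, ¬(X 1 = 0 ↔ X₀ 1 = 0) → monoMZero Ω ψ I X < a := by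
      by_cases hax : X₀ 1 = 0
      · -- off the axis the limit is at most `π y`, which tends to `0 ≤ M_{X₀}(ψ, 0⁺) < a`
        obtain ⟨l, hl, hle⟩ := monoMZero_mem_Icc hsol hX₀ h0.symm
        have ha0 : ((0 : ℝ) : EReal) < a :=
          (EReal.coe_le_coe_iff.2 hl.1).trans_lt (by rwa [← hle])
        obtain ⟨z, hz0, hza⟩ := EReal.lt_iff_exists_real_btwn.1 ha0
        rw [EReal.coe_lt_coe_iff] at hz0
        have hlim : Tendsto (fun X : Plane => X 1 * Real.pi) (𝓝[Ω] X₀) (𝓝 (X₀ 1 * Real.pi)) :=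
          (((continuous_coord 1).mul continuous_const).tendsto X₀).mono_left nhdsWithin_le_nhds
        rw [hax, zero_mul] at hlim
        filter_upwards [hlim.eventually (gt_mem_nhds hz0), self_mem_nhdsWithin] with X hXz hX hne
        rcases (hsol.nonneg X hX).eq_or_lt with h | h
        · obtain ⟨l', hl', hle'⟩ := monoMZero_mem_Icc hsol hX h.symm
          have hX1 : X 1 ≠ 0 := fun h => hne (iff_of_true h hax)
          rw [omegaBound, if_neg hX1] at hl'
          rw [hle']
          exact (EReal.coe_lt_coe_iff.2 (hl'.2.trans_lt hXz)).trans hza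
        · exact hbot X hX h
      · have : ∀ᶠ X in 𝓝[Ω] X₀, X 1 ≠ 0 := mem_nhdsWithin_of_mem_nhds
          ((continuous_coord 1).continuousAt.eventually_ne hax)
        filter_upwards [this] with X hX hne
        exact absurd (iff_of_false hX hax) hne
    filter_upwards [h1, h2, self_mem_nhdsWithin] with X hX1 hX2 hX
    rcases (hsol.nonneg X hX).eq_or_lt with h | h
    · by_cases hiff : X 1 = 0 ↔ X₀ 1 = 0
      · exact hX1 ⟨hX, h.symm, hiff⟩
      · exact hX2 hiff
    · exact hbot X hX h
  · filter_upwards [(hsol.continuousOn X₀ hX₀).eventually (lt_mem_nhds hpos),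
      self_mem_nhdsWithin] with X h1 h2 using hbot X h2 h1
end

theorem mainTheorem9 (Ω : Set Plane) (C : ℝ) (ψ I : Plane → ℝ)
    (hsol : IsVariationalSolution Ω C ψ I) :
    (∀ X₀ ∈ Ω,
      -- the limit defining `M_{X₀}(ψ, 0⁺)` exists in the extended reals
      Tendsto (fun r : ℝ => (monoM Ω ψ I X₀ r : EReal)) (𝓝[>] 0) (𝓝 (monoMZero Ω ψ I X₀)) ∧
      (monoMZero Ω ψ I X₀ = ⊥ ↔ 0 < ψ X₀) ∧
      (ψ X₀ = 0 →
        Tendsto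
          (fun r : ℝ =>
            ((wVol {X | X ∈ halfBall X₀ r ∧ I X = 1} / r ^ (growthExp X₀ + 1) : ℝ) : EReal))
          (𝓝[>] 0) (𝓝 (monoMZero Ω ψ I X₀)) ∧
        monoMZero Ω ψ I X₀ ∈ Set.Icc (0 : EReal) (omegaBound X₀ : EReal)) ∧
      (∀ r : ℝ, 0 < r → (X₀ 1 = 0 ∨ r < X₀ 1) →
        omegaBound X₀ = wVol (halfBall X₀ r) / r ^ (growthExp X₀ + 1))) ∧
    UpperSemicontinuousOn (fun X₀ => monoMZero Ω ψ I X₀) Ω := by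
  refine ⟨fun X₀ hX₀ => ?_, upperSemicontinuousOn_monoMZero hsol⟩
  have hω : ∀ r : ℝ, 0 < r → (X₀ 1 = 0 ∨ r < X₀ 1) →
      omegaBound X₀ = wVol (halfBall X₀ r) / r ^ (growthExp X₀ + 1) := fun r hr hX => by
    rw [wVol, setIntegral_halfBall_coord hr (hX.imp_right le_of_lt),
      mul_div_cancel_right₀ _ (pow_ne_zero _ hr.ne')]
  rcases (hsol.nonneg X₀ hX₀).eq_or_lt with h0 | hpos
  · obtain ⟨R, hR, hΩ, hX⟩ := exists_halfBall_subset hsol hX₀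
    obtain ⟨l, hl, h1, h2, -⟩ := exists_tendsto_monoM hsol hR hΩ hX h0.symm
    have h1' := EReal.tendsto_coe.2 h1
    rw [monoMZero_eq h1']
    refine ⟨h1', ?_, fun _ => ⟨EReal.tendsto_coe.2 h2, ?_⟩, hω⟩
    · simp [← h0]
    · exact ⟨EReal.coe_nonneg.2 hl.1, EReal.coe_le_coe_iff.2 hl.2⟩
  · have h1 := EReal.tendsto_coe_nhds_bot_iff.2 (tendsto_monoM_atBot hsol hX₀ hpos)
    rw [monoMZero_eq h1]
    exact ⟨h1, iff_of_true rfl hpos, fun h => absurd h hpos.ne', hω⟩
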